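/- We work over $\mathbb{C}$. For a finite set $S\subset\mathbb{P}^2=\mathbb{P}^2(\mathbb{C})$ let $I_d(mS)$ be the space of forms of degree $d$ in $\mathbb{C}[x_0,x_1,x_2]$ that have multiplicity at least $m$ at every point of $S$; similarly, for $Q\notin T$, $I_6(2T+2Q)=I_6(2(T\cup\{Q\}))$. Linear equivalence of divisors is denoted by $\sim$. Let $T\subset\mathbb{P}^2$ be a set of $8$ points, no $4$ on a line and no $7$ on a conic. Let $f,f'$ be cubic forms with $I_3(T)=\operatorname{span}(f,f')$ and let $g$ be a sextic form with $I_6(2T)=\operatorname{span}(f^2,ff',f'^2,g)$. Let $M$ be the ninth point of intersection of $f$ and $f'$, i.e. the intersection cycle of $V(f)$ and $V(f')$ is $M+\sum_{P\in T}P$ ($M\in T$ is allowed). Let $j=\det J(f,f',g)$ be the Jacobian determinant and $N_T=V(j)$. Then: (a) $j$ is a nonzero form of degree $9$, and the curve $N_T$ depends only on $T$: for any other choice of $f,f',g$ as above, $j$ changes only by a nonzero constant factor. (b) Every point $P\in T$ is a point of multiplicity at least $3$ of $N_T$. The multiplicity is exactly $3$ if $P=M$, or if $2P\not\sim2M$ on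 at least one nonsingular cubic $V(h)$, $h\in I_3(T)$. (c) Assume that the cubic $X=V(f)$ is nonsingular. Then for every $Q\in X$ with $Q\notin T\cup\{M\}$, $$\dim I_6(2T+2Q)>1\iff 2Q\sim2M\text{ on }X\iff Q\in N_T.$$ Moreover $M\in N_T$ if and only if $M\in T$. -/

import Mathlib

open scoped LinearAlgebra.Projectivization

noncomputable section

namespace CobleNonic

/-- The complex projective plane (its set of complex points). -/
abbrev Plane : Type := ℙ ℂ (Fin 3 → ℂ)

/-- The homogeneous coordinate ring `ℂ[x₀, x₁, x₂]` of the plane. -/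
abbrev Poly : Type := MvPolynomial (Fin 3) ℂ

/-- The point `P` lies on the curve `V(F)` (for a form `F`). -/
def OnCurve (F : Poly) (P : Plane) : Prop := MvPolynomial.eval P.rep F = 0

/-- The homogeneous prime ideal of the point `P`: all polynomials `F` that vanish on the line in
`ℂ³` which `P` represents, i.e. `F(t v) = 0` identically in `t`, for `P = [v]`. -/
def pointIdeal (P : Plane) : Ideal Poly :=
  RingHom.ker (MvPolynomial.aeval (R := ℂ)
    (fun i : Fin 3 => Polynomial.C (P.rep i) * (Polynomial.X : Polynomial ℂ)))

instance pointIdeal_isPrime (P : Plane) : (pointIdeal P).IsPrime :=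
  RingHom.ker_isPrime _

/-- The form `F` has multiplicity at least `m` at `P`: it lies in the ideal `I(P) ^ m` of the
`m`-fold fat point at `P`. (`I(P)` is generated by two linear forms `u, w`, and `I(P) ^ m` consists
of the polynomials all of whose terms have order at least `m` in the local coordinates `u, w`.) -/
def MultGE (F : Poly) (m : ℕ) (P : Plane) : Prop := F ∈ pointIdeal P ^ m

/-- The space `I_d(mS)` of forms of degree `d` that have multiplicity at least `m` at every
point of `S`. -/
def formSpace (d m : ℕ) (S : Set Plane) : Submodule ℂ Poly :=
  MvPolynomial.homogeneousSubmodule (Fin 3) ℂ d ⊓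
    ⨅ P ∈ S, (pointIdeal P ^ m).restrictScalars ℂ

/-- At most three points of `T` lie on a line, and at most six lie on a conic. -/
def GeneralEnough (T : Finset Plane) : Prop :=
  (∀ l : Poly, l.IsHomogeneous 1 → l ≠ 0 → {P : Plane | P ∈ T ∧ OnCurve l P}.ncard < 4) ∧
  (∀ q : Poly, q.IsHomogeneous 2 → q ≠ 0 → {P : Plane | P ∈ T ∧ OnCurve q P}.ncard < 7)

/-- The local intersection number `i_P(F, G)` of two plane curves, as the length of
`S_𝔭 ⧸ (F, G)`, where `S` is the homogeneous coordinate ring and `𝔭` the homogeneous prime ideal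
of `P`. It is `⊤` if `F` and `G` have a common factor vanishing at `P`. -/
def interNum (F G : Poly) (P : Plane) : ℕ∞ :=
  Module.length (Localization.AtPrime (pointIdeal P))
    (Localization.AtPrime (pointIdeal P) ⧸
      Ideal.span {algebraMap Poly (Localization.AtPrime (pointIdeal P)) F,
        algebraMap Poly (Localization.AtPrime (pointIdeal P)) G})

open scoped Classical in
/-- `M` is the ninth point of intersection of the cubics `f` and `f'` through the eight points
of `T`: the intersection cycle of `V(f)` and `V(f')` is `M + ∑_{P ∈ T} P`. (`M ∈ T` is allowed.) -/
def IsNinthPoint (T : Finset Plane) (f f' : Poly) (M : Plane) : Prop :=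
  ∀ P : Plane, interNum f f' P = (if P ∈ T then 1 else 0) + (if P = M then 1 else 0)

/-- The curve `V(f)` is nonsingular. -/
def Nonsingular (f : Poly) : Prop :=
  ∀ P : Plane, OnCurve f P → ∃ i : Fin 3, MvPolynomial.eval P.rep (MvPolynomial.pderiv i f) ≠ 0

/-- Linear equivalence of divisors supported on a nonsingular plane curve `X = V(f)`: `D - E` is
the divisor of a nonzero rational function on `X`. Such a function is a quotient `a / b` of forms
of equal degree that do not vanish identically on `X`, and its order at `P ∈ X` is
`i_P(f, a) - i_P(f, b)` (both numbers are finite). -/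
def LinEquivOn (f : Poly) (D E : Plane →₀ ℤ) : Prop :=
  ∃ (d : ℕ) (a b : Poly), a.IsHomogeneous d ∧ b.IsHomogeneous d ∧ ¬ f ∣ a ∧ ¬ f ∣ b ∧
    ∀ P : Plane, OnCurve f P →
      D P - E P = ((interNum f a P).toNat : ℤ) - ((interNum f b P).toNat : ℤ)

/-- The Jacobian determinant of three polynomials. -/
def jacobianDet (f f' g : Poly) : Poly :=
  Matrix.det (Matrix.of fun i k : Fin 3 => MvPolynomial.pderiv k (![f, f', g] i))

end CobleNonic

end

/-!
Everything rests on a description of `j` near a point `P`, on Noether's theorem, and on Bézout's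
inequality for a nonsingular cubic.

In coordinates with `P = [0 : 0 : 1]`, Euler's identity for the three forms turns `x₂ j` into the
combination `6 g {f, f'} - 3 f' {f, g} + 3 f {f', g}` of Poisson brackets in `x₀, x₁`
(`X_two_mul_jacobianDet`). The operator `x₀ ∂₀ + x₁ ∂₁` multiplies leading terms of order `m` by
`m`. Hence, for `f, f'` vanishing at `P` and `g` of order `m + 1` there, the term of order `m + 1`
of `x₂ j` is `(6 - 3 (m + 1)) {f, f'} g` (`jacobianDet_leading`). For `m = 1` it is zero: `j` has
multiplicity at least three along `T`. If `f, f'` are transverse at `P`, then subtracting a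
quadratic form in `f, f'` raises the order of `g` to three without changing `j`, and for `m = 2`
the formula shows that `j` has multiplicity four only if `g - q(f, f')` has order four. That sextic
then meets a nonsingular cubic `V(f)` at least in `2 T + 2 P`. By Bézout it meets it in nothing
else, and comparison with `f' ^ 2`, which cuts out `2 T + 2 M`, gives `2 P ∼ 2 M`.

At the ninth point the key is Noether's theorem (`mem_span_pair_of_local`): a sextic that is
singular along `T` and vanishes at `M` is `A f + B f'` with cubics `A, B`. These vanish wherever
`f, f'` are transverse; if they vanish on all of `T`, the sextic is a quadratic form in `f, f'`.
This is impossible for `g` plus such a form, since counting constants gives `dim I₆(2T) ≥ 4`. If `M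
∉ T`, it follows that `g` does not vanish at `M` and, by transversality, neither does `j`. If `M ∈
T`, some member of the pencil is singular at `M`; taking it as `f'`, the leading term of `x₂ j` is
`3 f' {f, g}`, and multiplicity four would make `g - c f ^ 2` vanish to order three at `M`, with
the same contradiction (`jacobianDet_notMem_ninth_pow_four`). In both cases `j ≠ 0`.

For `Q` on a nonsingular `V(f)` off the base locus, `dim I₆(2T + 2Q) > 1` means that there is a
sextic in this space not divisible by `f`. As above, Bézout then gives `2 Q ∼ 2 M`; and the sextic
may replace `g` in the Jacobian, which then vanishes at `Q`. Conversely, a zero of `j` at `Q` is a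
linear relation between the gradients, which yields such a sextic. A rational function `a / b` with
divisor `2 Q - 2 M` yields one as well, because Noether's theorem gives `f' ^ 2 a ∈ (f, b)`.

Intersection numbers with a nonsingular curve are valuations of a discrete valuation ring
(`exists_valuationRing`), hence additive. Bézout's inequality follows by comparing dimensions: `k`
points of `V(f)`, counted with multiplicity, impose `k` independent conditions on forms of large
degree (`card_le_of_count_le_interNum`).
-/

namespace CobleNonic

open MvPolynomial

/-! ### The order of vanishing at the coordinate point `[0 : 0 : 1]` -/

/-- The homogeneous ideal of the coordinate point `[0 : 0 : 1]`. -/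
noncomputable def originIdeal : Ideal Poly := Ideal.span {X 0, X 1}

/-- The substitution `xᵢ ↦ τ ^ wᵢ xᵢ` into polynomials in a new variable `τ`; the coefficient of
`τ ^ n` in the image of `F` is the part of `F` of weight `n`. -/
noncomputable def weightHom (w : Fin 3 → ℕ) : Poly →ₐ[ℂ] Polynomial Poly :=
  aeval fun i => Polynomial.C (X i) * Polynomial.X ^ w i

theorem weightHom_monomial (w : Fin 3 → ℕ) (s : Fin 3 →₀ ℕ) (a : ℂ) :
    weightHom w (monomial s a) =
      Polynomial.C (monomial s a) * Polynomial.X ^ (s.sum fun i k => w i * k) := by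
  rw [weightHom, aeval_monomial]
  simp only [mul_pow, Finsupp.prod_mul, ← pow_mul]
  have h1 : (s.prod fun i k => (Polynomial.X : Polynomial Poly) ^ (w i * k)) =
      Polynomial.X ^ (s.sum fun i k => w i * k) := by
    rw [Finsupp.prod, Finsupp.sum, Finset.prod_pow_eq_pow_sum]
  have h2 : (s.prod fun i k => (Polynomial.C (X i : Poly)) ^ k) =
      Polynomial.C (s.prod fun i k => (X i : Poly) ^ k) := by
    simp only [Finsupp.prod, map_prod, map_pow]
  rw [h1, h2, ← mul_assoc, MvPolynomial.monomial_eq, map_mul]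
  rfl

theorem eval_one_weightHom (w : Fin 3 → ℕ) (F : Poly) : (weightHom w F).eval 1 = F := by
  induction F using MvPolynomial.induction_on' with
  | monomial s a => simp [weightHom_monomial]
  | add p q hp hq => simp [hp, hq]

theorem coeff_weightHom_mem (n : ℕ) (F : Poly) :
    (weightHom ![1, 1, 0] F).coeff n ∈ originIdeal ^ n := by
  induction F using MvPolynomial.induction_on' with
  | add p q hp hq => simpa using add_mem hp hq
  | monomial s a =>
    rw [weightHom_monomial, Polynomial.coeff_C_mul, Polynomial.coeff_X_pow]
    split_ifs with h
    · have hn : n = s 0 + s 1 := by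
        rw [h, Finsupp.sum_fintype _ _ (by simp)]
        simp [Fin.sum_univ_three]
      have : (monomial s a : Poly) = C a * X 2 ^ s 2 * (X 0 ^ s 0 * X 1 ^ s 1) := by
        rw [MvPolynomial.monomial_eq, Finsupp.prod_fintype _ _ (by simp)]
        simp only [Fin.prod_univ_three]
        ring
      rw [mul_one, this, hn, pow_add]
      refine Ideal.mul_mem_left _ _ (Ideal.mul_mem_mul ?_ ?_)
      · exact Ideal.pow_mem_pow (Ideal.subset_span (by simp)) _
      · exact Ideal.pow_mem_pow (Ideal.subset_span (by simp)) _
    · simp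

theorem mem_originIdeal_pow_iff (n : ℕ) (F : Poly) :
    F ∈ originIdeal ^ n ↔ Polynomial.X ^ n ∣ weightHom ![1, 1, 0] F := by
  constructor
  · intro h
    have hle : originIdeal ≤ (Ideal.span {(Polynomial.X : Polynomial Poly)}).comap
        (weightHom ![1, 1, 0]) := by
      rw [originIdeal, Ideal.span_le]
      rintro x (rfl | rfl) <;>
        simp [Ideal.mem_span_singleton, weightHom]
    have h2 := Ideal.pow_right_mono hle n h
    have h3 := Ideal.le_comap_pow _ n h2
    rwa [Ideal.mem_comap, Ideal.span_singleton_pow, Ideal.mem_span_singleton] at h3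
  · intro h
    rw [Polynomial.X_pow_dvd_iff] at h
    rw [← eval_one_weightHom ![1, 1, 0] F, Polynomial.eval_eq_sum_range]
    refine Ideal.sum_mem _ fun k _ => ?_
    rw [one_pow, mul_one]
    by_cases hk : k < n
    · rw [h k hk]; exact zero_mem _
    · exact Ideal.pow_le_pow_right (not_lt.mp hk) (coeff_weightHom_mem k F)

/-- The order of vanishing at a point is additive: this is the statement that the graded ring
`⨁ I(P) ^ n / I(P) ^ (n + 1)` is a domain. -/
theorem mem_originIdeal_pow_of_mul_mem {m n : ℕ} {F G : Poly} (hF : F ∉ originIdeal ^ (m + 1))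
    (hFG : F * G ∈ originIdeal ^ (m + n)) : G ∈ originIdeal ^ n := by
  rw [mem_originIdeal_pow_iff] at *
  rw [map_mul] at hFG
  have hp : Prime (Polynomial.X : Polynomial Poly) := Polynomial.prime_X
  rw [pow_dvd_iff_le_emultiplicity] at *
  rw [emultiplicity_mul hp] at hFG
  rw [not_le] at hF
  have h1 : emultiplicity Polynomial.X (weightHom ![1, 1, 0] F) ≤ m := by
    rw [Nat.cast_add, Nat.cast_one] at hF
    exact Order.le_of_lt_add_one hF
  have h2 : ((m + n : ℕ) : ℕ∞) ≤ m + emultiplicity Polynomial.X (weightHom ![1, 1, 0] G) :=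
    hFG.trans (by gcongr)
  rw [Nat.cast_add] at h2
  exact (ENat.add_le_add_iff_left (ENat.natCast_ne_top m)).mp h2

theorem mem_originIdeal_iff (F : Poly) :
    F ∈ originIdeal ↔ aeval ![0, 0, (Polynomial.X : Polynomial ℂ)] F = 0 := by
  constructor
  · intro h
    have hle : originIdeal ≤ RingHom.ker (aeval ![0, 0, (Polynomial.X : Polynomial ℂ)]) := by
      rw [originIdeal, Ideal.span_le]
      rintro x (rfl | rfl) <;> simp [RingHom.mem_ker]
    exact hle h
  · intro h
    have key : ∀ G : Poly, G - Polynomial.aeval (X 2 : Poly)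
        (aeval ![0, 0, (Polynomial.X : Polynomial ℂ)] G) ∈ originIdeal := by
      intro G
      induction G using MvPolynomial.induction_on with
      | C a => simp
      | add p q hp hq => simpa [add_sub_add_comm] using add_mem hp hq
      | mul_X p i hp =>
        fin_cases i
        · have h0 : (X 0 : Poly) ∈ originIdeal := Ideal.subset_span (by simp)
          simpa using Ideal.mul_mem_left _ p h0
        · have h1 : (X 1 : Poly) ∈ originIdeal := Ideal.subset_span (by simp)
          simpa using Ideal.mul_mem_left _ p h1
        · simpa [← sub_mul] using Ideal.mul_mem_right _ _ hp
    simpa [h] using key F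

instance originIdeal_isPrime : originIdeal.IsPrime := by
  have : originIdeal = RingHom.ker (aeval (R := ℂ) ![0, 0, (Polynomial.X : Polynomial ℂ)]) :=
    Ideal.ext fun F => mem_originIdeal_iff F
  rw [this]
  exact RingHom.ker_isPrime _

/-! ### Linear changes of coordinates -/

/-- The substitution `F ↦ F ∘ A` of linear forms given by a matrix `A`. -/
noncomputable def substHom (A : Matrix (Fin 3) (Fin 3) ℂ) : Poly →ₐ[ℂ] Poly :=
  aeval fun i => ∑ k, C (A i k) * X k

theorem substHom_comp (A B : Matrix (Fin 3) (Fin 3) ℂ) :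
    (substHom B).comp (substHom A) = substHom (A * B) := by
  ext1 i
  simp only [substHom, AlgHom.comp_apply, aeval_X, map_sum, map_mul, algHom_C, Matrix.mul_apply,
    Finset.mul_sum, Finset.sum_mul, algebraMap_eq]
  rw [Finset.sum_comm]
  simp only [mul_assoc]

theorem substHom_one : substHom 1 = AlgHom.id ℂ Poly := by
  ext1 i
  simp [substHom, Matrix.one_apply]

/-- The change of coordinates given by an invertible matrix. -/
noncomputable def substEquiv (A : Matrix (Fin 3) (Fin 3) ℂ) (hA : IsUnit A.det) : Poly ≃ₐ[ℂ] Poly :=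
  AlgEquiv.ofAlgHom (substHom A) (substHom A⁻¹)
    (by rw [substHom_comp, Matrix.nonsing_inv_mul _ hA, substHom_one])
    (by rw [substHom_comp, Matrix.mul_nonsing_inv _ hA, substHom_one])

theorem isHomogeneous_substHom (A : Matrix (Fin 3) (Fin 3) ℂ) {F : Poly} {n : ℕ}
    (hF : F.IsHomogeneous n) : (substHom A F).IsHomogeneous n := by
  have h := IsHomogeneous.aeval (n := 1) hF (fun i => ∑ k, C (A i k) * X k)
    fun i => IsHomogeneous.sum _ _ _ fun k _ => isHomogeneous_C_mul_X _ _
  rwa [one_mul] at h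

theorem pderiv_substHom (A : Matrix (Fin 3) (Fin 3) ℂ) (F : Poly) (k : Fin 3) :
    pderiv k (substHom A F) = ∑ i, C (A i k) * substHom A (pderiv i F) := by
  induction F using MvPolynomial.induction_on with
  | C a => simp
  | add p q hp hq => simp [hp, hq, mul_add, Finset.sum_add_distrib]
  | mul_X p j hp =>
    have hX : pderiv k (substHom A (X j)) = C (A j k) := by
      simp [substHom, pderiv_X, Pi.single_apply]
    have hi : ∀ i, substHom A (pderiv i (p * X j)) =
        substHom A (pderiv i p) * substHom A (X j) + substHom A p * if i = j then 1 else 0 := by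
      intro i
      rw [pderiv_mul, map_add, map_mul, map_mul, pderiv_X, Pi.single_apply]
      simp only [eq_comm (a := i), apply_ite (substHom A), map_one, map_zero]
    rw [map_mul, pderiv_mul, hp, hX]
    simp only [hi, mul_add, Finset.sum_add_distrib, mul_ite, mul_one, mul_zero,
      Finset.sum_ite_eq', Finset.mem_univ, if_true, Finset.sum_mul, mul_assoc]
    rw [mul_comm (substHom A p)]

theorem jacobianDet_substHom (A : Matrix (Fin 3) (Fin 3) ℂ) (F G H : Poly) :
    jacobianDet (substHom A F) (substHom A G) (substHom A H) =
      C A.det * substHom A (jacobianDet F G H) := by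
  have h : (Matrix.of fun i k : Fin 3 => pderiv k (![substHom A F, substHom A G, substHom A H] i)) =
      ((substHom A).mapMatrix (Matrix.of fun i k : Fin 3 => pderiv k (![F, G, H] i))) *
        (C : ℂ →+* Poly).mapMatrix A := by
    ext1 i k
    have : ![substHom A F, substHom A G, substHom A H] i = substHom A (![F, G, H] i) := by
      fin_cases i <;> rfl
    simp [Matrix.mul_apply, this, pderiv_substHom, mul_comm]
  rw [jacobianDet, h, Matrix.det_mul, ← AlgHom.map_det, ← RingHom.map_det, mul_comm]
  rfl

theorem exists_matrix_mulVec_eq {v : Fin 3 → ℂ} (hv : v ≠ 0) :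
    ∃ A : Matrix (Fin 3) (Fin 3) ℂ, IsUnit A.det ∧ ∀ i, A i 2 = v i := by
  obtain ⟨k, hk⟩ := Function.ne_iff.mp hv
  simp only [Pi.zero_apply] at hk
  fin_cases k
  · exact ⟨!![0, 0, v 0; 1, 0, v 1; 0, 1, v 2], by simpa [Matrix.det_fin_three] using hk,
      by intro i; fin_cases i <;> rfl⟩
  · exact ⟨!![1, 0, v 0; 0, 0, v 1; 0, 1, v 2], by simpa [Matrix.det_fin_three] using hk,
      by intro i; fin_cases i <;> rfl⟩
  · exact ⟨!![1, 0, v 0; 0, 1, v 1; 0, 0, v 2], by simpa [Matrix.det_fin_three] using hk,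
      by intro i; fin_cases i <;> rfl⟩

theorem mem_pointIdeal_iff_substHom {A : Matrix (Fin 3) (Fin 3) ℂ} {P : Plane}
    (hA : ∀ i, A i 2 = P.rep i) (F : Poly) :
    F ∈ pointIdeal P ↔ substHom A F ∈ originIdeal := by
  rw [mem_originIdeal_iff, pointIdeal, RingHom.mem_ker, substHom, ← AlgHom.comp_apply, comp_aeval]
  have : (fun i => (aeval ![0, 0, (Polynomial.X : Polynomial ℂ)]) (∑ k, C (A i k) * X k : Poly)) =
      fun i => Polynomial.C (P.rep i) * (Polynomial.X : Polynomial ℂ) := by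
    funext i
    simp [Fin.sum_univ_three, hA]
  rw [this]

theorem mem_pointIdeal_pow_iff_substHom {A : Matrix (Fin 3) (Fin 3) ℂ} {P : Plane}
    (hA : ∀ i, A i 2 = P.rep i) (hd : IsUnit A.det) (n : ℕ) (F : Poly) :
    F ∈ pointIdeal P ^ n ↔ substHom A F ∈ originIdeal ^ n := by
  have h : (pointIdeal P).map (substEquiv A hd) = originIdeal := by
    ext G
    rw [Ideal.mem_map_of_equiv]
    constructor
    · rintro ⟨x, hx, rfl⟩
      exact (mem_pointIdeal_iff_substHom hA x).mp hx
    · intro hG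
      refine ⟨(substEquiv A hd).symm G, ?_, by simp⟩
      rw [mem_pointIdeal_iff_substHom hA]
      change substEquiv A hd ((substEquiv A hd).symm G) ∈ _
      simpa using hG
  have h2 : (pointIdeal P ^ n).map (substEquiv A hd) = originIdeal ^ n := by
    rw [Ideal.map_pow, h]
  rw [← h2]
  change _ ↔ substEquiv A hd F ∈ _
  rw [Ideal.mem_map_of_equiv]
  simp

/-! ### Forms, partial derivatives and powers of the ideal of a point -/

theorem aeval_mul_of_isHomogeneous {R : Type*} [CommRing R] [Algebra ℂ R] {F : Poly} {n : ℕ}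
    (hF : F.IsHomogeneous n) (g : Fin 3 → R) (r : R) :
    aeval (fun i => g i * r) F = aeval g F * r ^ n := by
  rw [aeval_def, aeval_def, eval₂_eq', eval₂_eq', Finset.sum_mul]
  refine Finset.sum_congr rfl fun s hs => ?_
  have hdeg : ∑ i, s i = n := by
    rw [hF.degree_eq_sum_deg_support hs]
    exact (Finset.sum_subset (Finset.subset_univ _) (by simp)).symm
  simp only [mul_pow, Finset.prod_mul_distrib]
  rw [Finset.prod_pow_eq_pow_sum, hdeg, mul_assoc]

theorem aeval_mul_X_of_isHomogeneous {F : Poly} {n : ℕ} (hF : F.IsHomogeneous n) (v : Fin 3 → ℂ) :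
    aeval (fun i => Polynomial.C (v i) * (Polynomial.X : Polynomial ℂ)) F =
      Polynomial.C (eval v F) * Polynomial.X ^ n := by
  rw [aeval_mul_of_isHomogeneous hF]
  congr 1
  exact aeval_algebraMap_apply (Polynomial ℂ) v F

theorem mem_pointIdeal_iff {F : Poly} {n : ℕ} (hF : F.IsHomogeneous n) (P : Plane) :
    F ∈ pointIdeal P ↔ eval P.rep F = 0 := by
  rw [pointIdeal, RingHom.mem_ker, aeval_mul_X_of_isHomogeneous hF]
  simp

theorem mem_originIdeal_iff_eval {F : Poly} {n : ℕ} (hF : F.IsHomogeneous n) :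
    F ∈ originIdeal ↔ eval ![0, 0, 1] F = 0 := by
  have h : (![0, 0, Polynomial.X] : Fin 3 → Polynomial ℂ) =
      fun i => Polynomial.C (![0, 0, 1] i) * Polynomial.X := by
    funext i; fin_cases i <;> simp
  rw [mem_originIdeal_iff, h, aeval_mul_X_of_isHomogeneous hF]
  simp

/-- A derivation lowers the order along an ideal by at most one. -/
theorem derivation_mem_pow (D : Derivation ℂ Poly Poly) (I : Ideal Poly) (m : ℕ) {F : Poly}
    (hF : F ∈ I ^ (m + 1)) : D F ∈ I ^ m := by
  induction m generalizing F with
  | zero => simp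
  | succ m ih =>
    rw [pow_succ] at hF
    refine Submodule.mul_induction_on hF ?_ ?_
    · intro a ha b hb
      rw [D.leibniz, smul_eq_mul, smul_eq_mul]
      refine add_mem (Ideal.mul_mem_right _ _ ha) ?_
      rw [pow_succ']
      exact Ideal.mul_mem_mul hb (ih ha)
    · intro a b ha hb
      rw [map_add]
      exact add_mem ha hb

theorem X_zero_mem_originIdeal : (X 0 : Poly) ∈ originIdeal := Ideal.subset_span (by simp)

theorem X_one_mem_originIdeal : (X 1 : Poly) ∈ originIdeal := Ideal.subset_span (by simp)

theorem X_two_notMem_originIdeal : (X 2 : Poly) ∉ originIdeal := by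
  rw [mem_originIdeal_iff_eval (isHomogeneous_X ℂ 2)]
  simp

/-- Euler's derivation in the local coordinates `x₀, x₁` acts on `I ^ m / I ^ (m + 1)` as
multiplication by `m`. -/
theorem localEuler_sub_mem (m : ℕ) {F : Poly} (hF : F ∈ originIdeal ^ m) :
    X 0 * pderiv 0 F + X 1 * pderiv 1 F - C (m : ℂ) * F ∈ originIdeal ^ (m + 1) := by
  have h0 : ∀ G : Poly, X 0 * pderiv 0 G + X 1 * pderiv 1 G ∈ originIdeal := fun G =>
    add_mem (Ideal.mul_mem_right _ _ X_zero_mem_originIdeal)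
      (Ideal.mul_mem_right _ _ X_one_mem_originIdeal)
  have h1 : ∀ G ∈ originIdeal, X 0 * pderiv 0 G + X 1 * pderiv 1 G - G ∈ originIdeal ^ 2 := by
    intro G hG
    obtain ⟨a, b, rfl⟩ := Ideal.mem_span_pair.mp hG
    have e : X 0 * pderiv 0 (a * X 0 + b * X 1) + X 1 * pderiv 1 (a * X 0 + b * X 1) -
        (a * X 0 + b * X 1) = X 0 * (X 0 * pderiv 0 a + X 1 * pderiv 1 a) +
          X 1 * (X 0 * pderiv 0 b + X 1 * pderiv 1 b) := by
      simp [pderiv_X]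
      ring
    rw [e, pow_two]
    exact add_mem (Ideal.mul_mem_mul X_zero_mem_originIdeal (h0 a))
      (Ideal.mul_mem_mul X_one_mem_originIdeal (h0 b))
  induction m generalizing F with
  | zero => simpa using h0 F
  | succ m ih =>
    rw [pow_succ] at hF
    refine Submodule.mul_induction_on hF ?_ ?_
    · intro a ha b hb
      have e : X 0 * pderiv 0 (a * b) + X 1 * pderiv 1 (a * b) - C ((m + 1 : ℕ) : ℂ) * (a * b) =
          (X 0 * pderiv 0 a + X 1 * pderiv 1 a - C (m : ℂ) * a) * b +
            a * (X 0 * pderiv 0 b + X 1 * pderiv 1 b - b) := by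
        simp only [pderiv_mul, Nat.cast_add, Nat.cast_one, map_add, map_one]
        ring
      rw [e]
      refine add_mem ?_ ?_
      · rw [pow_succ]; exact Ideal.mul_mem_mul (ih ha) hb
      · rw [show m + 1 + 1 = m + 2 from rfl, pow_add]; exact Ideal.mul_mem_mul ha (h1 b hb)
    · intro a b ha hb
      have e : X 0 * pderiv 0 (a + b) + X 1 * pderiv 1 (a + b) - C ((m + 1 : ℕ) : ℂ) * (a + b) =
          (X 0 * pderiv 0 a + X 1 * pderiv 1 a - C ((m + 1 : ℕ) : ℂ) * a) +
          (X 0 * pderiv 0 b + X 1 * pderiv 1 b - C ((m + 1 : ℕ) : ℂ) * b) := by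
        simp only [map_add]; ring
      rw [e]
      exact add_mem ha hb

theorem euler_three {F : Poly} {n : ℕ} (hF : F.IsHomogeneous n) :
    X 0 * pderiv 0 F + X 1 * pderiv 1 F + X 2 * pderiv 2 F = C (n : ℂ) * F := by
  have := hF.sum_X_mul_pderiv
  rw [Fin.sum_univ_three] at this
  rw [this, nsmul_eq_mul]
  simp

/-- The Poisson bracket in the local coordinates `x₀, x₁`. -/
noncomputable def bracket (F G : Poly) : Poly :=
  pderiv 0 F * pderiv 1 G - pderiv 1 F * pderiv 0 G

theorem bracket_mem (m n : ℕ) {F G : Poly} (hF : F ∈ originIdeal ^ (m + 1))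
    (hG : G ∈ originIdeal ^ (n + 1)) : bracket F G ∈ originIdeal ^ (m + n) := by
  rw [pow_add]
  exact sub_mem
    (Ideal.mul_mem_mul (derivation_mem_pow _ _ _ hF) (derivation_mem_pow _ _ _ hG))
    (Ideal.mul_mem_mul (derivation_mem_pow _ _ _ hF) (derivation_mem_pow _ _ _ hG))

/-- By Euler's identity, the Jacobian of three forms is a combination of their local Poisson
brackets. -/
theorem X_two_mul_jacobianDet {f f' g : Poly} (hf : f.IsHomogeneous 3) (hf' : f'.IsHomogeneous 3)
    (hg : g.IsHomogeneous 6) :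
    X 2 * jacobianDet f f' g =
      6 * g * bracket f f' - 3 * f' * bracket f g + 3 * f * bracket f' g := by
  have e1 := euler_three hf
  have e2 := euler_three hf'
  have e3 := euler_three hg
  have c3 : (C ((3 : ℕ) : ℂ) : Poly) = 3 := map_natCast C 3
  have c6 : (C ((6 : ℕ) : ℂ) : Poly) = 6 := map_natCast C 6
  rw [c3] at e1 e2
  rw [c6] at e3
  rw [jacobianDet, Matrix.det_fin_three]
  simp only [Matrix.of_apply, Matrix.cons_val_zero, Matrix.cons_val_one, Matrix.cons_val, bracket]
  linear_combination (pderiv 0 f' * pderiv 1 g - pderiv 1 f' * pderiv 0 g) * e1 -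
    (pderiv 0 f * pderiv 1 g - pderiv 1 f * pderiv 0 g) * e2 +
    (pderiv 0 f * pderiv 1 f' - pderiv 1 f * pderiv 0 f') * e3

/-- The leading term of `x₂ j` where `g` has order `m + 1`: modulo higher order, the local Euler
identity `f {f', g} - f' {f, g} + (m + 1) g {f, f'} = 0` holds. For `m = 1` the coefficient is `0`,
so `j` vanishes to order three rather than two. -/
theorem jacobianDet_leading {f f' g : Poly} (hf : f.IsHomogeneous 3) (hf' : f'.IsHomogeneous 3)
    (hg : g.IsHomogeneous 6) (m : ℕ) (hfm : f ∈ originIdeal) (hfm' : f' ∈ originIdeal)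
    (hgm : g ∈ originIdeal ^ (m + 1)) :
    X 2 * jacobianDet f f' g - C (6 - 3 * (m + 1 : ℂ)) * (bracket f f' * g) ∈
      originIdeal ^ (m + 2) := by
  have h1 := localEuler_sub_mem 1 (F := f) (by rwa [pow_one])
  have h2 := localEuler_sub_mem 1 (F := f') (by rwa [pow_one])
  have h3 := localEuler_sub_mem (m + 1) hgm
  have b1 := bracket_mem 0 m (F := f) (by rwa [zero_add, pow_one]) hgm
  have b2 := bracket_mem 0 m (F := f') (by rwa [zero_add, pow_one]) hgm
  rw [zero_add] at b1 b2
  have k1 := Ideal.mul_mem_mul b2 h1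
  have k2 := Ideal.mul_mem_mul b1 h2
  rw [← pow_add] at k1 k2
  have k3 := Ideal.mul_mem_left _ (bracket f f') h3
  have e : X 2 * jacobianDet f f' g - C (6 - 3 * (m + 1 : ℂ)) * (bracket f f' * g) =
      3 * (bracket f g * (X 0 * pderiv 0 f' + X 1 * pderiv 1 f' - C ((1 : ℕ) : ℂ) * f')) -
      3 * (bracket f' g * (X 0 * pderiv 0 f + X 1 * pderiv 1 f - C ((1 : ℕ) : ℂ) * f)) -
      3 * (bracket f f' * (X 0 * pderiv 0 g + X 1 * pderiv 1 g - C ((m + 1 : ℕ) : ℂ) * g)) := by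
    rw [X_two_mul_jacobianDet hf hf' hg]
    simp only [bracket, map_sub, map_add, map_mul, map_one, Nat.cast_one, Nat.cast_add]
    have c3 : (C (3 : ℂ) : Poly) = 3 := map_ofNat C 3
    have c6 : (C (6 : ℂ) : Poly) = 6 := map_ofNat C 6
    rw [c3, c6]
    ring
  rw [e]
  exact sub_mem (sub_mem (Ideal.mul_mem_left _ _ k2) (Ideal.mul_mem_left _ _ k1))
    (Ideal.mul_mem_left _ _ k3)

/-- If `f'` has a double point, the local Euler identity reads
`f {f', g} - 2 f' {f, g} + 2 g {f, f'} = 0` modulo higher order, and only the term `3 f' {f, g}` is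
left. -/
theorem jacobianDet_leading_of_tangent {f f' g : Poly} (hf : f.IsHomogeneous 3)
    (hf' : f'.IsHomogeneous 3) (hg : g.IsHomogeneous 6) (hfm : f ∈ originIdeal)
    (hfm' : f' ∈ originIdeal ^ 2) (hgm : g ∈ originIdeal ^ 2) :
    X 2 * jacobianDet f f' g - 3 * (f' * bracket f g) ∈ originIdeal ^ 4 := by
  have h1 := localEuler_sub_mem 1 (F := f) (by rwa [pow_one])
  have h2 := localEuler_sub_mem 2 hfm'
  have h3 := localEuler_sub_mem 2 hgm
  have b1 := bracket_mem 0 1 (F := f) (by rwa [zero_add, pow_one]) hgm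
  have b2 := bracket_mem 1 1 hfm' hgm
  have b3 := bracket_mem 0 1 (F := f) (by rwa [zero_add, pow_one]) hfm'
  have k1 := Ideal.mul_mem_mul b2 h1
  have k2 := Ideal.mul_mem_mul b1 h2
  have k3 := Ideal.mul_mem_mul b3 h3
  rw [← pow_add] at k1 k2 k3
  have e : X 2 * jacobianDet f f' g - 3 * (f' * bracket f g) =
      3 * (bracket f g * (X 0 * pderiv 0 f' + X 1 * pderiv 1 f' - C ((2 : ℕ) : ℂ) * f')) -
      3 * (bracket f' g * (X 0 * pderiv 0 f + X 1 * pderiv 1 f - C ((1 : ℕ) : ℂ) * f)) -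
      3 * (bracket f f' * (X 0 * pderiv 0 g + X 1 * pderiv 1 g - C ((2 : ℕ) : ℂ) * g)) := by
    rw [X_two_mul_jacobianDet hf hf' hg]
    simp only [bracket, Nat.cast_one, map_one]
    have c2 : (C ((2 : ℕ) : ℂ) : Poly) = 2 := map_natCast C 2
    rw [c2]
    ring
  rw [e]
  exact sub_mem (sub_mem (Ideal.mul_mem_left _ _ k2) (Ideal.mul_mem_left _ _ k1))
    (Ideal.mul_mem_left _ _ k3)

/-- The leading term of a form vanishing at `[0 : 0 : 1]`. -/
theorem sub_linear_part_mem {F : Poly} {n : ℕ} (hF : F.IsHomogeneous (n + 1))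
    (h : F ∈ originIdeal) :
    F - (C (eval ![0, 0, 1] (pderiv 0 F)) * X 0 + C (eval ![0, 0, 1] (pderiv 1 F)) * X 1) *
      X 2 ^ n ∈ originIdeal ^ 2 := by
  have hk : ∀ k, pderiv k F - C (eval ![0, 0, 1] (pderiv k F)) * X 2 ^ n ∈ originIdeal := by
    intro k
    have hh : (pderiv k F - C (eval ![0, 0, 1] (pderiv k F)) * X 2 ^ n).IsHomogeneous n := by
      refine IsHomogeneous.sub (by simpa using hF.pderiv (i := k)) ?_
      exact isHomogeneous_C_mul_X_pow _ _ _
    rw [mem_originIdeal_iff_eval hh]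
    simp
  have h1 := localEuler_sub_mem 1 (F := F) (by rwa [pow_one])
  have h2 := add_mem (Ideal.mul_mem_mul X_zero_mem_originIdeal (hk 0))
    (Ideal.mul_mem_mul X_one_mem_originIdeal (hk 1))
  rw [← pow_two] at h2
  convert sub_mem h2 h1 using 1
  rw [Nat.cast_one, map_one]
  ring

/-- The leading term of a form with a double point at `[0 : 0 : 1]`. -/
theorem exists_quadratic_part {F : Poly} {n : ℕ} (hF : F.IsHomogeneous (n + 2))
    (h : F ∈ originIdeal ^ 2) :
    ∃ a b c : ℂ, F - (C a * X 0 ^ 2 + C b * (X 0 * X 1) + C c * X 1 ^ 2) * X 2 ^ n ∈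
      originIdeal ^ 3 := by
  have hk : ∀ k, pderiv k F ∈ originIdeal := fun k => by
    simpa using derivation_mem_pow (pderiv k) originIdeal 1 h
  have l0 := sub_linear_part_mem (n := n) (hF.pderiv (i := 0)) (hk 0)
  have l1 := sub_linear_part_mem (n := n) (hF.pderiv (i := 1)) (hk 1)
  have h1 := localEuler_sub_mem 2 h
  have h2 := add_mem (Ideal.mul_mem_mul X_zero_mem_originIdeal l0)
    (Ideal.mul_mem_mul X_one_mem_originIdeal l1)
  rw [← pow_succ'] at h2
  have h3 := Ideal.mul_mem_left _ (C (1 / 2)) (sub_mem h2 h1)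
  set a := eval ![0, 0, 1] (pderiv 0 (pderiv 0 F))
  set b := eval ![0, 0, 1] (pderiv 1 (pderiv 0 F))
  set b' := eval ![0, 0, 1] (pderiv 0 (pderiv 1 F))
  set c := eval ![0, 0, 1] (pderiv 1 (pderiv 1 F))
  refine ⟨1 / 2 * a, 1 / 2 * (b + b'), 1 / 2 * c, ?_⟩
  convert h3 using 1
  have c2 : (C ((2 : ℕ) : ℂ) : Poly) = 2 := map_natCast C 2
  have hq : (C (1 / 2) : Poly) * 2 = 1 := by
    rw [← c2, ← C_mul]; norm_num
  simp only [map_mul, map_add, c2]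
  linear_combination (-F) * hq

theorem mem_originIdeal_sq_of_pderiv {F : Poly} (h : F ∈ originIdeal)
    (h0 : pderiv 0 F ∈ originIdeal) (h1 : pderiv 1 F ∈ originIdeal) : F ∈ originIdeal ^ 2 := by
  have e := localEuler_sub_mem 1 (F := F) (by rwa [pow_one])
  have h2 := add_mem (Ideal.mul_mem_mul X_zero_mem_originIdeal h0)
    (Ideal.mul_mem_mul X_one_mem_originIdeal h1)
  rw [← pow_two] at h2
  convert sub_mem h2 e using 1
  rw [Nat.cast_one, map_one]
  ring

/-! ### Local computations at an arbitrary point -/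

theorem exists_adapted_matrix (P : Plane) :
    ∃ A : Matrix (Fin 3) (Fin 3) ℂ, IsUnit A.det ∧ ∀ i, A i 2 = P.rep i :=
  exists_matrix_mulVec_eq P.rep_nonzero

/-- Orders of vanishing at `P` add up under multiplication. -/
theorem mem_pow_of_mul_mem {P : Plane} {m n : ℕ} {F G : Poly} (hF : F ∉ pointIdeal P ^ (m + 1))
    (hFG : F * G ∈ pointIdeal P ^ (m + n)) : G ∈ pointIdeal P ^ n := by
  obtain ⟨A, hd, hA⟩ := exists_adapted_matrix P
  rw [mem_pointIdeal_pow_iff_substHom hA hd] at *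
  rw [map_mul] at hFG
  exact mem_originIdeal_pow_of_mul_mem hF hFG

/-- A form is singular at `P` exactly if its gradient vanishes there: by Euler's identity the form
itself then vanishes too. -/
theorem mem_sq_iff {F : Poly} {n : ℕ} (hF : F.IsHomogeneous (n + 1)) (P : Plane) :
    F ∈ pointIdeal P ^ 2 ↔ ∀ k, eval P.rep (pderiv k F) = 0 := by
  have hh : ∀ k, (pderiv k F).IsHomogeneous n := fun k => by simpa using hF.pderiv (i := k)
  constructor
  · intro h k
    rw [← mem_pointIdeal_iff (hh k)]
    simpa using derivation_mem_pow (pderiv k) _ 1 h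
  · intro h
    obtain ⟨A, hd, hA⟩ := exists_adapted_matrix P
    have hk : ∀ k, pderiv k (substHom A F) ∈ originIdeal := by
      intro k
      rw [pderiv_substHom]
      refine Ideal.sum_mem _ fun i _ => Ideal.mul_mem_left _ _ ?_
      rw [← mem_pointIdeal_iff_substHom hA, mem_pointIdeal_iff (hh i)]
      exact h i
    rw [mem_pointIdeal_pow_iff_substHom hA hd]
    refine mem_originIdeal_sq_of_pderiv ?_ (hk 0) (hk 1)
    have e := euler_three (isHomogeneous_substHom A hF)
    have h1 : C ((n + 1 : ℕ) : ℂ) * substHom A F ∈ originIdeal := by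
      rw [← e]
      exact add_mem (add_mem (Ideal.mul_mem_left _ _ (hk 0)) (Ideal.mul_mem_left _ _ (hk 1)))
        (Ideal.mul_mem_left _ _ (hk 2))
    have h2 := Ideal.mul_mem_left _ (C ((n + 1 : ℕ) : ℂ)⁻¹) h1
    rwa [← mul_assoc, ← C_mul, inv_mul_cancel₀ (by exact_mod_cast n.succ_ne_zero), C_1,
      one_mul] at h2

theorem C_mul_mem_iff {I : Ideal Poly} {c : ℂ} (hc : c ≠ 0) {F : Poly} :
    C c * F ∈ I ↔ F ∈ I := by
  refine ⟨fun h => ?_, fun h => Ideal.mul_mem_left _ _ h⟩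
  have := Ideal.mul_mem_left _ (C c⁻¹) h
  rwa [← mul_assoc, ← C_mul, inv_mul_cancel₀ hc, C_1, one_mul] at this

theorem jacobianDet_mem_pow_iff {A : Matrix (Fin 3) (Fin 3) ℂ} {P : Plane}
    (hA : ∀ i, A i 2 = P.rep i) (hd : IsUnit A.det) (n : ℕ) (f f' g : Poly) :
    jacobianDet f f' g ∈ pointIdeal P ^ n ↔
      X 2 * jacobianDet (substHom A f) (substHom A f') (substHom A g) ∈ originIdeal ^ n := by
  rw [mem_pointIdeal_pow_iff_substHom hA hd, jacobianDet_substHom, mul_left_comm,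
    C_mul_mem_iff hd.ne_zero]
  refine ⟨fun h => Ideal.mul_mem_left _ _ h, fun h => ?_⟩
  exact mem_originIdeal_pow_of_mul_mem (m := 0) (by simpa using X_two_notMem_originIdeal)
    (by simpa using h)

theorem jacobianDet_mem_cube {f f' g : Poly} (hf : f.IsHomogeneous 3) (hf' : f'.IsHomogeneous 3)
    (hg : g.IsHomogeneous 6) {P : Plane} (hfm : f ∈ pointIdeal P) (hfm' : f' ∈ pointIdeal P)
    (hgm : g ∈ pointIdeal P ^ 2) : jacobianDet f f' g ∈ pointIdeal P ^ 3 := by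
  obtain ⟨A, hd, hA⟩ := exists_adapted_matrix P
  rw [jacobianDet_mem_pow_iff hA hd]
  rw [mem_pointIdeal_iff_substHom hA] at hfm hfm'
  rw [mem_pointIdeal_pow_iff_substHom hA hd] at hgm
  have := jacobianDet_leading (isHomogeneous_substHom A hf) (isHomogeneous_substHom A hf')
    (isHomogeneous_substHom A hg) 1 hfm hfm' hgm
  norm_num at this
  exact this

/-- Two forms through `P` are transverse there if their linear parts at `P` are linearly
independent. -/
def Transverse (f f' : Poly) (P : Plane) : Prop :=
  ∀ a b : ℂ, C a * f + C b * f' ∈ pointIdeal P ^ 2 → a = 0 ∧ b = 0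

/-- In coordinates centred at `P`, transversality is the nonvanishing of the local Jacobian of
`f, f'`. -/
theorem Transverse.det_ne_zero {f f' : Poly} (hf : f.IsHomogeneous 3) (hf' : f'.IsHomogeneous 3)
    {P : Plane} (hfm : f ∈ pointIdeal P) (hfm' : f' ∈ pointIdeal P) (h : Transverse f f' P)
    {A : Matrix (Fin 3) (Fin 3) ℂ} (hA : ∀ i, A i 2 = P.rep i) (hd : IsUnit A.det) :
    eval ![0, 0, 1] (pderiv 0 (substHom A f)) * eval ![0, 0, 1] (pderiv 1 (substHom A f')) -
    eval ![0, 0, 1] (pderiv 1 (substHom A f)) * eval ![0, 0, 1] (pderiv 0 (substHom A f')) ≠ 0 := by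
  rw [mem_pointIdeal_iff_substHom hA] at hfm hfm'
  have l1 := sub_linear_part_mem (isHomogeneous_substHom A hf) hfm
  have l2 := sub_linear_part_mem (isHomogeneous_substHom A hf') hfm'
  set a₁ := eval ![0, 0, 1] (pderiv 0 (substHom A f))
  set a₂ := eval ![0, 0, 1] (pderiv 1 (substHom A f))
  set b₁ := eval ![0, 0, 1] (pderiv 0 (substHom A f'))
  set b₂ := eval ![0, 0, 1] (pderiv 1 (substHom A f'))
  have key : ∀ a b : ℂ, a * a₁ + b * b₁ = 0 → a * a₂ + b * b₂ = 0 → a = 0 ∧ b = 0 := by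
    intro a b h0 h1
    apply h
    rw [mem_pointIdeal_pow_iff_substHom hA hd]
    have := add_mem (Ideal.mul_mem_left _ (C a) l1) (Ideal.mul_mem_left _ (C b) l2)
    convert this using 1
    have h0' := congrArg (C : ℂ → Poly) h0
    have h1' := congrArg (C : ℂ → Poly) h1
    simp only [C_add, C_mul, C_0] at h0' h1'
    have ca : ∀ c : ℂ, substHom A (C c) = C c := fun c => by simp [substHom]
    simp only [map_add, map_mul, ca]
    linear_combination (X 0 * X 2 ^ 2) * h0' + (X 1 * X 2 ^ 2) * h1'
  intro h0
  obtain ⟨hb1, ha1⟩ := key b₁ (-a₁) (by ring) (by linear_combination -h0)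
  obtain ⟨hb2, ha2⟩ := key b₂ (-a₂) (by linear_combination h0) (by ring)
  have := key 1 0 (by linear_combination -ha1) (by linear_combination -ha2)
  simp at this

theorem bracket_isHomogeneous {m n : ℕ} {F G : Poly} (hF : F.IsHomogeneous m)
    (hG : G.IsHomogeneous n) : (bracket F G).IsHomogeneous (m - 1 + (n - 1)) :=
  ((hF.pderiv).mul hG.pderiv).sub (hF.pderiv.mul hG.pderiv)

theorem Transverse.bracket_notMem {f f' : Poly} (hf : f.IsHomogeneous 3)
    (hf' : f'.IsHomogeneous 3) {P : Plane} (hfm : f ∈ pointIdeal P) (hfm' : f' ∈ pointIdeal P)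
    (h : Transverse f f' P)
    {A : Matrix (Fin 3) (Fin 3) ℂ} (hA : ∀ i, A i 2 = P.rep i) (hd : IsUnit A.det) :
    bracket (substHom A f) (substHom A f') ∉ originIdeal := by
  rw [mem_originIdeal_iff_eval (bracket_isHomogeneous (isHomogeneous_substHom A hf)
    (isHomogeneous_substHom A hf'))]
  simpa [bracket] using h.det_ne_zero hf hf' hfm hfm' hA hd

/-- If `g` has a triple point where `f, f'` are transverse, the leading term of `x₂ j` is
`-3 {f, f'} g`, so `j` has order four only if `g` has. -/
theorem Transverse.mem_of_jacobianDet_mem {f f' g : Poly} (hf : f.IsHomogeneous 3)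
    (hf' : f'.IsHomogeneous 3) (hg : g.IsHomogeneous 6) {P : Plane} (hfm : f ∈ pointIdeal P)
    (hfm' : f' ∈ pointIdeal P) (h : Transverse f f' P) (hgm : g ∈ pointIdeal P ^ 3)
    (hj : jacobianDet f f' g ∈ pointIdeal P ^ 4) : g ∈ pointIdeal P ^ 4 := by
  obtain ⟨A, hd, hA⟩ := exists_adapted_matrix P
  have hb := h.bracket_notMem hf hf' hfm hfm' hA hd
  rw [jacobianDet_mem_pow_iff hA hd] at hj
  rw [mem_pointIdeal_iff_substHom hA] at hfm hfm'
  rw [mem_pointIdeal_pow_iff_substHom hA hd] at hgm ⊢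
  have := jacobianDet_leading (isHomogeneous_substHom A hf) (isHomogeneous_substHom A hf')
    (isHomogeneous_substHom A hg) 2 hfm hfm' hgm
  have h1 := sub_mem hj this
  rw [sub_sub_cancel, C_mul_mem_iff (by norm_num)] at h1
  exact mem_originIdeal_pow_of_mul_mem (m := 0) (by simpa using hb) (by simpa using h1)

/-- Where `f` and `f'` are transverse, the pencil they span contains members with leading terms
`x₀` and `x₁`. -/
theorem Transverse.exists_combination {f f' : Poly} (hf : f.IsHomogeneous 3)
    (hf' : f'.IsHomogeneous 3) {P : Plane} (hfm : f ∈ pointIdeal P) (hfm' : f' ∈ pointIdeal P)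
    (h : Transverse f f' P) {A : Matrix (Fin 3) (Fin 3) ℂ} (hA : ∀ i, A i 2 = P.rep i)
    (hd : IsUnit A.det) :
    ∃ u₁ u₂ w₁ w₂ : ℂ,
      C u₁ * substHom A f + C u₂ * substHom A f' - X 0 * X 2 ^ 2 ∈ originIdeal ^ 2 ∧
      C w₁ * substHom A f + C w₂ * substHom A f' - X 1 * X 2 ^ 2 ∈ originIdeal ^ 2 := by
  have hD := h.det_ne_zero hf hf' hfm hfm' hA hd
  rw [mem_pointIdeal_iff_substHom hA] at hfm hfm'
  have l1 := sub_linear_part_mem (isHomogeneous_substHom A hf) hfm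
  have l2 := sub_linear_part_mem (isHomogeneous_substHom A hf') hfm'
  set a₁ := eval ![0, 0, 1] (pderiv 0 (substHom A f))
  set a₂ := eval ![0, 0, 1] (pderiv 1 (substHom A f))
  set b₁ := eval ![0, 0, 1] (pderiv 0 (substHom A f'))
  set b₂ := eval ![0, 0, 1] (pderiv 1 (substHom A f'))
  set D := a₁ * b₂ - a₂ * b₁
  have hDD : (C D⁻¹ : Poly) * (C a₁ * C b₂ - C a₂ * C b₁) = 1 := by
    rw [← C_mul, ← C_mul, ← C_sub, ← C_mul, inv_mul_cancel₀ hD, C_1]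
  refine ⟨D⁻¹ * b₂, -(D⁻¹ * a₂), -(D⁻¹ * b₁), D⁻¹ * a₁, ?_, ?_⟩
  · convert add_mem (Ideal.mul_mem_left _ (C (D⁻¹ * b₂)) l1)
      (Ideal.mul_mem_left _ (C (-(D⁻¹ * a₂))) l2) using 1
    simp only [C_mul, C_neg]
    linear_combination (X 0 * X 2 ^ 2) * hDD
  · convert add_mem (Ideal.mul_mem_left _ (C (-(D⁻¹ * b₁))) l1)
      (Ideal.mul_mem_left _ (C (D⁻¹ * a₁)) l2) using 1
    simp only [C_mul, C_neg]
    linear_combination (X 1 * X 2 ^ 2) * hDD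

/-- Where `f` and `f'` are transverse, the quadratic forms in `f, f'` realize every leading term
of a sextic with a double point. -/
theorem Transverse.exists_quadratic {f f' g : Poly} (hf : f.IsHomogeneous 3)
    (hf' : f'.IsHomogeneous 3) (hg : g.IsHomogeneous 6) {P : Plane} (hfm : f ∈ pointIdeal P)
    (hfm' : f' ∈ pointIdeal P) (h : Transverse f f' P) (hgm : g ∈ pointIdeal P ^ 2) :
    ∃ a b c : ℂ, g - (C a * f ^ 2 + C b * (f * f') + C c * f' ^ 2) ∈ pointIdeal P ^ 3 := by
  obtain ⟨A, hd, hA⟩ := exists_adapted_matrix P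
  obtain ⟨u₁, u₂, w₁, w₂, hu, hw⟩ := h.exists_combination hf hf' hfm hfm' hA hd
  rw [mem_pointIdeal_iff_substHom hA] at hfm hfm'
  rw [mem_pointIdeal_pow_iff_substHom hA hd] at hgm
  obtain ⟨a, b, c, l3⟩ := exists_quadratic_part (n := 4) (isHomogeneous_substHom A hg) hgm
  set U := C u₁ * substHom A f + C u₂ * substHom A f' with hU
  set W := C w₁ * substHom A f + C w₂ * substHom A f' with hW
  have hUm : U ∈ originIdeal :=
    add_mem (Ideal.mul_mem_left _ _ hfm) (Ideal.mul_mem_left _ _ hfm')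
  have hWm : W ∈ originIdeal :=
    add_mem (Ideal.mul_mem_left _ _ hfm) (Ideal.mul_mem_left _ _ hfm')
  have x0 : X 0 * X 2 ^ 2 ∈ originIdeal := Ideal.mul_mem_right _ _ X_zero_mem_originIdeal
  have x1 : X 1 * X 2 ^ 2 ∈ originIdeal := Ideal.mul_mem_right _ _ X_one_mem_originIdeal
  have m1 := Ideal.mul_mem_mul hu (add_mem hUm x0)
  have m2 := Ideal.mul_mem_mul hw (add_mem hWm x1)
  have m3 := add_mem (Ideal.mul_mem_mul hu hWm) (Ideal.mul_mem_mul hw x0)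
  rw [← pow_succ] at m1 m2 m3
  have tot := sub_mem l3 (add_mem (add_mem (Ideal.mul_mem_left _ (C a) m1)
    (Ideal.mul_mem_left _ (C b) m3)) (Ideal.mul_mem_left _ (C c) m2))
  refine ⟨a * u₁ ^ 2 + b * (u₁ * w₁) + c * w₁ ^ 2,
    2 * (a * (u₁ * u₂)) + b * (u₁ * w₂ + u₂ * w₁) + 2 * (c * (w₁ * w₂)),
    a * u₂ ^ 2 + b * (u₂ * w₂) + c * w₂ ^ 2, ?_⟩
  rw [mem_pointIdeal_pow_iff_substHom hA hd]
  convert tot using 1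
  have ca : ∀ c : ℂ, substHom A (C c) = C c := fun c => by simp [substHom]
  have c2 : (C (2 : ℂ) : Poly) = 2 := map_ofNat C 2
  have c2' : substHom A 2 = 2 := map_ofNat _ 2
  simp only [map_sub, map_add, map_mul, map_pow, ca, hU, hW, c2, c2']
  ring

/-- Transverse curves generate the ideal of the point up to second order. -/
theorem Transverse.exists_mul_mem {f f' : Poly} (hf : f.IsHomogeneous 3)
    (hf' : f'.IsHomogeneous 3) {P : Plane} (hfm : f ∈ pointIdeal P) (hfm' : f' ∈ pointIdeal P)
    (h : Transverse f f' P) :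
    ∃ s ∉ pointIdeal P, ∀ x ∈ pointIdeal P, s * x ∈ Ideal.span {f, f'} ⊔ pointIdeal P ^ 2 := by
  obtain ⟨A, hd, hA⟩ := exists_adapted_matrix P
  obtain ⟨u₁, u₂, w₁, w₂, hu, hw⟩ := h.exists_combination hf hf' hfm hfm' hA hd
  set φ := substEquiv A hd
  have hφ : ∀ F, substHom A (φ.symm F) = F := φ.apply_symm_apply
  have hφ' : ∀ F, φ.symm (substHom A F) = F := φ.symm_apply_apply
  refine ⟨φ.symm (X 2 ^ 2), ?_, fun x hx => ?_⟩
  · rw [mem_pointIdeal_iff_substHom hA, hφ]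
    exact fun h => X_two_notMem_originIdeal (originIdeal_isPrime.mem_of_pow_mem _ h)
  · rw [mem_pointIdeal_iff_substHom hA] at hx
    obtain ⟨p, q, e⟩ := Ideal.mem_span_pair.mp hx
    have e1 : φ.symm (X 2 ^ 2) * x =
        (φ.symm (p * C u₁ + q * C w₁) * f + φ.symm (p * C u₂ + q * C w₂) * f') -
        φ.symm (p * (C u₁ * substHom A f + C u₂ * substHom A f' - X 0 * X 2 ^ 2) +
          q * (C w₁ * substHom A f + C w₂ * substHom A f' - X 1 * X 2 ^ 2)) := by
      rw [← hφ' x, ← e]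
      conv_rhs => rw [← hφ' f, ← hφ' f']
      simp only [hφ]
      rw [← map_mul, ← map_mul, ← map_mul, ← map_add, ← map_sub]
      congr 1
      ring
    rw [e1]
    refine sub_mem (Ideal.mem_sup_left (Ideal.mem_span_pair.mpr ⟨_, _, rfl⟩))
      (Ideal.mem_sup_right ?_)
    rw [mem_pointIdeal_pow_iff_substHom hA hd, hφ]
    exact add_mem (Ideal.mul_mem_left _ _ hu) (Ideal.mul_mem_left _ _ hw)

/-- If `f'` has a double point at `P` and `f` is smooth there, then `j` has order at least four only
if `{f, g}` has order two, i.e. if the leading term of `g` is a multiple of that of `f ^ 2`. -/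
theorem mem_of_tangent_of_jacobianDet_mem {f f' g : Poly} (hf : f.IsHomogeneous 3)
    (hf' : f'.IsHomogeneous 3) (hg : g.IsHomogeneous 6) {P : Plane} (hfm : f ∈ pointIdeal P)
    (hfm2 : f ∉ pointIdeal P ^ 2) (hfm' : f' ∈ pointIdeal P ^ 2) (hfm3 : f' ∉ pointIdeal P ^ 3)
    (hgm : g ∈ pointIdeal P ^ 2) (hj : jacobianDet f f' g ∈ pointIdeal P ^ 4) :
    ∃ c : ℂ, g - C c * f ^ 2 ∈ pointIdeal P ^ 3 := by
  obtain ⟨A, hd, hA⟩ := exists_adapted_matrix P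
  rw [jacobianDet_mem_pow_iff hA hd] at hj
  rw [mem_pointIdeal_iff_substHom hA] at hfm
  rw [mem_pointIdeal_pow_iff_substHom hA hd] at hgm hfm2 hfm' hfm3
  have hF := isHomogeneous_substHom A hf
  have hG := isHomogeneous_substHom A hg
  have h1 := sub_mem hj (jacobianDet_leading_of_tangent hF (isHomogeneous_substHom A hf')
    hG hfm hfm' hgm)
  rw [sub_sub_cancel, show (3 : Poly) = C 3 from (map_ofNat C 3).symm,
    C_mul_mem_iff (by norm_num)] at h1
  have h2 : bracket (substHom A f) (substHom A g) ∈ originIdeal ^ 2 :=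
    mem_originIdeal_pow_of_mul_mem (m := 2) hfm3 h1
  have l1 := sub_linear_part_mem hF hfm
  obtain ⟨a, b, c, l3⟩ := exists_quadratic_part (n := 4) hG hgm
  have ca : ∀ c : ℂ, substHom A (C c) = C c := fun c => by simp [substHom]
  set a₁ := eval ![0, 0, 1] (pderiv 0 (substHom A f))
  set a₂ := eval ![0, 0, 1] (pderiv 1 (substHom A f))
  set F := substHom A f
  set G := substHom A g
  set L : Poly := (C a₁ * X 0 + C a₂ * X 1) * X 2 ^ 2 with hL
  set Q : Poly := (C a * X 0 ^ 2 + C b * (X 0 * X 1) + C c * X 1 ^ 2) * X 2 ^ 4 with hQ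
  -- the bracket of the leading terms vanishes
  have h3 : bracket L Q ∈ originIdeal ^ 2 := by
    have hLm : L ∈ originIdeal := Ideal.mul_mem_right _ _
      (add_mem (Ideal.mul_mem_left _ _ X_zero_mem_originIdeal)
        (Ideal.mul_mem_left _ _ X_one_mem_originIdeal))
    have k1 := bracket_mem 1 1 l1 hgm
    have k2 := bracket_mem 0 2 (F := L) (by rwa [zero_add, pow_one]) l3
    have := sub_mem h2 (add_mem k1 k2)
    convert this using 1
    simp only [bracket, map_sub]
    ring
  have h4 : bracket L Q = (C (a₁ * b - 2 * (a₂ * a)) * X 0 + C (2 * (a₁ * c) - a₂ * b) * X 1) *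
      X 2 ^ 6 := by
    have c2 : (C (2 : ℂ) : Poly) = 2 := map_ofNat C 2
    simp only [bracket, hL, hQ, map_sub, map_mul, c2, pderiv_mul, map_add, pderiv_C,
      pderiv_X, Pi.single_apply, Fin.isValue, pow_succ, pow_zero]
    simp
    ring
  have hX : ∀ p q : ℂ, (C p * X 0 + C q * X 1) * X 2 ^ 6 ∈ originIdeal ^ 2 → p = 0 ∧ q = 0 := by
    intro p q h
    have hh0 := derivation_mem_pow (pderiv 0) _ 1 h
    have hh1 := derivation_mem_pow (pderiv 1) _ 1 h
    rw [pow_one] at hh0 hh1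
    rw [mem_originIdeal_iff] at hh0 hh1
    constructor
    · simpa [pderiv_X, Pi.single_apply] using hh0
    · simpa [pderiv_X, Pi.single_apply] using hh1
  rw [h4] at h3
  obtain ⟨e1, e2⟩ := hX _ _ h3
  -- hence the quadratic leading term is a multiple of the square of the linear one
  have hc : ∃ e : ℂ, a = e * a₁ ^ 2 ∧ b = 2 * (e * (a₁ * a₂)) ∧ c = e * a₂ ^ 2 := by
    by_cases h1 : a₁ = 0
    · have h2 : a₂ ≠ 0 := by
        intro h2
        apply hfm2
        rw [h1, h2] at hL
        simp only [C_0, zero_mul, add_zero] at hL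
        simpa [hL] using l1
      have ha : a = 0 := by simpa [h1, h2] using e1
      have hb : b = 0 := by simpa [h1, h2] using e2
      exact ⟨c / a₂ ^ 2, by simp [h1, ha], by simp [h1, hb], by field_simp⟩
    · refine ⟨a / a₁ ^ 2, by field_simp, ?_, ?_⟩
      · field_simp
        linear_combination e1
      · field_simp
        linear_combination (a₁ / 2) * e2 + (a₂ / 2) * e1
  obtain ⟨e, rfl, rfl, rfl⟩ := hc
  refine ⟨e, ?_⟩
  rw [mem_pointIdeal_pow_iff_substHom hA hd]
  have hLm : L ∈ originIdeal := Ideal.mul_mem_right _ _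
    (add_mem (Ideal.mul_mem_left _ _ X_zero_mem_originIdeal)
      (Ideal.mul_mem_left _ _ X_one_mem_originIdeal))
  have m1 := Ideal.mul_mem_left _ (C e) (Ideal.mul_mem_mul l1 (add_mem hfm hLm))
  rw [← pow_succ] at m1
  convert sub_mem l3 m1 using 1
  have c2 : (C (2 : ℂ) : Poly) = 2 := map_ofNat C 2
  simp only [map_sub, map_mul, map_pow, ca, hQ, hL, c2]
  ring

/-- The ideal of `P` is not generated by one element `h` up to second order, even locally. -/
theorem exists_notMem_loc {P : Plane} {h : Poly} (hh : h ∈ pointIdeal P) :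
    ∃ x ∈ pointIdeal P, ∀ s B : Poly, s * x - h * B ∈ pointIdeal P ^ 2 → s ∈ pointIdeal P := by
  obtain ⟨A, hd, hA⟩ := exists_adapted_matrix P
  by_contra! hcon
  -- transport to the coordinate point
  have key : ∀ x ∈ originIdeal, ∃ s B : Poly,
      s * x - substHom A h * B ∈ originIdeal ^ 2 ∧ s ∉ originIdeal := by
    intro x hx
    have e : substHom A ((substEquiv A hd).symm x) = x := (substEquiv A hd).apply_symm_apply x
    obtain ⟨s, B, h1, h2⟩ := hcon ((substEquiv A hd).symm x)
      (by rw [mem_pointIdeal_iff_substHom hA, e]; exact hx)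
    rw [mem_pointIdeal_pow_iff_substHom hA hd, map_sub, map_mul, map_mul, e] at h1
    rw [mem_pointIdeal_iff_substHom hA] at h2
    exact ⟨_, _, h1, h2⟩
  rw [mem_pointIdeal_iff_substHom hA] at hh
  set H := substHom A h
  have hb : ∀ x ∈ originIdeal, bracket H x ∈ originIdeal := by
    intro x hx
    obtain ⟨s, B, h1, h2⟩ := key x hx
    have h3 := bracket_mem 0 1 (F := H) (by rwa [zero_add, pow_one]) h1
    rw [zero_add, pow_one] at h3
    have e : s * bracket H x = bracket H (s * x - H * B) - x * bracket H s + H * bracket H B := by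
      simp only [bracket, map_sub, pderiv_mul]
      ring
    have h4 : s * bracket H x ∈ originIdeal := by
      rw [e]
      exact add_mem (sub_mem h3 (Ideal.mul_mem_right _ _ hx)) (Ideal.mul_mem_right _ _ hh)
    exact (originIdeal_isPrime.mem_or_mem h4).resolve_left h2
  have hH : H ∈ originIdeal ^ 2 := by
    refine mem_originIdeal_sq_of_pderiv hh ?_ ?_
    · simpa [bracket, pderiv_X, Pi.single_apply] using hb _ X_one_mem_originIdeal
    · simpa [bracket, pderiv_X, Pi.single_apply] using hb _ X_zero_mem_originIdeal
  obtain ⟨s, B, h1, h2⟩ := key _ X_zero_mem_originIdeal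
  have h3 : s * X 0 ∈ originIdeal ^ 2 := by
    have := add_mem h1 (Ideal.mul_mem_right B _ hH)
    rwa [sub_add_cancel] at this
  have h4 : (X 0 : Poly) ∈ originIdeal ^ 2 :=
    mem_originIdeal_pow_of_mul_mem (m := 0) (by simpa using h2) (by simpa using h3)
  have h5 := derivation_mem_pow (pderiv 0) _ 1 h4
  rw [pderiv_X_self, pow_one] at h5
  exact originIdeal_isPrime.ne_top ((Ideal.eq_top_iff_one _).mpr h5)

/-- If `h` is smooth at `P`, the square of the ideal of `P` does not lie in `(h)` up to third order,
even locally. -/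
theorem exists_sq_notMem_loc {P : Plane} {h : Poly} (hh : h ∈ pointIdeal P)
    (hh2 : h ∉ pointIdeal P ^ 2) :
    ∃ x ∈ pointIdeal P ^ 2, ∀ s B : Poly, s * x - h * B ∈ pointIdeal P ^ 3 →
      s ∈ pointIdeal P := by
  obtain ⟨A, hd, hA⟩ := exists_adapted_matrix P
  by_contra! hcon
  have key : ∀ x ∈ originIdeal ^ 2, ∃ s B : Poly,
      s * x - substHom A h * B ∈ originIdeal ^ 3 ∧ s ∉ originIdeal := by
    intro x hx
    have e : substHom A ((substEquiv A hd).symm x) = x := (substEquiv A hd).apply_symm_apply x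
    obtain ⟨s, B, h1, h2⟩ := hcon ((substEquiv A hd).symm x)
      (by rw [mem_pointIdeal_pow_iff_substHom hA hd, e]; exact hx)
    rw [mem_pointIdeal_pow_iff_substHom hA hd, map_sub, map_mul, map_mul, e] at h1
    rw [mem_pointIdeal_iff_substHom hA] at h2
    exact ⟨_, _, h1, h2⟩
  rw [mem_pointIdeal_iff_substHom hA] at hh
  rw [mem_pointIdeal_pow_iff_substHom hA hd] at hh2
  set H := substHom A h
  have hb : ∀ y ∈ originIdeal, bracket H y ∈ originIdeal := by
    intro y hy
    by_contra hy'
    obtain ⟨s, B, h1, h2⟩ := key (y ^ 2) (Ideal.pow_mem_pow hy 2)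
    have h3 := bracket_mem 0 2 (F := H) (by rwa [zero_add, pow_one]) h1
    rw [zero_add] at h3
    -- differentiating the relation along `H` shows that `y` is a multiple of `H` up to order 2
    have e : (2 * s * bracket H y) * y =
        bracket H (s * y ^ 2 - H * B) - y ^ 2 * bracket H s + H * bracket H B := by
      simp only [bracket, map_sub, pderiv_mul, pderiv_pow]
      push_cast
      ring
    have h4 : (2 * s * bracket H y) * y - H * bracket H B ∈ originIdeal ^ 2 := by
      rw [e, add_sub_cancel_right]
      exact sub_mem h3 (Ideal.mul_mem_right _ _ (Ideal.pow_mem_pow hy 2))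
    set t := 2 * s * bracket H y
    have h5 := bracket_mem 0 1 (F := H) (by rwa [zero_add, pow_one]) h4
    rw [zero_add, pow_one] at h5
    have e2 : t * bracket H y = bracket H (t * y - H * bracket H B) - y * bracket H t +
        H * bracket H (bracket H B) := by
      simp only [bracket, map_sub, pderiv_mul]
      ring
    have h6 : t * bracket H y ∈ originIdeal := by
      rw [e2]
      exact add_mem (sub_mem h5 (Ideal.mul_mem_right _ _ hy)) (Ideal.mul_mem_right _ _ hh)
    have h7 := (originIdeal_isPrime.mem_or_mem h6).resolve_right hy'
    have h8 := (originIdeal_isPrime.mem_or_mem h7).resolve_right hy'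
    rw [show (2 : Poly) = C 2 from (map_ofNat C 2).symm, C_mul_mem_iff two_ne_zero] at h8
    exact h2 h8
  refine hh2 (mem_originIdeal_sq_of_pderiv hh ?_ ?_)
  · simpa [bracket, pderiv_X, Pi.single_apply] using hb _ X_one_mem_originIdeal
  · simpa [bracket, pderiv_X, Pi.single_apply] using hb _ X_zero_mem_originIdeal

/-- At a smooth point of `V(f)` there is a second local parameter `y`. -/
theorem exists_parameter {f : Poly} {n : ℕ} (hf : f.IsHomogeneous (n + 1)) {P : Plane}
    (hfm : f ∈ pointIdeal P) (hfm2 : f ∉ pointIdeal P ^ 2) :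
    ∃ y ∈ pointIdeal P, ∃ s ∉ pointIdeal P, ∀ x ∈ pointIdeal P,
      s * x ∈ Ideal.span {f, y} ⊔ pointIdeal P ^ 2 := by
  obtain ⟨A, hd, hA⟩ := exists_adapted_matrix P
  rw [mem_pointIdeal_iff_substHom hA] at hfm
  rw [mem_pointIdeal_pow_iff_substHom hA hd] at hfm2
  have l1 := sub_linear_part_mem (isHomogeneous_substHom A hf) hfm
  set a₁ := eval ![0, 0, 1] (pderiv 0 (substHom A f))
  set a₂ := eval ![0, 0, 1] (pderiv 1 (substHom A f))
  set φ := substEquiv A hd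
  have hφ : ∀ F, substHom A (φ.symm F) = F := φ.apply_symm_apply
  have hφ' : ∀ F, φ.symm (substHom A F) = F := φ.symm_apply_apply
  have hX2 : φ.symm (X 2 ^ n) ∉ pointIdeal P := by
    rw [mem_pointIdeal_iff_substHom hA, hφ]
    exact fun h => X_two_notMem_originIdeal (originIdeal_isPrime.mem_of_pow_mem _ h)
  have main : ∀ (y : Poly) (a : ℂ) (i : Fin 3), a ≠ 0 → y ∈ originIdeal →
      (∀ x ∈ originIdeal, ∃ p q, x = p * X i + q * y) →
      (∃ b : ℂ, substHom A f - (C a * X i + C b * y) * X 2 ^ n ∈ originIdeal ^ 2) →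
      ∃ y ∈ pointIdeal P, ∃ s ∉ pointIdeal P, ∀ x ∈ pointIdeal P,
        s * x ∈ Ideal.span {f, y} ⊔ pointIdeal P ^ 2 := by
    rintro y a i ha hy hspan ⟨b, hb⟩
    have hq : (C a⁻¹ : Poly) * C a = 1 := by rw [← C_mul, inv_mul_cancel₀ ha, C_1]
    refine ⟨φ.symm y, by rwa [mem_pointIdeal_iff_substHom hA, hφ], _, hX2, fun x hx => ?_⟩
    rw [mem_pointIdeal_iff_substHom hA] at hx
    obtain ⟨p, q, e⟩ := hspan _ hx
    have e1 : φ.symm (X 2 ^ n) * x =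
        (φ.symm (p * C a⁻¹) * f + φ.symm (X 2 ^ n * (q - p * C a⁻¹ * C b)) * φ.symm y) -
        φ.symm (p * C a⁻¹ * (substHom A f - (C a * X i + C b * y) * X 2 ^ n)) := by
      rw [← hφ' x, e]
      conv_rhs => rw [← hφ' f]
      simp only [hφ]
      rw [← map_mul, ← map_mul, ← map_mul, ← map_add, ← map_sub]
      congr 1
      linear_combination (-p * X i * X 2 ^ n) * hq
    rw [e1]
    refine sub_mem (Ideal.mem_sup_left (Ideal.mem_span_pair.mpr ⟨_, _, rfl⟩))
      (Ideal.mem_sup_right ?_)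
    rw [mem_pointIdeal_pow_iff_substHom hA hd, hφ]
    exact Ideal.mul_mem_left _ _ hb
  by_cases h1 : a₁ = 0
  · have h2 : a₂ ≠ 0 := by
      intro h2
      apply hfm2
      simpa [h1, h2] using l1
    refine main (X 0) a₂ 1 h2 X_zero_mem_originIdeal (fun x hx => ?_) ⟨a₁, ?_⟩
    · obtain ⟨p, q, e⟩ := Ideal.mem_span_pair.mp hx
      exact ⟨q, p, by rw [← e, add_comm]⟩
    · rwa [add_comm (C a₂ * X 1)]
  · refine main (X 1) a₁ 0 h1 X_one_mem_originIdeal (fun x hx => ?_) ⟨a₂, l1⟩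
    obtain ⟨p, q, e⟩ := Ideal.mem_span_pair.mp hx
    exact ⟨p, q, e.symm⟩

/-! ### Linear forms -/

/-- The linear form with given coefficients. -/
noncomputable def linForm (c : Fin 3 → ℂ) : Poly := ∑ i, C (c i) * X i

theorem isHomogeneous_linForm (c : Fin 3 → ℂ) : (linForm c).IsHomogeneous 1 :=
  IsHomogeneous.sum _ _ _ fun _ _ => isHomogeneous_C_mul_X _ _

theorem eval_linForm (c v : Fin 3 → ℂ) : eval v (linForm c) = ∑ i, c i * v i := by
  simp [linForm]

theorem exists_eval_linForm_eq (φ : Module.Dual ℂ (Fin 3 → ℂ)) :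
    ∃ c, ∀ v, eval v (linForm c) = φ v := by
  refine ⟨fun i => φ (Pi.single i 1), fun v => ?_⟩
  rw [eval_linForm]
  conv_rhs => rw [pi_eq_sum_univ' v, map_sum]
  refine Finset.sum_congr rfl fun i _ => ?_
  rw [map_smul, smul_eq_mul, mul_comm]

theorem linForm_ne_zero {c : Fin 3 → ℂ} (h : linForm c ≠ 0) : c ≠ 0 := by
  rintro rfl
  simp [linForm] at h

theorem exists_linForm_ne_zero {Z : Set Plane} (hZ : Z.Finite) :
    ∃ c, linForm c ≠ 0 ∧ ∀ P ∈ Z, ¬ OnCurve (linForm c) P := by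
  have P₀ : Plane := Projectivization.mk ℂ (fun _ => 1) (fun h => one_ne_zero (congrFun h 0))
  have : Finite (insert P₀ Z : Set Plane) := (hZ.insert P₀).to_subtype
  obtain ⟨φ, hφ⟩ := Module.exists_dual_forall_apply_ne_zero (K := ℂ)
    (fun P : (insert P₀ Z : Set Plane) => P.1.rep) fun P => P.1.rep_nonzero
  obtain ⟨c, hc⟩ := exists_eval_linForm_eq φ
  refine ⟨c, ?_, fun P hP => ?_⟩
  · intro h
    have := hφ ⟨P₀, Set.mem_insert _ _⟩
    rw [← hc, h] at this
    simp at this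
  · rw [OnCurve, hc]
    exact hφ ⟨P, Set.mem_insert_of_mem _ hP⟩

theorem exists_linForm_separating {P R : Plane} (h : R ≠ P) :
    ∃ c, OnCurve (linForm c) R ∧ ¬ OnCurve (linForm c) P := by
  have hn : P.rep ∉ ℂ ∙ R.rep := by
    intro hm
    obtain ⟨a, ha⟩ := Submodule.mem_span_singleton.mp hm
    apply h
    rw [← P.mk_rep, ← R.mk_rep, Eq.comm, Projectivization.mk_eq_mk_iff']
    exact ⟨a, ha⟩
  obtain ⟨φ, h1, h2⟩ := Submodule.exists_le_ker_of_notMem hn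
  obtain ⟨c, hc⟩ := exists_eval_linForm_eq φ
  refine ⟨c, ?_, ?_⟩
  · rw [OnCurve, hc]
    exact h2 (Submodule.mem_span_singleton_self _)
  · rwa [OnCurve, hc]

/-! ### Forms: scaling, graded pieces, factors -/

theorem eval_smul_of_isHomogeneous {F : Poly} {n : ℕ} (hF : F.IsHomogeneous n) (v : Fin 3 → ℂ)
    (a : ℂ) : eval (a • v) F = a ^ n * eval v F := by
  have := aeval_mul_of_isHomogeneous hF v a
  have e : a • v = fun i => v i * a := by
    funext i
    simp [mul_comm]
  rw [e, mul_comm]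
  exact this

theorem eval_aeval_mul_X (F : Poly) (v : Fin 3 → ℂ) (t : ℂ) :
    (aeval (fun i => Polynomial.C (v i) * (Polynomial.X : Polynomial ℂ)) F).eval t =
      eval (t • v) F := by
  induction F using MvPolynomial.induction_on with
  | C a => simp
  | add p q hp hq => rw [map_add, Polynomial.eval_add, hp, hq, map_add]
  | mul_X p i hp =>
    rw [map_mul, Polynomial.eval_mul, hp, map_mul, aeval_X, eval_X, Polynomial.eval_mul,
      Polynomial.eval_C, Polynomial.eval_X, Pi.smul_apply, smul_eq_mul, mul_comm t]

theorem homogeneousComponent_mul_of_isHomogeneous {F : Poly} {n : ℕ} (hF : F.IsHomogeneous n)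
    (A : Poly) (m : ℕ) :
    homogeneousComponent (m + n) (A * F) = homogeneousComponent m A * F := by
  conv_lhs => rw [← sum_homogeneousComponent A, Finset.sum_mul, map_sum]
  have h : ∀ i, homogeneousComponent (m + n) (homogeneousComponent i A * F) =
      if i = m then homogeneousComponent i A * F else 0 := by
    intro i
    rw [homogeneousComponent_of_mem ((homogeneousComponent_isHomogeneous i A).mul hF)]
    simp [eq_comm]
  simp only [h, Finset.sum_ite_eq', Finset.mem_range]
  split_ifs with hm
  · rfl
  · rw [homogeneousComponent_eq_zero _ _ (by omega), zero_mul]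

theorem exists_isHomogeneous_of_mem_span_pair {f f' G : Poly} {a b c d : ℕ}
    (hf : f.IsHomogeneous a) (hf' : f'.IsHomogeneous b) (hG : G.IsHomogeneous (c + a))
    (hd : c + a = d + b) (h : G ∈ Ideal.span {f, f'}) :
    ∃ A B : Poly, A.IsHomogeneous c ∧ B.IsHomogeneous d ∧ G = A * f + B * f' := by
  obtain ⟨A, B, e⟩ := Ideal.mem_span_pair.mp h
  refine ⟨_, _, homogeneousComponent_isHomogeneous c A, homogeneousComponent_isHomogeneous d B, ?_⟩
  rw [← homogeneousComponent_mul_of_isHomogeneous hf,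
    ← homogeneousComponent_mul_of_isHomogeneous hf', ← hd, ← map_add, e,
    homogeneousComponent_of_mem hG, if_pos rfl]

theorem coeff_weightHom_one_isHomogeneous (F : Poly) (n : ℕ) :
    ((weightHom ![1, 1, 1] F).coeff n).IsHomogeneous n := by
  induction F using MvPolynomial.induction_on' with
  | add p q hp hq => simpa using hp.add hq
  | monomial s a =>
    rw [weightHom_monomial, Polynomial.coeff_C_mul, Polynomial.coeff_X_pow]
    split_ifs with h
    · rw [mul_one]
      apply isHomogeneous_monomial
      rw [h, Finsupp.degree]
      refine Finset.sum_congr rfl fun i _ => ?_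
      fin_cases i <;> simp
    · simpa using isHomogeneous_zero _ _ _

/-- Factors of forms are forms: compare the degree and the order in `τ` after the substitution
`x ↦ τ x`. -/
theorem isHomogeneous_of_mul {a b : Poly} {n : ℕ} (h : (a * b).IsHomogeneous n) (h0 : a * b ≠ 0) :
    ∃ m, a.IsHomogeneous m := by
  have hw : ∀ F : Poly, F ≠ 0 → weightHom ![1, 1, 1] F ≠ 0 := by
    intro F hF h
    apply hF
    rw [← eval_one_weightHom ![1, 1, 1] F, h, Polynomial.eval_zero]
  have e : weightHom ![1, 1, 1] (a * b) = Polynomial.C (a * b) * Polynomial.X ^ n := by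
    have : (![1, 1, 1] : Fin 3 → ℕ) = fun _ => 1 := by funext i; fin_cases i <;> rfl
    rw [weightHom, this]
    simp only [pow_one]
    rw [aeval_mul_of_isHomogeneous h]
    congr 1
    induction a * b using MvPolynomial.induction_on with
    | C a => simp
    | add p q hp hq => simp [hp, hq]
    | mul_X p i hp => simp [hp]
  have ha := hw a (left_ne_zero_of_mul h0)
  have hb := hw b (right_ne_zero_of_mul h0)
  have d1 := Polynomial.natDegree_mul ha hb
  have d2 := Polynomial.natTrailingDegree_mul ha hb
  rw [← map_mul, e, Polynomial.natDegree_C_mul_X_pow _ _ h0] at d1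
  have d3 : (Polynomial.C (a * b) * Polynomial.X ^ n).natTrailingDegree = n := by
    rw [Polynomial.C_mul_X_pow_eq_monomial, Polynomial.natTrailingDegree_monomial h0]
  rw [← map_mul, e, d3] at d2
  have i1 := Polynomial.natTrailingDegree_le_natDegree (weightHom ![1, 1, 1] a)
  have i2 := Polynomial.natTrailingDegree_le_natDegree (weightHom ![1, 1, 1] b)
  refine ⟨(weightHom ![1, 1, 1] a).natDegree, ?_⟩
  have hc := coeff_weightHom_one_isHomogeneous a (weightHom ![1, 1, 1] a).natDegree
  convert hc using 1
  conv_lhs => rw [← eval_one_weightHom ![1, 1, 1] a, Polynomial.eval_eq_sum_range,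
    Finset.sum_range_succ]
  rw [Finset.sum_eq_zero, zero_add, one_pow, mul_one]
  intro i hi
  rw [Polynomial.coeff_eq_zero_of_lt_natTrailingDegree, zero_mul]
  have := Finset.mem_range.mp hi
  omega

/-! ### Noether's theorem -/

theorem eval_eq_zero_iff_onCurve {F : Poly} {n : ℕ} (hF : F.IsHomogeneous n) {v : Fin 3 → ℂ}
    (hv : v ≠ 0) : eval v F = 0 ↔ OnCurve F (Projectivization.mk ℂ v hv) := by
  obtain ⟨a, ha⟩ := Projectivization.exists_smul_eq_mk_rep ℂ v hv
  rw [OnCurve, ← ha, Units.smul_def, eval_smul_of_isHomogeneous hF]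
  simp

/-- Three forms without common zeros generate an ideal containing a power of each variable. -/
theorem exists_X_pow_mem_span {f f' : Poly} {a b : ℕ} (hf : f.IsHomogeneous a)
    (hf' : f'.IsHomogeneous b) {c : Fin 3 → ℂ}
    (h : ∀ P, OnCurve f P → OnCurve f' P → ¬ OnCurve (linForm c) P) (i : Fin 3) :
    ∃ N, (X i : Poly) ^ N ∈ Ideal.span {f, f', linForm c} := by
  have h1 : (X i : Poly) ∈ (Ideal.span {f, f', linForm c}).radical := by
    rw [← vanishingIdeal_zeroLocus_eq_radical (K := ℂ)]
    intro v hv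
    rw [zeroLocus_span] at hv
    simp only [Set.mem_insert_iff, Set.mem_singleton_iff, forall_eq_or_imp, forall_eq,
      Set.mem_ofPred_eq] at hv
    rw [aeval_X]
    by_contra hvi
    have hv0 : v ≠ 0 := by rintro rfl; exact hvi rfl
    change eval v f = 0 ∧ eval v f' = 0 ∧ eval v (linForm c) = 0 at hv
    rw [eval_eq_zero_iff_onCurve hf hv0, eval_eq_zero_iff_onCurve hf' hv0,
      eval_eq_zero_iff_onCurve (isHomogeneous_linForm c) hv0] at hv
    exact h _ hv.1 hv.2.1 hv.2.2
  exact h1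

/-- A linear form avoiding the common zeros of `f` and `f'` is not a zero divisor modulo
`(f, f')`. -/
theorem mem_span_of_linForm_mul_mem {f f' : Poly} {a b : ℕ} (hf : f.IsHomogeneous a)
    (hf' : f'.IsHomogeneous b) {c : Fin 3 → ℂ} (hc : c ≠ 0)
    (h : ∀ P, OnCurve f P → OnCurve f' P → ¬ OnCurve (linForm c) P) {G : Poly}
    (hG : linForm c * G ∈ Ideal.span {f, f'}) : G ∈ Ideal.span {f, f'} := by
  obtain ⟨k, hk⟩ := Function.ne_iff.mp hc
  simp only [Pi.zero_apply] at hk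
  set l := linForm c with hl
  -- `π` is the restriction to the line `l = 0`, realized as a retraction of the polynomial ring
  set π : Poly →ₐ[ℂ] Poly := aeval fun i => if i = k then X k - C (c k)⁻¹ * l else X i with hπ
  have πl : π l = 0 := by
    have e : l = C (c k) * X k + ∑ i ∈ Finset.univ.erase k, C (c i) * X i := by
      rw [hl, linForm, Finset.add_sum_erase _ (fun i => C (c i) * X i) (Finset.mem_univ k)]
    have e2 : π (∑ i ∈ Finset.univ.erase k, C (c i) * X i) =
        ∑ i ∈ Finset.univ.erase k, C (c i) * X i := by
      rw [map_sum]
      refine Finset.sum_congr rfl fun i hi => ?_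
      rw [map_mul, algHom_C, hπ, aeval_X, if_neg (Finset.ne_of_mem_erase hi)]
      rfl
    have e3 : π (X k) = X k - C (c k)⁻¹ * l := by rw [hπ, aeval_X, if_pos rfl]
    have e4 : (C (c k) : Poly) * C (c k)⁻¹ = 1 := by rw [← C_mul, mul_inv_cancel₀ hk, C_1]
    have e5 : π (C (c k)) = C (c k) := algHom_C _ _
    rw [e, map_add, map_mul, e2, e3, e5]
    linear_combination (-l) * e4 - e
  have πsub : ∀ F : Poly, l ∣ F - π F := by
    intro F
    induction F using MvPolynomial.induction_on with
    | C a => simp [hπ]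
    | add p q hp hq => rw [map_add, add_sub_add_comm]; exact dvd_add hp hq
    | mul_X p i hp =>
      have hX : l ∣ X i - π (X i) := by
        rw [hπ, aeval_X]
        split_ifs with hi
        · rw [hi, sub_sub_cancel]; exact dvd_mul_left _ _
        · simp
      have : p * X i - π (p * X i) = (p - π p) * X i + π p * (X i - π (X i)) := by
        rw [map_mul]; ring
      rw [this]
      exact dvd_add (dvd_mul_of_dvd_left hp _) (dvd_mul_of_dvd_right hX _)
  have hdvd : ∀ d : Poly, d ∣ π f → d ∣ π f' → ∀ i ≠ k, ∃ N, d ∣ X i ^ N := by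
    intro d h1 h2 i hi
    obtain ⟨N, hN⟩ := exists_X_pow_mem_span hf hf' h i
    refine ⟨N, ?_⟩
    have hXi : π (X i) = X i := by rw [hπ, aeval_X, if_neg hi]
    have := Ideal.mem_map_of_mem π hN
    rw [Ideal.map_span, Set.image_insert_eq, Set.image_pair, map_pow, hXi, ← hl, πl] at this
    have hle : Ideal.span {π f, π f', 0} ≤ Ideal.span {d} := by
      rw [Ideal.span_le]
      rintro x (rfl | rfl | rfl)
      · exact Ideal.mem_span_singleton.mpr h1
      · exact Ideal.mem_span_singleton.mpr h2
      · exact zero_mem _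
    exact Ideal.mem_span_singleton.mp (hle this)
  have hne : ∃ i j : Fin 3, i ≠ k ∧ j ≠ k ∧ i ≠ j := by
    fin_cases k
    · exact ⟨1, 2, by decide, by decide, by decide⟩
    · exact ⟨0, 2, by decide, by decide, by decide⟩
    · exact ⟨0, 1, by decide, by decide, by decide⟩
  obtain ⟨i, j, hi, hj, hij⟩ := hne
  have hrel : IsRelPrime (π f) (π f') := by
    intro d h1 h2
    obtain ⟨N, hN⟩ := hdvd d h1 h2 i hi
    obtain ⟨N', hN'⟩ := hdvd d h1 h2 j hj
    have hX : IsRelPrime (X i : Poly) (X j) := by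
      rw [(X_prime (i := i)).irreducible.isRelPrime_iff_not_dvd, X_dvd_X]
      exact hij
    exact (hX.pow (m := N) (n := N')) hN hN'
  obtain ⟨A, B, e⟩ := Ideal.mem_span_pair.mp hG
  have e0 : π A * π f + π B * π f' = 0 := by
    rw [← map_mul, ← map_mul, ← map_add, e, map_mul, πl, zero_mul]
  have hAB : ∃ D, π A = D * π f' ∧ π B = -D * π f := by
    by_cases h0 : π f' = 0
    · have hu : π f ≠ 0 := by
        intro h1
        obtain ⟨N, hN⟩ := hdvd 0 (by rw [h1]) (by rw [h0]) i hi
        exact pow_ne_zero N (X_ne_zero i) (zero_dvd_iff.mp hN)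
      obtain ⟨D, hD⟩ : π f ∣ π B :=
        hrel.dvd_of_dvd_mul_right ⟨-π A, by linear_combination e0⟩
      refine ⟨-D, ?_, by rw [hD]; ring⟩
      apply mul_right_cancel₀ hu
      linear_combination e0 - π f' * hD
    · obtain ⟨D, hD⟩ : π f' ∣ π A :=
        hrel.symm.dvd_of_dvd_mul_right ⟨-π B, by linear_combination e0⟩
      refine ⟨D, by rw [hD]; ring, ?_⟩
      apply mul_right_cancel₀ h0
      linear_combination e0 - π f * hD
  obtain ⟨D, hA, hB⟩ := hAB
  obtain ⟨A', hA'⟩ := πsub A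
  obtain ⟨B', hB'⟩ := πsub B
  obtain ⟨p, hp⟩ := πsub f
  obtain ⟨p', hp'⟩ := πsub f'
  have hl0 : l ≠ 0 := by
    intro h0
    have : coeff (Finsupp.single k 1) l = c k := by
      rw [hl, linForm, coeff_sum]
      simp [coeff_C_mul, coeff_X, Finsupp.single_left_inj]
    rw [h0, coeff_zero] at this
    exact hk this.symm
  rw [Ideal.mem_span_pair]
  refine ⟨A' - D * p', B' + D * p, ?_⟩
  apply mul_left_cancel₀ hl0
  linear_combination e - f * hA' - f' * hB' + f * D * hp' - f' * D * hp - f * hA - f' * hB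

/-- **Max Noether's theorem**: a form that lies in the ideal `(f, f')` locally at every point lies
in it. -/
theorem mem_span_pair_of_local {f f' G : Poly} {a b m : ℕ} (hf : f.IsHomogeneous a)
    (hf' : f'.IsHomogeneous b) (hG : G.IsHomogeneous m)
    (hfin : {P : Plane | OnCurve f P ∧ OnCurve f' P}.Finite)
    (hloc : ∀ P, OnCurve f P → OnCurve f' P →
      ∃ s, s ∉ pointIdeal P ∧ s * G ∈ Ideal.span {f, f'}) :
    G ∈ Ideal.span {f, f'} := by
  obtain ⟨c, hc0, hc⟩ := exists_linForm_ne_zero hfin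
  have hc' : ∀ P, OnCurve f P → OnCurve f' P → ¬ OnCurve (linForm c) P :=
    fun P h1 h2 => hc P ⟨h1, h2⟩
  have hloc' : ∀ P, ∃ s, s ∉ pointIdeal P ∧ s * G ∈ Ideal.span {f, f'} := by
    intro P
    by_cases h1 : OnCurve f P
    · by_cases h2 : OnCurve f' P
      · exact hloc P h1 h2
      · exact ⟨f', by rwa [mem_pointIdeal_iff hf'],
          Ideal.mul_mem_right _ _ (Ideal.subset_span (by simp))⟩
    · exact ⟨f, by rwa [mem_pointIdeal_iff hf],
          Ideal.mul_mem_right _ _ (Ideal.subset_span (by simp))⟩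
  set J : Ideal Poly := (Ideal.span {f, f'}).colon {G} with hJ
  have hmem : ∀ s, s ∈ J ↔ s * G ∈ Ideal.span {f, f'} := fun s => Submodule.mem_colon_singleton
  have hrad : linForm c ∈ J.radical := by
    rw [← vanishingIdeal_zeroLocus_eq_radical (K := ℂ)]
    intro v hv
    rw [mem_zeroLocus_iff] at hv
    by_cases hv0 : v = 0
    · change eval v _ = 0
      rw [eval_linForm, hv0]; simp
    exfalso
    obtain ⟨s, hs1, hs2⟩ := hloc' (Projectivization.mk ℂ v hv0)
    obtain ⟨u, hu⟩ := Projectivization.exists_smul_eq_mk_rep ℂ v hv0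
    rw [pointIdeal, RingHom.mem_ker] at hs1
    obtain ⟨t, ht⟩ := Infinite.exists_notMem_finset
      (insert 0 ((aeval fun i => Polynomial.C ((Projectivization.mk ℂ v hv0).rep i) *
        (Polynomial.X : Polynomial ℂ)) s).roots.toFinset)
    rw [Finset.mem_insert, not_or, Multiset.mem_toFinset, Polynomial.mem_roots hs1,
      Polynomial.IsRoot] at ht
    set r : ℂ := u * t with hr
    have hr0 : r ≠ 0 := mul_ne_zero u.ne_zero ht.1
    -- the conductor is stable under scaling of the coordinates
    set ψ : Poly →ₐ[ℂ] Poly := aeval fun i => X i * C r with hψ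
    have hψh : ∀ {F : Poly} {n : ℕ}, F.IsHomogeneous n → ψ F = C (r ^ n) * F := by
      intro F n hF
      rw [hψ, aeval_mul_of_isHomogeneous hF, aeval_X_left_apply, mul_comm, C_pow]
    have h1 : ψ s ∈ J := by
      rw [hmem]
      have := Ideal.mem_map_of_mem ψ hs2
      rw [Ideal.map_span, Set.image_pair, map_mul, hψh hG, hψh hf, hψh hf', mul_left_comm,
        C_mul_mem_iff (pow_ne_zero _ hr0)] at this
      refine (Ideal.span_le.mpr ?_) this
      rintro x (rfl | rfl)
      · exact Ideal.mul_mem_left _ _ (Ideal.subset_span (by simp))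
      · exact Ideal.mul_mem_left _ _ (Ideal.subset_span (by simp))
    have h2 := hv _ h1
    apply ht.2
    have h3 : ∀ F : Poly, aeval v (ψ F) = eval (r • v) F := by
      intro F
      rw [hψ, ← AlgHom.comp_apply, comp_aeval, ← aeval_eq_eval]
      congr 2
      funext i
      simp [mul_comm]
    have h4 : t • (Projectivization.mk ℂ v hv0).rep = r • v := by
      rw [← hu, hr, Units.smul_def, smul_smul, mul_comm]
    rw [eval_aeval_mul_X, h4, ← h3, h2]
  obtain ⟨N, hN⟩ := hrad
  rw [hmem] at hN
  clear hloc hloc' hJ hmem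
  induction N with
  | zero => simpa using hN
  | succ N ih =>
    rw [pow_succ', mul_assoc] at hN
    exact ih (mem_span_of_linForm_mul_mem hf hf' (linForm_ne_zero hc0) hc' hN)

/-- Two plane curves meet. -/
theorem exists_common_zero {f f' : Poly} {a b : ℕ} (hf : f.IsHomogeneous a)
    (hf' : f'.IsHomogeneous b) (ha : a ≠ 0) (hb : b ≠ 0) : ∃ P, OnCurve f P ∧ OnCurve f' P := by
  by_contra! h
  have h1 : (1 : Poly) ∈ Ideal.span {f, f'} := by
    refine mem_span_pair_of_local hf hf' (isHomogeneous_one _ _) ?_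
      fun P h1 h2 => absurd h2 (h P h1)
    convert Set.finite_empty
    ext P
    simpa using h P
  obtain ⟨A, B, e⟩ := Ideal.mem_span_pair.mp h1
  have h0 : ∀ {F : Poly} {n : ℕ}, F.IsHomogeneous n → n ≠ 0 → eval 0 F = 0 := by
    intro F n hF hn
    have := eval_smul_of_isHomogeneous hF 0 0
    rwa [zero_smul, zero_pow hn, zero_mul] at this
  have := congrArg (eval 0) e
  rw [map_add, map_mul, map_mul, h0 hf ha, h0 hf' hb] at this
  simp at this

/-- Two components of a reducible curve meet, and the curve is singular where they do. -/
theorem irreducible_of_nonsingular {f : Poly} {n : ℕ} (hf : f.IsHomogeneous n) (hn : n ≠ 0)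
    (hns : Nonsingular f) : Irreducible f := by
  have hf0 : f ≠ 0 := by
    rintro rfl
    obtain ⟨P, hP, -⟩ := exists_common_zero (isHomogeneous_X ℂ (0 : Fin 3))
      (isHomogeneous_X ℂ (0 : Fin 3)) one_ne_zero one_ne_zero
    obtain ⟨i, hi⟩ := hns P (by simp [OnCurve])
    simp at hi
  have hconst : ∀ a : Poly, a ≠ 0 → a.IsHomogeneous 0 → IsUnit a := by
    intro a ha h
    rw [← totalDegree_zero_iff_isHomogeneous, totalDegree_eq_zero_iff_eq_C] at h
    rw [h] at ha ⊢
    exact (isUnit_iff_ne_zero.mpr (by rintro h'; simp [h'] at ha)).map C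
  constructor
  · intro hu
    obtain ⟨P, hP, -⟩ := exists_common_zero hf hf hn hn
    exact (hu.map (eval P.rep)).ne_zero hP
  · intro a b hab
    rw [hab] at hf hf0
    obtain ⟨k, hk⟩ := isHomogeneous_of_mul hf hf0
    obtain ⟨k', hk'⟩ := isHomogeneous_of_mul (a := b) (b := a) (by rwa [mul_comm])
      (by rwa [mul_comm])
    by_cases h1 : k = 0
    · exact Or.inl (hconst a (left_ne_zero_of_mul hf0) (h1 ▸ hk))
    by_cases h2 : k' = 0
    · exact Or.inr (hconst b (right_ne_zero_of_mul hf0) (h2 ▸ hk'))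
    exfalso
    obtain ⟨P, hP, hP'⟩ := exists_common_zero hk hk' h1 h2
    rw [OnCurve] at hP hP'
    obtain ⟨i, hi⟩ := hns P (by rw [hab, OnCurve, map_mul, hP, zero_mul])
    apply hi
    rw [hab, pderiv_mul, map_add, map_mul, map_mul, hP, hP']
    simp

/-! ### The local ring of the plane at a point, and intersection numbers -/

/-- The local ring at `P` of the homogeneous coordinate ring. -/
abbrev LocalRingAt (P : Plane) : Type := Localization.AtPrime (pointIdeal P)

/-- The polynomials that lie in the ideal `I` locally at `P`. -/
noncomputable def locIdeal (P : Plane) (I : Ideal Poly) : Ideal Poly :=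
  (I.map (algebraMap Poly (LocalRingAt P))).comap (algebraMap Poly (LocalRingAt P))

theorem mem_locIdeal {P : Plane} {I : Ideal Poly} {F : Poly} :
    F ∈ locIdeal P I ↔ ∃ s ∉ pointIdeal P, s * F ∈ I := by
  rw [locIdeal, Ideal.mem_comap,
    IsLocalization.algebraMap_mem_map_algebraMap_iff (pointIdeal P).primeCompl]
  rfl

theorem locIdeal_mono {P : Plane} {I J : Ideal Poly} (h : I ≤ J) : locIdeal P I ≤ locIdeal P J :=
  Ideal.comap_mono (Ideal.map_mono h)

theorem le_locIdeal (P : Plane) (I : Ideal Poly) : I ≤ locIdeal P I := Ideal.le_comap_map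

theorem map_pointIdeal (P : Plane) :
    (pointIdeal P).map (algebraMap Poly (LocalRingAt P)) =
      IsLocalRing.maximalIdeal (LocalRingAt P) :=
  IsLocalization.AtPrime.map_eq_maximalIdeal _ _

theorem map_le_map_of_le_locIdeal {P : Plane} {I J : Ideal Poly} (h : I ≤ locIdeal P J) :
    I.map (algebraMap Poly (LocalRingAt P)) ≤ J.map (algebraMap Poly (LocalRingAt P)) :=
  Ideal.map_le_iff_le_comap.mpr h

theorem map_lt_map {P : Plane} {I J : Ideal Poly} (h : I ≤ J) {x : Poly} (hx : x ∈ J)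
    (hx' : x ∉ locIdeal P I) :
    I.map (algebraMap Poly (LocalRingAt P)) < J.map (algebraMap Poly (LocalRingAt P)) :=
  lt_of_le_of_ne (Ideal.map_mono h) fun e => hx' <| by
    rw [locIdeal, e]
    exact le_locIdeal P J hx

theorem map_pointIdeal_lt_top (P : Plane) :
    (pointIdeal P).map (algebraMap Poly (LocalRingAt P)) < ⊤ := by
  rw [map_pointIdeal]
  exact lt_top_iff_ne_top.mpr (IsLocalRing.maximalIdeal.isMaximal _).ne_top

/-- Nakayama's lemma at `P`. -/
theorem le_locIdeal_of_le_sup {P : Plane} {I J : Ideal Poly}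
    (h : I ≤ locIdeal P (J ⊔ pointIdeal P * I)) : I ≤ locIdeal P J := by
  have h1 := map_le_map_of_le_locIdeal h
  rw [Ideal.map_sup, Ideal.map_mul, map_pointIdeal, ← smul_eq_mul] at h1
  have h2 := Submodule.le_of_le_smul_of_le_jacobson_bot
    (IsNoetherian.noetherian (I.map (algebraMap Poly (LocalRingAt P))))
    (IsLocalRing.maximalIdeal_le_jacobson _) h1
  exact Ideal.map_le_iff_le_comap.mp h2

/-- The intersection number is the length of the chains of ideals above `(F, G)` in the local ring;
the estimates below exhibit such chains. -/
theorem interNum_eq_coheight (F G : Poly) (P : Plane) :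
    interNum F G P =
      Order.coheight ((Ideal.span {F, G}).map (algebraMap Poly (LocalRingAt P))) := by
  rw [interNum, Module.length_quotient, Ideal.map_span, Set.image_pair]

theorem interNum_congr {F G F' G' : Poly} (h : Ideal.span {F, G} = Ideal.span {F', G'})
    (P : Plane) : interNum F G P = interNum F' G' P := by
  rw [interNum_eq_coheight, h, interNum_eq_coheight]

theorem interNum_eq_zero_iff (F G : Poly) (P : Plane) :
    interNum F G P = 0 ↔ F ∉ pointIdeal P ∨ G ∉ pointIdeal P := by
  rw [interNum_eq_coheight, Order.coheight_eq_zero, isMax_iff_eq_top]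
  constructor
  · intro h
    by_contra! h'
    have : Ideal.span {F, G} ≤ pointIdeal P := by
      rw [Ideal.span_le]
      rintro x (rfl | rfl)
      exacts [h'.1, h'.2]
    have h2 := Ideal.map_mono (f := algebraMap Poly (LocalRingAt P)) this
    rw [h] at h2
    exact (map_pointIdeal_lt_top P).not_ge h2
  · intro h
    have : ∃ x ∈ Ideal.span {F, G}, x ∉ pointIdeal P := by
      rcases h with h | h
      · exact ⟨F, Ideal.subset_span (by simp), h⟩
      · exact ⟨G, Ideal.subset_span (by simp), h⟩
    obtain ⟨x, hx, hx'⟩ := this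
    refine Ideal.eq_top_of_isUnit_mem _ (Ideal.mem_map_of_mem _ hx) ?_
    exact IsLocalization.map_units (LocalRingAt P) (⟨x, hx'⟩ : (pointIdeal P).primeCompl)

theorem one_add_le_coheight {P : Plane} {I J : Ideal Poly} (h : I ≤ J) {x : Poly} (hx : x ∈ J)
    (hx' : x ∉ locIdeal P I) :
    Order.coheight (J.map (algebraMap Poly (LocalRingAt P))) + 1 ≤
      Order.coheight (I.map (algebraMap Poly (LocalRingAt P))) :=
  Order.coheight_add_one_le (map_lt_map h hx hx')

theorem one_le_coheight_pointIdeal (P : Plane) :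
    1 ≤ Order.coheight ((pointIdeal P).map (algebraMap Poly (LocalRingAt P))) := by
  simpa using Order.coheight_add_one_le (map_pointIdeal_lt_top P)

/-- If `i_P(f, f') = 1`, then `f, f'` generate the ideal of `P` locally. -/
theorem le_locIdeal_of_interNum_eq_one {f f' : Poly} {P : Plane} (hf : f ∈ pointIdeal P)
    (hf' : f' ∈ pointIdeal P) (h : interNum f f' P = 1) :
    pointIdeal P ≤ locIdeal P (Ideal.span {f, f'}) := by
  intro x hx
  by_contra hx'
  have h1 := one_add_le_coheight (Ideal.span_le.mpr (by rintro y (rfl | rfl) <;> assumption)) hx hx'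
  rw [← interNum_eq_coheight, h] at h1
  have h2 := (add_le_add_left (one_le_coheight_pointIdeal P) 1).trans h1
  norm_num at h2

/-- Otherwise one of `f, f'` would generate the ideal of `P` up to second order. -/
theorem transverse_of_interNum_eq_one {f f' : Poly} {P : Plane} (hf : f ∈ pointIdeal P)
    (hf' : f' ∈ pointIdeal P) (h : interNum f f' P = 1) : Transverse f f' P := by
  have hle := le_locIdeal_of_interNum_eq_one hf hf' h
  have key : ∀ {f f' : Poly}, f' ∈ pointIdeal P → pointIdeal P ≤ locIdeal P (Ideal.span {f, f'}) →
      ∀ a b : ℂ, C a * f + C b * f' ∈ pointIdeal P ^ 2 → a = 0 := by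
    intro f f' hf' hle a b hab
    by_contra ha
    have hq : (C a⁻¹ : Poly) * C a = 1 := by rw [← C_mul, inv_mul_cancel₀ ha, C_1]
    obtain ⟨x, hx, hx'⟩ := exists_notMem_loc hf'
    obtain ⟨s, hs, hsx⟩ := mem_locIdeal.mp (hle hx)
    obtain ⟨p, q, e⟩ := Ideal.mem_span_pair.mp hsx
    refine hs (hx' s (q - p * C a⁻¹ * C b) ?_)
    convert Ideal.mul_mem_left _ (p * C a⁻¹) hab using 1
    rw [← e]
    linear_combination (-p * f) * hq
  intro a b hab
  refine ⟨key hf' hle a b hab, key hf (by rwa [Set.pair_comm]) b a (by rwa [add_comm])⟩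

/-- If `i_P(f, f') ≤ 2`, then the square of the ideal of `P` lies in `(f, f')` locally. Where
`f, f'` generate the ideal of `P` up to second order, this holds by Nakayama's lemma. -/
theorem sq_le_locIdeal_of_interNum_le_two {f f' : Poly} {P : Plane} (hf : f ∈ pointIdeal P)
    (hf' : f' ∈ pointIdeal P) (h : interNum f f' P ≤ 2) :
    pointIdeal P ^ 2 ≤ locIdeal P (Ideal.span {f, f'}) := by
  have hle : Ideal.span {f, f'} ≤ pointIdeal P :=
    Ideal.span_le.mpr (by rintro y (rfl | rfl) <;> assumption)
  by_cases h1 : pointIdeal P ≤ locIdeal P (Ideal.span {f, f'} ⊔ pointIdeal P * pointIdeal P)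
  · exact (Ideal.pow_le_self two_ne_zero).trans (le_locIdeal_of_le_sup h1)
  · obtain ⟨x, hx, hx'⟩ := SetLike.not_le_iff_exists.mp h1
    intro y hy
    by_contra hy'
    have c1 := one_add_le_coheight (sup_le hle Ideal.mul_le_left) hx hx'
    have c2 := one_add_le_coheight (le_sup_left (b := pointIdeal P * pointIdeal P))
      (Ideal.mem_sup_right (by rwa [← pow_two])) hy'
    rw [← interNum_eq_coheight] at c2
    have c3 := (add_le_add_left ((add_le_add_left (one_le_coheight_pointIdeal P) 1).trans c1)
      1).trans (c2.trans h)
    norm_num at c3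

/-- Two curves singular at `P` have intersection number at least three, the length of
`S_𝔭 ⧸ 𝔭 ^ 2`. -/
theorem notMem_sq_or_notMem_sq {f f' : Poly} {P : Plane} (h : interNum f f' P ≤ 2) :
    f ∉ pointIdeal P ^ 2 ∨ f' ∉ pointIdeal P ^ 2 := by
  by_contra! h'
  have hle : Ideal.span {f, f'} ≤ pointIdeal P ^ 2 :=
    Ideal.span_le.mpr (by rintro y (rfl | rfl); exacts [h'.1, h'.2])
  obtain ⟨x, hx, hx'⟩ := exists_notMem_loc (zero_mem (pointIdeal P))
  obtain ⟨y, hy, hy'⟩ := exists_notMem_loc hx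
  have c1 := one_add_le_coheight (I := Ideal.span {x} ⊔ pointIdeal P ^ 2) (J := pointIdeal P)
    (P := P) (sup_le ((Ideal.span_singleton_le_iff_mem _).mpr hx) (Ideal.pow_le_self two_ne_zero))
    hy (by
      rw [mem_locIdeal]
      rintro ⟨s, hs, hsy⟩
      obtain ⟨a, ha, b, hb, e⟩ := Submodule.mem_sup.mp hsy
      obtain ⟨r, rfl⟩ := Ideal.mem_span_singleton.mp ha
      exact hs (hy' s r (by rw [← e]; simpa using hb)))
  have c2 := one_add_le_coheight (P := P) (le_sup_right (a := Ideal.span {x}))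
    (Ideal.mem_sup_left (Ideal.mem_span_singleton_self x)) (by
      rw [mem_locIdeal]
      rintro ⟨s, hs, hsx⟩
      exact hs (hx' s 0 (by simpa using hsx)))
  have c3 : Order.coheight ((pointIdeal P ^ 2).map (algebraMap Poly (LocalRingAt P))) ≤
      interNum f f' P := by
    rw [interNum_eq_coheight]
    exact Order.coheight_anti (Ideal.map_mono hle)
  have c4 := (add_le_add_left ((add_le_add_left (one_le_coheight_pointIdeal P) 1).trans c1)
      1).trans (c2.trans (c3.trans h))
  norm_num at c4

theorem not_transverse_of_interNum_eq_two {f f' : Poly} (hf : f.IsHomogeneous 3)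
    (hf' : f'.IsHomogeneous 3) {P : Plane} (hfm : f ∈ pointIdeal P)
    (hfm' : f' ∈ pointIdeal P) (h : interNum f f' P = 2) : ¬ Transverse f f' P := by
  intro ht
  have hle : Ideal.span {f, f'} ≤ pointIdeal P :=
    Ideal.span_le.mpr (by rintro y (rfl | rfl) <;> assumption)
  obtain ⟨s, hs, hs'⟩ := ht.exists_mul_mem hf hf' hfm hfm'
  have h1 : pointIdeal P ≤ locIdeal P (Ideal.span {f, f'}) := by
    refine le_locIdeal_of_le_sup fun x hx => ?_
    rw [← pow_two]
    exact mem_locIdeal.mpr ⟨s, hs, hs' x hx⟩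
  have h2 := le_antisymm (map_le_map_of_le_locIdeal h1) (Ideal.map_mono hle)
  rw [interNum_eq_coheight, ← h2, map_pointIdeal] at h
  have h3 : (2 : ℕ∞) ≤ Order.coheight (IsLocalRing.maximalIdeal (LocalRingAt P)) := h.ge
  have h4 : Order.coheight (IsLocalRing.maximalIdeal (LocalRingAt P)) = 1 := by
    rw [← Module.length_quotient, Module.length_eq_one_iff, isSimpleModule_iff_isCoatom]
    exact (IsLocalRing.maximalIdeal.isMaximal _).out
  rw [h4] at h3
  norm_num at h3

/-- If `f'` agreed with a multiple of `f` up to third order at a smooth point `P` of `f`, the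
intersection number would be at least three. -/
theorem notMem_locIdeal_cube_of_interNum_le_two {f f' : Poly} {P : Plane}
    (hfm : f ∈ pointIdeal P) (hfm2 : f ∉ pointIdeal P ^ 2) (h : interNum f f' P ≤ 2) :
    f' ∉ locIdeal P (Ideal.span {f} ⊔ pointIdeal P ^ 3) := by
  intro h3
  obtain ⟨x, hx, hx'⟩ := exists_notMem_loc hfm
  obtain ⟨y, hy, hy'⟩ := exists_sq_notMem_loc hfm hfm2
  have hnot : ∀ n : ℕ, ∀ z : Poly, (∀ s B : Poly, s * z - f * B ∈ pointIdeal P ^ n →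
      s ∈ pointIdeal P) → z ∉ locIdeal P (Ideal.span {f} ⊔ pointIdeal P ^ n) := by
    intro n z hz hm
    obtain ⟨s, hs, hsz⟩ := mem_locIdeal.mp hm
    obtain ⟨a, ha, b, hb, e⟩ := Submodule.mem_sup.mp hsz
    obtain ⟨r, rfl⟩ := Ideal.mem_span_singleton.mp ha
    exact hs (hz s r (by rw [← e]; simpa using hb))
  have c1 := one_add_le_coheight (J := pointIdeal P)
    (sup_le ((Ideal.span_singleton_le_iff_mem _).mpr hfm) (Ideal.pow_le_self two_ne_zero))
    hx (hnot 2 x hx')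
  have c2 := one_add_le_coheight (J := Ideal.span {f} ⊔ pointIdeal P ^ 2)
    (sup_le_sup_left (Ideal.pow_le_pow_right (by norm_num : 2 ≤ 3)) _)
    (Ideal.mem_sup_right hy) (hnot 3 y hy')
  have c3 : Order.coheight
      ((Ideal.span {f} ⊔ pointIdeal P ^ 3).map (algebraMap Poly (LocalRingAt P))) ≤
      interNum f f' P := by
    rw [interNum_eq_coheight]
    refine Order.coheight_anti (map_le_map_of_le_locIdeal (Ideal.span_le.mpr ?_))
    rintro z (rfl | rfl)
    · exact le_locIdeal _ _ (Ideal.mem_sup_left (Ideal.mem_span_singleton_self _))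
    · exact h3
  have c4 := (add_le_add_left ((add_le_add_left (one_le_coheight_pointIdeal P) 1).trans c1)
      1).trans (c2.trans (c3.trans h))
  norm_num at c4

/-! ### Intersection numbers with a curve at a smooth point -/

/-- At a smooth point `P` of an irreducible curve `V(f)` the intersection number with `f` is the
valuation of a discrete valuation ring, the local ring of `V(f)`. -/
theorem exists_valuationRing {f : Poly} {n : ℕ} (hf : f.IsHomogeneous (n + 1)) (hp : Prime f)
    {P : Plane} (hfm : f ∈ pointIdeal P) (hfm2 : f ∉ pointIdeal P ^ 2) :
    ∃ (A : Type) (_ : CommRing A) (_ : IsDomain A) (_ : IsDiscreteValuationRing A)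
      (π : Poly →+* A), (∀ F, interNum f F P = IsDiscreteValuationRing.addVal A (π F)) ∧
        (∀ (J : Ideal Poly) (F : Poly), π F ∈ J.map π ↔ F ∈ locIdeal P (Ideal.span {f} ⊔ J)) ∧
        (pointIdeal P).map π = IsLocalRing.maximalIdeal A := by
  set I : Ideal (LocalRingAt P) := Ideal.span {algebraMap Poly (LocalRingAt P) f} with hI
  have hmapI : (Ideal.span {f}).map (algebraMap Poly (LocalRingAt P)) = I := by
    rw [Ideal.map_span, Set.image_singleton]
  have hIp : I.IsPrime := by
    rw [← hmapI]
    refine IsLocalization.isPrime_of_isPrime_disjoint (pointIdeal P).primeCompl _ _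
      ((Ideal.span_singleton_prime hp.ne_zero).mpr hp) ?_
    rw [Set.disjoint_left]
    intro x hx hx'
    exact hx ((Ideal.span_singleton_le_iff_mem _).mpr hfm hx')
  let A := LocalRingAt P ⧸ I
  have : IsLocalRing A :=
    IsLocalRing.of_surjective' (Ideal.Quotient.mk I) Ideal.Quotient.mk_surjective
  let π : Poly →+* A := (Ideal.Quotient.mk I).comp (algebraMap Poly (LocalRingAt P))
  have hπ : ∀ (J : Ideal Poly) (F : Poly), π F ∈ J.map π ↔
      F ∈ locIdeal P (Ideal.span {f} ⊔ J) := by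
    intro J F
    rw [← Ideal.map_map, locIdeal, Ideal.mem_comap, Ideal.map_sup, hmapI]
    change Ideal.Quotient.mk I _ ∈ _ ↔ _
    rw [Ideal.mem_quotient_iff_mem_sup, sup_comm]
  have hmax : (pointIdeal P).map π = IsLocalRing.maximalIdeal A := by
    rw [← Ideal.map_map, map_pointIdeal]
    exact IsLocalRing.map_maximalIdeal_of_surjective _ Ideal.Quotient.mk_surjective
  have hπf : π f = 0 := Ideal.Quotient.eq_zero_iff_mem.mpr (Ideal.mem_span_singleton_self _)
  have hprin : (IsLocalRing.maximalIdeal A).IsPrincipal := by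
    obtain ⟨y, hy, s, hs, hs'⟩ := exists_parameter hf hfm hfm2
    have h1 : pointIdeal P ≤ locIdeal P (Ideal.span {f, y}) := by
      refine le_locIdeal_of_le_sup fun x hx => ?_
      rw [← pow_two]
      exact mem_locIdeal.mpr ⟨s, hs, hs' x hx⟩
    refine ⟨π y, ?_⟩
    rw [Ideal.submodule_span_eq, ← hmax]
    apply le_antisymm
    · rw [Ideal.map_le_iff_le_comap]
      intro x hx
      have h2 := h1 hx
      rw [Ideal.span_insert, ← hπ, Ideal.map_span, Set.image_singleton] at h2
      exact h2
    · rw [Ideal.span_singleton_le_iff_mem]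
      exact Ideal.mem_map_of_mem π hy
  have hnf : IsLocalRing.maximalIdeal A ≠ ⊥ := by
    intro hF
    rw [← hmax] at hF
    obtain ⟨x, hx, hx'⟩ := exists_notMem_loc hfm
    have h1 : π x ∈ (⊥ : Ideal Poly).map π := by
      rw [Ideal.map_bot, ← hF]
      exact Ideal.mem_map_of_mem π hx
    rw [hπ, sup_bot_eq] at h1
    obtain ⟨s, hs, hsx⟩ := mem_locIdeal.mp h1
    obtain ⟨r, hr⟩ := Ideal.mem_span_singleton.mp hsx
    exact hs (hx' s r (by rw [hr, sub_self]; exact zero_mem _))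
  have hpir : IsPrincipalIdealRing A :=
    ((tfae_of_isNoetherianRing_of_isLocalRing_of_isDomain A).out 0 4).mpr hprin
  have hdvr : IsDiscreteValuationRing A :=
    { not_a_field' := hnf }
  refine ⟨A, inferInstance, inferInstance, hdvr, π, fun F => ?_, hπ, hmax⟩
  rw [← Ring.ord_eq_addVal, Ring.ord,
    ← Module.length_eq_of_surjective (S := LocalRingAt P) (Ideal.Quotient.mk_surjective (I := I)),
    interNum]
  have e1 : Ideal.span {algebraMap Poly (LocalRingAt P) f, algebraMap Poly (LocalRingAt P) F} =
      I ⊔ Ideal.span {algebraMap Poly (LocalRingAt P) F} := Ideal.span_insert _ _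
  have e2 : Ideal.span {π F} =
      (Ideal.span {algebraMap Poly (LocalRingAt P) F}).map (Ideal.Quotient.mk I) := by
    rw [Ideal.map_span, Set.image_singleton]
    rfl
  rw [e1, e2]
  exact (AlgEquiv.ofRingEquiv (R := LocalRingAt P) (f := DoubleQuot.quotQuotEquivQuotSup I
    (Ideal.span {algebraMap Poly (LocalRingAt P) F})) fun _ => rfl).toLinearEquiv.length_eq.symm

theorem Nonsingular.notMem_sq {f : Poly} {n : ℕ} (hf : f.IsHomogeneous (n + 1))
    (hns : Nonsingular f) {P : Plane} (hP : OnCurve f P) : f ∉ pointIdeal P ^ 2 := by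
  rw [mem_sq_iff hf]
  push Not
  exact hns P hP

theorem Nonsingular.prime {f : Poly} {n : ℕ} (hf : f.IsHomogeneous (n + 1))
    (hns : Nonsingular f) : Prime f :=
  (irreducible_of_nonsingular hf n.succ_ne_zero hns).prime

/-- On a discrete valuation ring, the valuation detects powers of the maximal ideal. -/
theorem natCast_le_addVal_iff {A : Type*} [CommRing A] [IsDomain A] [IsDiscreteValuationRing A]
    (n : ℕ) (x : A) :
    (n : ℕ∞) ≤ IsDiscreteValuationRing.addVal A x ↔ x ∈ IsLocalRing.maximalIdeal A ^ n := by
  obtain ⟨ϖ, hϖ⟩ := IsDiscreteValuationRing.exists_irreducible A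
  rw [hϖ.maximalIdeal_eq, Ideal.span_singleton_pow, Ideal.mem_span_singleton,
    ← hϖ.addVal_pow n, IsDiscreteValuationRing.addVal_le_iff_dvd]

theorem interNum_eq_of_dvd_sub {f F G : Poly} {P : Plane} (h : f ∣ F - G) :
    interNum f F P = interNum f G P := by
  obtain ⟨r, hr⟩ := h
  apply interNum_congr
  rw [sub_eq_iff_eq_add.mp hr, mul_comm, add_comm, Ideal.span_pair_add_mul_left]

section Smooth

variable {f : Poly} {n : ℕ} (hf : f.IsHomogeneous (n + 1)) (hns : Nonsingular f) {P : Plane}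
  (hP : OnCurve f P)

include hf hns hP

theorem interNum_mul (F G : Poly) : interNum f (F * G) P = interNum f F P + interNum f G P := by
  obtain ⟨A, _, _, _, π, h1, h2, h3⟩ := exists_valuationRing hf (hns.prime hf)
    ((mem_pointIdeal_iff hf P).mpr hP) (hns.notMem_sq hf hP)
  rw [h1, h1, h1, map_mul, IsDiscreteValuationRing.addVal_mul]

theorem natCast_le_interNum_iff (k : ℕ) (F : Poly) :
    (k : ℕ∞) ≤ interNum f F P ↔ F ∈ locIdeal P (Ideal.span {f} ⊔ pointIdeal P ^ k) := by
  obtain ⟨A, _, _, _, π, h1, h2, h3⟩ := exists_valuationRing hf (hns.prime hf)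
    ((mem_pointIdeal_iff hf P).mpr hP) (hns.notMem_sq hf hP)
  rw [h1, natCast_le_addVal_iff, ← h3, ← Ideal.map_pow, h2]

theorem natCast_le_interNum {k : ℕ} {F : Poly} (hF : F ∈ pointIdeal P ^ k) :
    (k : ℕ∞) ≤ interNum f F P :=
  (natCast_le_interNum_iff hf hns hP k F).mpr (le_locIdeal _ _ (Ideal.mem_sup_right hF))

theorem mem_locIdeal_of_interNum_le {F G : Poly} (h : interNum f G P ≤ interNum f F P) :
    F ∈ locIdeal P (Ideal.span {f, G}) := by
  obtain ⟨A, _, _, _, π, h1, h2, h3⟩ := exists_valuationRing hf (hns.prime hf)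
    ((mem_pointIdeal_iff hf P).mpr hP) (hns.notMem_sq hf hP)
  rw [h1, h1, IsDiscreteValuationRing.addVal_le_iff_dvd] at h
  rw [Ideal.span_insert, ← h2, Ideal.map_span, Set.image_singleton]
  exact Ideal.mem_span_singleton.mpr h

theorem interNum_ne_top {F : Poly} (hF : ¬ f ∣ F) : interNum f F P ≠ ⊤ := by
  obtain ⟨A, _, _, _, π, h1, h2, h3⟩ := exists_valuationRing hf (hns.prime hf)
    ((mem_pointIdeal_iff hf P).mpr hP) (hns.notMem_sq hf hP)
  rw [h1, Ne, IsDiscreteValuationRing.addVal_eq_top_iff]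
  intro h0
  have h4 : π F ∈ (⊥ : Ideal Poly).map π := by rw [h0]; exact zero_mem _
  rw [h2, sup_bot_eq] at h4
  obtain ⟨s, hs, hsF⟩ := mem_locIdeal.mp h4
  rcases (hns.prime hf).dvd_or_dvd (Ideal.mem_span_singleton.mp hsF) with h | h
  · exact hs (Ideal.mem_of_dvd _ h ((mem_pointIdeal_iff hf P).mpr hP))
  · exact hF h

/-- Some line through `P` is not tangent to `V(f)` there. -/
theorem exists_linForm_interNum_eq_one : ∃ c, interNum f (linForm c) P = 1 := by
  obtain ⟨A, hd, hA⟩ := exists_adapted_matrix P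
  have hφ : ∀ F, substHom A (substHom A⁻¹ F) = F := (substEquiv A hd).apply_symm_apply
  have hφ' : ∀ F, substHom A⁻¹ (substHom A F) = F := (substEquiv A hd).symm_apply_apply
  have hX : ∀ i, substHom A⁻¹ (X i) = linForm (A⁻¹ i) := fun i => by
    rw [substHom, aeval_X, linForm]
  have hmem : ∀ i, (X i : Poly) ∈ originIdeal → linForm (A⁻¹ i) ∈ pointIdeal P := fun i hi => by
    rwa [mem_pointIdeal_iff_substHom hA, ← hX, hφ]
  have h1 : ∀ i, (X i : Poly) ∈ originIdeal → 1 ≤ interNum f (linForm (A⁻¹ i)) P := fun i hi => by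
    simpa using natCast_le_interNum hf hns hP (k := 1) (by simpa using hmem i hi)
  by_contra! hcon
  have h2 : ∀ i, (X i : Poly) ∈ originIdeal →
      linForm (A⁻¹ i) ∈ locIdeal P (Ideal.span {f} ⊔ pointIdeal P ^ 2) := fun i hi => by
    rw [← natCast_le_interNum_iff hf hns hP]
    have := lt_of_le_of_ne (h1 i hi) (hcon _).symm
    exact Order.add_one_le_of_lt this
  have h3 : pointIdeal P ≤ locIdeal P (Ideal.span {f} ⊔ pointIdeal P ^ 2) := by
    intro x hx
    rw [mem_pointIdeal_iff_substHom hA] at hx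
    obtain ⟨p, q, e⟩ := Ideal.mem_span_pair.mp hx
    rw [← hφ' x, ← e, map_add, map_mul, map_mul, hX, hX]
    exact add_mem (Ideal.mul_mem_left _ _ (h2 0 X_zero_mem_originIdeal))
      (Ideal.mul_mem_left _ _ (h2 1 X_one_mem_originIdeal))
  obtain ⟨x, hx, hx'⟩ := exists_notMem_loc ((mem_pointIdeal_iff hf P).mpr hP)
  obtain ⟨s, hs, hsx⟩ := mem_locIdeal.mp (h3 hx)
  obtain ⟨a, ha, b, hb, e⟩ := Submodule.mem_sup.mp hsx
  obtain ⟨r, rfl⟩ := Ideal.mem_span_singleton.mp ha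
  exact hs (hx' s r (by rw [← e]; simpa using hb))

end Smooth

/-! ### Bézout's inequality on a nonsingular cubic -/

theorem finrank_homogeneousSubmodule (d : ℕ) :
    Module.finrank ℂ (homogeneousSubmodule (Fin 3) ℂ d) = (d + 2).choose 2 := by
  rw [homogeneousSubmodule_eq_finsupp_supported,
    (AddMonoidAlgebra.supportedEquivFinsupp (R := ℂ) (S := ℂ)
      {s : Fin 3 →₀ ℕ | s.degree = d}).finrank_eq]
  have e : {s : Fin 3 →₀ ℕ | s.degree = d} =
      ((Finset.finsuppAntidiag Finset.univ d : Finset (Fin 3 →₀ ℕ)) : Set (Fin 3 →₀ ℕ)) := by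
    ext s
    simp [Finsupp.degree_eq_sum]
  rw [e, (Finsupp.domLCongr (Equiv.refl _)).finrank_eq,
    Module.finrank_finsupp_self]
  simp only [Finset.coe_sort_coe, Fintype.card_coe, Finset.card_finsuppAntidiag_nat_eq_choose]
  rw [Finset.card_univ, Fintype.card_fin, show 3 + d - 1 = d + 2 by omega]
  exact Nat.choose_symm_add

theorem two_mul_choose (d : ℕ) : (d + 2).choose 2 * 2 = (d + 2) * (d + 1) := by
  have := Nat.add_one_mul_choose_eq (d + 1) 1
  rw [Nat.choose_one_right] at this
  exact this.symm

instance finiteDimensional_homogeneousSubmodule (d : ℕ) :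
    FiniteDimensional ℂ (homogeneousSubmodule (Fin 3) ℂ d) :=
  Module.Finite.iff_fg.mpr (homogeneousSubmodule_fg _ _ _)

theorem interNum_eq_zero_of_notMem {f F : Poly} {P : Plane} (hF : F ∉ pointIdeal P) :
    interNum f F P = 0 := (interNum_eq_zero_iff _ _ _).mpr (Or.inr hF)

theorem onCurve_linForm_iff (c : Fin 3 → ℂ) (P : Plane) :
    OnCurve (linForm c) P ↔ linForm c ∈ pointIdeal P :=
  (mem_pointIdeal_iff (isHomogeneous_linForm c) P).symm

open scoped Classical in
/-- The forms of degree `d` that cut out on `V(f)` a divisor containing `D`. -/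
noncomputable def curveSpace (f : Poly) (d : ℕ) (D : Multiset Plane) : Submodule ℂ Poly :=
  homogeneousSubmodule (Fin 3) ℂ d ⊓
    ⨅ P, (locIdeal P (Ideal.span {f} ⊔ pointIdeal P ^ D.count P)).restrictScalars ℂ

open scoped Classical in
theorem mem_curveSpace {f : Poly} {d : ℕ} {D : Multiset Plane} {F : Poly} :
    F ∈ curveSpace f d D ↔ F.IsHomogeneous d ∧
      ∀ P, F ∈ locIdeal P (Ideal.span {f} ⊔ pointIdeal P ^ D.count P) := by
  simp [curveSpace]

section Bezout

variable {f : Poly} (hf : f.IsHomogeneous 3) (hns : Nonsingular f)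

include hf hns

open scoped Classical in
theorem mem_curveSpace_of_le_interNum {d : ℕ} {D : Multiset Plane} {F : Poly}
    (hD : ∀ P ∈ D, OnCurve f P) (hF : F.IsHomogeneous d)
    (h : ∀ P ∈ D, (D.count P : ℕ∞) ≤ interNum f F P) : F ∈ curveSpace f d D := by
  rw [mem_curveSpace]
  refine ⟨hF, fun P => ?_⟩
  by_cases hP : P ∈ D
  · exact (natCast_le_interNum_iff hf hns (hD P hP) _ _).mp (h P hP)
  · rw [Multiset.count_eq_zero_of_notMem hP, pow_zero]
    exact le_locIdeal _ _ (Ideal.mem_sup_right (by rw [Ideal.one_eq_top]; trivial))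

open scoped Classical in
/-- A product of lines realizes any multiplicities along `V(f)`, exactly at a given point. -/
theorem exists_form_interNum_eq {P : Plane} (hP : OnCurve f P) (D : Multiset Plane)
    (hD : ∀ R ∈ D, OnCurve f R) :
    ∃ H : Poly, H.IsHomogeneous D.card ∧ interNum f H P = D.count P ∧
      ∀ R ∈ D, (D.count R : ℕ∞) ≤ interNum f H R := by
  induction D using Multiset.induction_on with
  | empty =>
    refine ⟨1, isHomogeneous_one _ _, ?_, by simp⟩
    rw [Multiset.count_zero, Nat.cast_zero, interNum_eq_zero_iff]
    exact Or.inr fun h => (pointIdeal_isPrime P).ne_top ((Ideal.eq_top_iff_one _).mpr h)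
  | cons R D ih =>
    obtain ⟨H, h1, h2, h3⟩ := ih fun R hR => hD R (Multiset.mem_cons_of_mem hR)
    have hR := hD R (Multiset.mem_cons_self R D)
    obtain ⟨c, hc1, hc2⟩ : ∃ c, 1 ≤ interNum f (linForm c) R ∧
        interNum f (linForm c) P = if P = R then 1 else 0 := by
      by_cases hPR : P = R
      · subst hPR
        obtain ⟨c, hc⟩ := exists_linForm_interNum_eq_one hf hns hP
        exact ⟨c, hc.ge, by rw [hc, if_pos rfl]⟩
      · obtain ⟨c, hc1, hc2⟩ := exists_linForm_separating (Ne.symm hPR)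
        rw [onCurve_linForm_iff] at hc1 hc2
        refine ⟨c, ?_, ?_⟩
        · simpa using natCast_le_interNum hf hns hR (k := 1) (by simpa using hc1)
        · rw [if_neg hPR, interNum_eq_zero_of_notMem hc2]
    refine ⟨H * linForm c, ?_, ?_, ?_⟩
    · rw [Multiset.card_cons]
      exact h1.mul (isHomogeneous_linForm c)
    · rw [interNum_mul hf hns hP, h2, hc2, Multiset.count_cons]
      push_cast
      rfl
    · intro R' hR'
      rw [interNum_mul hf hns (hD R' hR'), Multiset.count_cons]
      push_cast
      gcongr
      · by_cases hm : R' ∈ D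
        · exact h3 R' hm
        · rw [Multiset.count_eq_zero_of_notMem hm]
          exact bot_le
      · split_ifs with h
        · rw [h]; exact hc1
        · exact bot_le

/-- Points on `V(f)`, with multiplicities, impose independent conditions on forms of large
degree. -/
theorem finrank_curveSpace_add_card_le {d : ℕ} (D : Multiset Plane)
    (hD : ∀ R ∈ D, OnCurve f R) (hd : D.card ≤ d) :
    Module.finrank ℂ (curveSpace f d D) + D.card ≤ (d + 2).choose 2 := by
  classical
  induction D using Multiset.induction_on with
  | empty =>
    rw [Multiset.card_zero, add_zero, ← finrank_homogeneousSubmodule]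
    exact Submodule.finrank_mono inf_le_left
  | cons P D ih =>
    rw [Multiset.card_cons] at hd ⊢
    have hP := hD P (Multiset.mem_cons_self P D)
    have hD' : ∀ R ∈ D, OnCurve f R := fun R hR => hD R (Multiset.mem_cons_of_mem hR)
    have ih' := ih hD' (by omega)
    have hlt : curveSpace f d (P ::ₘ D) < curveSpace f d D := by
      have hle : curveSpace f d (P ::ₘ D) ≤ curveSpace f d D := by
        intro F hF
        rw [mem_curveSpace] at hF ⊢
        refine ⟨hF.1, fun R => locIdeal_mono (sup_le_sup_left
          (Ideal.pow_le_pow_right (Multiset.count_le_count_cons _ _ _)) _) (hF.2 R)⟩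
      refine lt_of_le_of_ne hle fun heq => ?_
      obtain ⟨H, h1, h2, h3⟩ := exists_form_interNum_eq hf hns hP D hD'
      obtain ⟨c, -, hc⟩ := exists_linForm_ne_zero (Set.finite_singleton P)
      have hc' : linForm c ^ (d - D.card) ∉ pointIdeal P := by
        intro h
        exact hc P rfl ((onCurve_linForm_iff c P).mpr
          ((pointIdeal_isPrime P).mem_of_pow_mem _ h))
      have hmem : H * linForm c ^ (d - D.card) ∈ curveSpace f d D := by
        refine mem_curveSpace_of_le_interNum hf hns hD' ?_ fun R hR => ?_
        · have := h1.mul ((isHomogeneous_linForm c).pow (d - D.card))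
          rwa [one_mul, show D.card + (d - D.card) = d by omega] at this
        · rw [interNum_mul hf hns (hD' R hR)]
          exact (h3 R hR).trans le_self_add
      rw [← heq, mem_curveSpace] at hmem
      have h4 := hmem.2 P
      rw [← natCast_le_interNum_iff hf hns hP, interNum_mul hf hns hP, h2,
        interNum_eq_zero_of_notMem hc', add_zero, Multiset.count_cons_self, Nat.cast_le] at h4
      omega
    have : FiniteDimensional ℂ (curveSpace f d D) :=
      Submodule.finiteDimensional_of_le (S₂ := homogeneousSubmodule (Fin 3) ℂ d) inf_le_left
    have := Submodule.finrank_lt_finrank_of_lt hlt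
    omega

open scoped Classical in
/-- **Bézout's inequality** on the nonsingular cubic `V(f)`. -/
theorem card_le_of_count_le_interNum {G : Poly} {e : ℕ} (hG : G.IsHomogeneous e) (hfG : ¬ f ∣ G)
    (D : Multiset Plane) (hD : ∀ R ∈ D, OnCurve f R)
    (h : ∀ R ∈ D, (D.count R : ℕ∞) ≤ interNum f G R) : D.card ≤ 3 * e := by
  set k := D.card with hk
  have hp := hns.prime hf
  have hG0 : G ≠ 0 := fun h0 => hfG (h0 ▸ dvd_zero f)
  have inj : ∀ F : Poly, F ≠ 0 → Function.Injective (LinearMap.mulLeft ℂ F) := fun F hF a b hab =>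
    mul_left_cancel₀ hF hab
  have hfr : ∀ (F : Poly) (m : ℕ), F ≠ 0 →
      Module.finrank ℂ ((homogeneousSubmodule (Fin 3) ℂ m).map (LinearMap.mulLeft ℂ F)) =
        (m + 2).choose 2 := fun F m hF => by
    rw [← (Submodule.equivMapOfInjective _ (inj F hF) _).finrank_eq, finrank_homogeneousSubmodule]
  set d := k + 3 + e with hd
  set U := (homogeneousSubmodule (Fin 3) ℂ (k + e)).map (LinearMap.mulLeft ℂ f)
  set V := (homogeneousSubmodule (Fin 3) ℂ (k + 3)).map (LinearMap.mulLeft ℂ G)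
  have hUV : U ⊔ V ≤ curveSpace f d D := by
    refine sup_le ?_ ?_
    · rintro _ ⟨A, hA, rfl⟩
      rw [mem_curveSpace]
      refine ⟨?_, fun P => le_locIdeal _ _ (Ideal.mem_sup_left
        (Ideal.mem_span_singleton.mpr (dvd_mul_right f A)))⟩
      have := hf.mul hA
      rwa [show 3 + (k + e) = d by omega] at this
    · rintro _ ⟨A, hA, rfl⟩
      refine mem_curveSpace_of_le_interNum hf hns hD ?_ fun R hR => ?_
      · have := hG.mul hA
        rwa [show e + (k + 3) = d by omega] at this
      · rw [LinearMap.mulLeft_apply, interNum_mul hf hns (hD R hR)]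
        exact (h R hR).trans le_self_add
  have hinf : U ⊓ V ≤ (homogeneousSubmodule (Fin 3) ℂ k).map (LinearMap.mulLeft ℂ (G * f)) := by
    rintro _ ⟨⟨A, hA, rfl⟩, ⟨B, hB, hAB⟩⟩
    rw [LinearMap.mulLeft_apply, LinearMap.mulLeft_apply] at hAB
    obtain ⟨E, rfl⟩ : f ∣ B :=
      (hp.dvd_or_dvd (hAB ▸ dvd_mul_right f A : f ∣ G * B)).resolve_left hfG
    refine ⟨homogeneousComponent k E, homogeneousComponent_isHomogeneous _ _, ?_⟩
    have h1 := homogeneousComponent_mul_of_isHomogeneous hf E k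
    rw [mul_comm E, homogeneousComponent_of_mem hB, if_pos rfl] at h1
    rw [LinearMap.mulLeft_apply, LinearMap.mulLeft_apply, ← hAB, h1]
    ring
  have i1 := finrank_curveSpace_add_card_le hf hns (d := d) D hD (by omega)
  have : FiniteDimensional ℂ (curveSpace f d D) :=
      Submodule.finiteDimensional_of_le (S₂ := homogeneousSubmodule (Fin 3) ℂ d) inf_le_left
  have i2 := Submodule.finrank_mono hUV
  have i3 := Submodule.finrank_mono hinf
  have i4 := Submodule.finrank_sup_add_finrank_inf_eq U V
  rw [hfr _ _ (mul_ne_zero hG0 hp.ne_zero)] at i3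
  rw [hfr _ _ hp.ne_zero, hfr _ _ hG0] at i4
  have c1 : (d + 2).choose 2 * 2 = (k + 3 + e + 2) * (k + 3 + e + 1) := two_mul_choose d
  have c2 := two_mul_choose (k + e)
  have c3 := two_mul_choose (k + 3)
  have c4 := two_mul_choose k
  have c5 : (k + 3 + e + 2) * (k + 3 + e + 1) + (k + 2) * (k + 1) =
      (k + e + 2) * (k + e + 1) + (k + 3 + 2) * (k + 3 + 1) + 6 * e := by ring
  omega

/-- A form of degree `e` whose divisor on `V(f)` contains `D` of degree `3 e` has divisor `D`. -/
theorem interNum_eq_of_sum_eq {G : Poly} {e : ℕ} (hG : G.IsHomogeneous e) (hfG : ¬ f ∣ G)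
    (D : Plane →₀ ℕ) (hD : ∀ R ∈ D.support, OnCurve f R)
    (h : ∀ R, OnCurve f R → (D R : ℕ∞) ≤ interNum f G R) (hsum : D.sum (fun _ m => m) = 3 * e) :
    ∀ R, OnCurve f R → interNum f G R = D R := by
  classical
  intro R hR
  refine le_antisymm ?_ (h R hR)
  by_contra! hlt
  have h1 : ((D R + 1 : ℕ) : ℕ∞) ≤ interNum f G R := by
    push_cast
    exact Order.add_one_le_of_lt hlt
  have h2 := card_le_of_count_le_interNum hf hns hG hfG (R ::ₘ D.toMultiset) (by
    intro Q hQ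
    rw [Multiset.mem_cons, Finsupp.mem_toMultiset] at hQ
    rcases hQ with rfl | hQ
    · exact hR
    · exact hD Q hQ) (by
    intro Q hQ
    rw [Multiset.mem_cons, Finsupp.mem_toMultiset] at hQ
    rw [Multiset.count_cons, Finsupp.count_toMultiset]
    split_ifs with hQR
    · rw [hQR]; exact h1
    · exact h Q (hD Q (hQ.resolve_left hQR)))
  rw [Multiset.card_cons, Finsupp.card_toMultiset] at h2
  simp only [Finsupp.sum, id] at hsum h2
  omega

theorem finite_inter {G : Poly} {e : ℕ} (hG : G.IsHomogeneous e) (hfG : ¬ f ∣ G) :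
    {P : Plane | OnCurve f P ∧ OnCurve G P}.Finite := by
  classical
  by_contra hinf
  obtain ⟨t, ht, hcard⟩ := Set.Infinite.exists_subset_card_eq hinf (3 * e + 1)
  have := card_le_of_count_le_interNum hf hns hG hfG t.val (fun R hR => (ht hR).1) fun R hR => by
    rw [Multiset.count_eq_one_of_mem t.nodup hR]
    exact natCast_le_interNum hf hns (ht hR).1
      (by rw [pow_one]; exact (mem_pointIdeal_iff hG R).mpr (ht hR).2)
  rw [Finset.card_val, hcard] at this
  omega

end Bezout

/-! ### Linear systems of cubics and sextics -/

theorem mem_formSpace {d m : ℕ} {S : Set Plane} {F : Poly} :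
    F ∈ formSpace d m S ↔ F.IsHomogeneous d ∧ ∀ P ∈ S, F ∈ pointIdeal P ^ m := by
  simp [formSpace]

instance finiteDimensional_formSpace (d m : ℕ) (S : Set Plane) :
    FiniteDimensional ℂ (formSpace d m S) :=
  Submodule.finiteDimensional_of_le (S₂ := homogeneousSubmodule (Fin 3) ℂ d) inf_le_left

theorem choose_le_finrank_ker_add_card {ι : Type*} [Fintype ι] {d : ℕ}
    (L : homogeneousSubmodule (Fin 3) ℂ d →ₗ[ℂ] ι → ℂ) :
    (d + 2).choose 2 ≤ Module.finrank ℂ L.ker + Fintype.card ι := by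
  have h1 := L.finrank_range_add_finrank_ker
  have h2 := Submodule.finrank_le L.range
  rw [Module.finrank_fintype_fun_eq_card] at h2
  rw [finrank_homogeneousSubmodule] at h1
  omega

/-- Evaluation of forms at representatives of points. -/
noncomputable def evalMap (d : ℕ) (S : Finset Plane) :
    homogeneousSubmodule (Fin 3) ℂ d →ₗ[ℂ] S → ℂ :=
  LinearMap.pi fun P => (aeval P.1.rep : Poly →ₐ[ℂ] ℂ).toLinearMap ∘ₗ Submodule.subtype _

/-- Evaluation of the gradients of forms at representatives of points. -/
noncomputable def gradMap (d : ℕ) (S : Finset Plane) :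
    homogeneousSubmodule (Fin 3) ℂ d →ₗ[ℂ] S × Fin 3 → ℂ :=
  LinearMap.pi fun P => (aeval P.1.1.rep : Poly →ₐ[ℂ] ℂ).toLinearMap ∘ₗ
    (pderiv P.2).toLinearMap ∘ₗ Submodule.subtype _

theorem finrank_ker_evalMap_le (d : ℕ) (S : Finset Plane) :
    Module.finrank ℂ (evalMap d S).ker ≤ Module.finrank ℂ (formSpace d 1 (S : Set Plane)) := by
  rw [(Submodule.equivMapOfInjective _ (Submodule.injective_subtype _) _).finrank_eq]
  refine Submodule.finrank_mono ?_
  rintro _ ⟨⟨F, hF⟩, hk, rfl⟩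
  refine mem_formSpace.mpr ⟨hF, fun P hP => ?_⟩
  rw [pow_one]
  exact (mem_pointIdeal_iff hF P).mpr (congrFun hk ⟨P, hP⟩)

/-- Eight points impose at most eight conditions on the ten coefficients of a cubic. -/
theorem two_le_finrank_cubics {T : Finset Plane} (hT : T.card = 8) :
    2 ≤ Module.finrank ℂ (formSpace 3 1 (T : Set Plane)) := by
  have h1 := choose_le_finrank_ker_add_card (evalMap 3 T)
  have h2 := finrank_ker_evalMap_le 3 T
  have h3 : (3 + 2).choose 2 = 10 := rfl
  rw [Fintype.card_coe, hT] at h1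
  omega

/-- Eight double points impose at most `24` conditions on the `28` coefficients of a sextic. -/
theorem four_le_finrank_sextics {T : Finset Plane} (hT : T.card = 8) :
    4 ≤ Module.finrank ℂ (formSpace 6 2 (T : Set Plane)) := by
  have h1 := choose_le_finrank_ker_add_card (gradMap 6 T)
  have h3 : (6 + 2).choose 2 = 28 := rfl
  rw [Fintype.card_prod, Fintype.card_coe, hT, Fintype.card_fin] at h1
  have h2 : Module.finrank ℂ (gradMap 6 T).ker ≤
      Module.finrank ℂ (formSpace 6 2 (T : Set Plane)) := by
    rw [(Submodule.equivMapOfInjective _ (Submodule.injective_subtype _) _).finrank_eq]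
    refine Submodule.finrank_mono ?_
    rintro _ ⟨⟨F, hF⟩, hk, rfl⟩
    refine mem_formSpace.mpr ⟨hF, fun P hP => ?_⟩
    exact (mem_sq_iff (n := 5) hF P).mpr fun k => congrFun hk (⟨P, hP⟩, k)
  omega

/-- The data of the theorem: eight points `T`, generators `f, f'` of the pencil of cubics through
`T`, a sextic `g` completing `f ^ 2, f * f', f' ^ 2` to generators of the sextics singular along
`T`, and the ninth base point `M` of the pencil. -/
structure NonicData (T : Finset Plane) (f f' g : Poly) (M : Plane) : Prop where
  card : T.card = 8
  cubics : Submodule.span ℂ {f, f'} = formSpace 3 1 (T : Set Plane)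
  sextics : Submodule.span ℂ {f ^ 2, f * f', f' ^ 2, g} = formSpace 6 2 (T : Set Plane)
  ninth : IsNinthPoint T f f' M

theorem mem_span_pair_iff_C {f f' h : Poly} :
    h ∈ Submodule.span ℂ {f, f'} ↔ ∃ a b : ℂ, h = C a * f + C b * f' := by
  rw [Submodule.mem_span_pair]
  simp only [smul_eq_C_mul, eq_comm]

theorem mem_span_quadruple_iff_C {p q r s h : Poly} :
    h ∈ Submodule.span ℂ {p, q, r, s} ↔
      ∃ a b c e : ℂ, h = C a * p + C b * q + C c * r + C e * s := by
  rw [Submodule.mem_span_insert]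
  simp only [Submodule.mem_span_insert, Submodule.mem_span_singleton, smul_eq_C_mul]
  constructor
  · rintro ⟨a, _, ⟨b, _, ⟨c, _, ⟨e, rfl⟩, rfl⟩, rfl⟩, rfl⟩
    exact ⟨a, b, c, e, by ring⟩
  · rintro ⟨a, b, c, e, rfl⟩
    exact ⟨a, _, ⟨b, _, ⟨c, _, ⟨e, rfl⟩, rfl⟩, rfl⟩, by ring⟩

theorem span_sextics_le {f f' h h' g : Poly} {V : Submodule ℂ Poly}
    (hle : Submodule.span ℂ {h, h'} ≤ Submodule.span ℂ {f, f'})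
    (hV : Submodule.span ℂ {f ^ 2, f * f', f' ^ 2, g} = V) :
    Submodule.span ℂ {h ^ 2, h * h', h' ^ 2, g} ≤ V := by
  have m1 : h ∈ Submodule.span ℂ {h, h'} := Submodule.subset_span (by simp)
  have m2 : h' ∈ Submodule.span ℂ {h, h'} := Submodule.subset_span (by simp)
  obtain ⟨a, b, e1⟩ := mem_span_pair_iff_C.mp (hle m1)
  obtain ⟨c, d, e2⟩ := mem_span_pair_iff_C.mp (hle m2)
  subst e1 e2
  rw [← hV, Submodule.span_le]
  have c2 : (C (2 : ℂ) : Poly) = 2 := map_ofNat C 2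
  rintro x (rfl | rfl | rfl | rfl)
  · exact mem_span_quadruple_iff_C.mpr ⟨a ^ 2, 2 * (a * b), b ^ 2, 0, by
      simp only [map_pow, map_mul, map_zero, c2]; ring⟩
  · exact mem_span_quadruple_iff_C.mpr ⟨a * c, a * d + b * c, b * d, 0, by
      simp only [map_add, map_mul, map_zero]; ring⟩
  · exact mem_span_quadruple_iff_C.mpr ⟨c ^ 2, 2 * (c * d), d ^ 2, 0, by
      simp only [map_pow, map_mul, map_zero, c2]; ring⟩
  · exact Submodule.subset_span (by simp)

theorem span_pair_combination_eq (f f' : Poly) (a : ℂ) {b : ℂ} (hb : b ≠ 0) :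
    Submodule.span ℂ {f, C a * f + C b * f'} = Submodule.span ℂ {f, f'} := by
  refine le_antisymm (Submodule.span_le.mpr ?_) (Submodule.span_le.mpr ?_)
  · rintro x (rfl | rfl)
    · exact Submodule.subset_span (by simp)
    · exact mem_span_pair_iff_C.mpr ⟨a, b, rfl⟩
  · rintro x (rfl | rfl)
    · exact Submodule.subset_span (by simp)
    · have h : (C b⁻¹ : Poly) * C b = 1 := by rw [← C_mul, inv_mul_cancel₀ hb, C_1]
      refine mem_span_pair_iff_C.mpr ⟨-(b⁻¹ * a), b⁻¹, ?_⟩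
      rw [C_neg, C_mul]
      linear_combination (-x) * h

theorem ideal_span_le_of_span_le {f f' h h' : Poly}
    (hle : Submodule.span ℂ {h, h'} ≤ Submodule.span ℂ {f, f'}) :
    Ideal.span {h, h'} ≤ Ideal.span {f, f'} := by
  rw [Ideal.span_le]
  intro x hx
  obtain ⟨a, b, rfl⟩ := mem_span_pair_iff_C.mp (hle (Submodule.subset_span hx))
  exact Ideal.mem_span_pair.mpr ⟨_, _, rfl⟩

theorem jacobianDet_combination (f f' g : Poly) (a b a' b' p q r e : ℂ) :
    jacobianDet (C a * f + C b * f') (C a' * f + C b' * f')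
      (C p * f ^ 2 + C q * (f * f') + C r * f' ^ 2 + C e * g) =
      C ((a * b' - b * a') * e) * jacobianDet f f' g := by
  have h1 : ∀ (a b : ℂ) k, pderiv k (C a * f + C b * f') = C a * pderiv k f + C b * pderiv k f' :=
    fun a b k => by rw [map_add, pderiv_C_mul, pderiv_C_mul]
  have h2 : ∀ k, pderiv k (C p * f ^ 2 + C q * (f * f') + C r * f' ^ 2 + C e * g) =
      C p * (2 * f * pderiv k f) + C q * (pderiv k f * f' + f * pderiv k f') +
        C r * (2 * f' * pderiv k f') + C e * pderiv k g := fun k => by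
    simp only [map_add, pderiv_mul, pderiv_C, zero_mul, zero_add, pderiv_pow, Nat.cast_ofNat,
      Nat.reduceSub, pow_one]
  have h3 : (C ((a * b' - b * a') * e) : Poly) = (C a * C b' - C b * C a') * C e := by
    rw [C_mul, C_sub, C_mul, C_mul]
  rw [h3]
  simp only [jacobianDet, Matrix.det_fin_three, Matrix.of_apply, Matrix.cons_val_zero,
    Matrix.cons_val_one, Matrix.cons_val, h1, h2]
  ring

theorem jacobianDet_add_quadratic (f f' g : Poly) (p q r e : ℂ) :
    jacobianDet f f' (C p * f ^ 2 + C q * (f * f') + C r * f' ^ 2 + C e * g) =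
      C e * jacobianDet f f' g := by
  simpa using jacobianDet_combination f f' g 1 0 0 1 p q r e

theorem eval_pderiv_mul_of_eval_eq_zero {F A : Poly} {v : Fin 3 → ℂ}
    (hF : eval v F = 0) (k : Fin 3) :
    eval v (pderiv k (A * F)) = eval v A * eval v (pderiv k F) := by
  rw [pderiv_mul, map_add, map_mul, map_mul, hF, mul_zero, zero_add]

/-- Where `f` and `f'` are transverse, `A * f + B * f'` is singular only if `A` and `B` vanish. -/
theorem Transverse.mem_and_mem {f f' A B : Poly} (hf : f.IsHomogeneous 3)
    (hf' : f'.IsHomogeneous 3) (hA : A.IsHomogeneous 3) (hB : B.IsHomogeneous 3) {P : Plane}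
    (h : Transverse f f' P) (hfm : f ∈ pointIdeal P) (hfm' : f' ∈ pointIdeal P)
    (hm : A * f + B * f' ∈ pointIdeal P ^ 2) : A ∈ pointIdeal P ∧ B ∈ pointIdeal P := by
  rw [mem_pointIdeal_iff hA, mem_pointIdeal_iff hB]
  apply h
  rw [mem_pointIdeal_iff hf] at hfm
  rw [mem_pointIdeal_iff hf'] at hfm'
  rw [mem_sq_iff (n := 5) ((hA.mul hf).add (hB.mul hf'))] at hm
  rw [mem_sq_iff (n := 2) ((hf.C_mul _).add (hf'.C_mul _))]
  intro k
  rw [← hm k]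
  simp only [map_add, eval_pderiv_mul_of_eval_eq_zero hfm, eval_pderiv_mul_of_eval_eq_zero hfm',
    eval_C]

/-- If the Jacobian vanishes at a point, the gradients are linearly dependent there, and by
Euler's identity so are the values. -/
theorem exists_dependent_of_jacobianDet {f f' g : Poly} (hf : f.IsHomogeneous 3)
    (hf' : f'.IsHomogeneous 3) (hg : g.IsHomogeneous 6) {v : Fin 3 → ℂ}
    (hj : eval v (jacobianDet f f' g) = 0) :
    ∃ a b e : ℂ, ¬ (a = 0 ∧ b = 0 ∧ e = 0) ∧
      (∀ k, a * eval v (pderiv k f) + b * eval v (pderiv k f') + e * eval v (pderiv k g) = 0) ∧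
      a * eval v f + b * eval v f' + 2 * (e * eval v g) = 0 := by
  have euler : ∀ {F : Poly} {n : ℕ}, F.IsHomogeneous n →
      ∑ k, v k * eval v (pderiv k F) = n * eval v F := by
    intro F n hF
    have := congrArg (eval v) hF.sum_X_mul_pderiv
    simpa using this
  rw [jacobianDet, RingHom.map_det] at hj
  obtain ⟨w, hw, hw0⟩ := Matrix.exists_vecMul_eq_zero_iff.mpr hj
  have hk : ∀ k, w 0 * eval v (pderiv k f) + w 1 * eval v (pderiv k f') +
      w 2 * eval v (pderiv k g) = 0 := by
    intro k
    have := congrFun hw0 k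
    simpa [Matrix.vecMul, dotProduct, Fin.sum_univ_three] using this
  refine ⟨w 0, w 1, w 2, ?_, hk, ?_⟩
  · rintro ⟨h0, h1, h2⟩
    apply hw
    funext i
    fin_cases i <;> assumption
  · have e1 := euler hf
    have e2 := euler hf'
    have e3 := euler hg
    have : ∑ k, v k * (w 0 * eval v (pderiv k f) + w 1 * eval v (pderiv k f') +
        w 2 * eval v (pderiv k g)) = 0 := by simp [hk]
    have h2 : w 0 * ∑ k, v k * eval v (pderiv k f) + w 1 * ∑ k, v k * eval v (pderiv k f') +
        w 2 * ∑ k, v k * eval v (pderiv k g) = 0 := by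
      rw [← this]
      simp only [Fin.sum_univ_three]
      ring
    rw [e1, e2, e3] at h2
    push_cast at h2
    linear_combination (1 / 3) * h2

namespace NonicData

variable {T : Finset Plane} {f f' g : Poly} {M : Plane} (D : NonicData T f f' g M)

include D

/-- The data do not depend on the chosen basis of the pencil. -/
theorem changeBasis {h h' : Poly} (hh : Submodule.span ℂ {h, h'} = formSpace 3 1 (T : Set Plane)) :
    NonicData T h h' g M := by
  have e := hh.trans D.cubics.symm
  refine ⟨D.card, hh, le_antisymm (span_sextics_le e.le D.sextics) ?_, fun P => ?_⟩
  · rw [← D.sextics]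
    exact span_sextics_le e.ge rfl
  · rw [← D.ninth P]
    exact interNum_congr
      (le_antisymm (ideal_span_le_of_span_le e.le) (ideal_span_le_of_span_le e.ge)) P

theorem mem_cubics_left : f ∈ formSpace 3 1 (T : Set Plane) := by
  rw [← D.cubics]; exact Submodule.subset_span (by simp)

theorem mem_cubics_right : f' ∈ formSpace 3 1 (T : Set Plane) := by
  rw [← D.cubics]; exact Submodule.subset_span (by simp)

theorem mem_sextics_right : g ∈ formSpace 6 2 (T : Set Plane) := by
  rw [← D.sextics]; exact Submodule.subset_span (by simp)

theorem isHomogeneous_left : f.IsHomogeneous 3 := (mem_formSpace.mp D.mem_cubics_left).1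

theorem isHomogeneous_right : f'.IsHomogeneous 3 := (mem_formSpace.mp D.mem_cubics_right).1

theorem isHomogeneous_sextic : g.IsHomogeneous 6 := (mem_formSpace.mp D.mem_sextics_right).1

theorem mem_left {P : Plane} (hP : P ∈ T) : f ∈ pointIdeal P := by
  simpa using (mem_formSpace.mp D.mem_cubics_left).2 P hP

theorem mem_right {P : Plane} (hP : P ∈ T) : f' ∈ pointIdeal P := by
  simpa using (mem_formSpace.mp D.mem_cubics_right).2 P hP

theorem mem_sextic {P : Plane} (hP : P ∈ T) : g ∈ pointIdeal P ^ 2 :=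
  (mem_formSpace.mp D.mem_sextics_right).2 P hP

theorem exists_cubic {h : Poly} (hh : h ∈ formSpace 3 1 (T : Set Plane)) :
    ∃ a b : ℂ, h = C a * f + C b * f' := by
  rw [← D.cubics] at hh
  exact mem_span_pair_iff_C.mp hh

theorem exists_sextic {h : Poly} (hh : h ∈ formSpace 6 2 (T : Set Plane)) :
    ∃ a b c e : ℂ, h = C a * f ^ 2 + C b * (f * f') + C c * f' ^ 2 + C e * g := by
  rw [← D.sextics] at hh
  exact mem_span_quadruple_iff_C.mp hh

theorem quadratic_mem (a b c : ℂ) :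
    C a * f ^ 2 + C b * (f * f') + C c * f' ^ 2 ∈ formSpace 6 2 (T : Set Plane) := by
  rw [← D.sextics]
  exact mem_span_quadruple_iff_C.mpr ⟨a, b, c, 0, by rw [C_0]; ring⟩

theorem exists_jacobianDet_eq {f₁ f₁' g₁ : Poly}
    (h₁ : Submodule.span ℂ {f₁, f₁'} = formSpace 3 1 (T : Set Plane))
    (hg₁ : g₁ ∈ formSpace 6 2 (T : Set Plane)) :
    ∃ c : ℂ, jacobianDet f₁ f₁' g₁ = C c * jacobianDet f f' g := by
  obtain ⟨a, b, rfl⟩ := D.exists_cubic (h := f₁) (by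
    rw [← h₁]; exact Submodule.subset_span (by simp))
  obtain ⟨a', b', rfl⟩ := D.exists_cubic (h := f₁') (by
    rw [← h₁]; exact Submodule.subset_span (by simp))
  obtain ⟨p, q, r, e, rfl⟩ := D.exists_sextic hg₁
  exact ⟨_, jacobianDet_combination f f' g a b a' b' p q r e⟩

theorem cubics_independent {a b : ℂ} (h : C a * f + C b * f' = 0) : a = 0 ∧ b = 0 := by
  have hli : LinearIndependent ℂ ![f, f'] := by
    rw [linearIndependent_iff_card_le_finrank_span, Set.finrank]
    have : Set.range ![f, f'] = {f, f'} := by simp [Matrix.range_cons, Set.pair_comm]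
    rw [this, D.cubics]
    simpa using two_le_finrank_cubics D.card
  rw [LinearIndependent.pair_iff] at hli
  exact hli a b (by rwa [smul_eq_C_mul, smul_eq_C_mul])

theorem sextics_independent {a b c e : ℂ}
    (h : C a * f ^ 2 + C b * (f * f') + C c * f' ^ 2 + C e * g = 0) : e = 0 := by
  have hli : LinearIndependent ℂ ![f ^ 2, f * f', f' ^ 2, g] := by
    rw [linearIndependent_iff_card_le_finrank_span, Set.finrank]
    have : Set.range ![f ^ 2, f * f', f' ^ 2, g] = {f ^ 2, f * f', f' ^ 2, g} := by
      simp only [Matrix.range_cons, Matrix.range_empty, Set.union_empty, Set.singleton_union]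
    rw [this, D.sextics]
    simpa using four_le_finrank_sextics D.card
  have := Fintype.linearIndependent_iff.mp hli ![a, b, c, e] (by
    simpa [Fin.sum_univ_four, smul_eq_C_mul] using h) 3
  simpa using this

theorem mem_left_ninth : f ∈ pointIdeal M := by
  by_contra h
  have := D.ninth M
  rw [(interNum_eq_zero_iff _ _ _).mpr (Or.inl h), if_pos rfl] at this
  exact absurd this.symm (by simp)

theorem mem_right_ninth : f' ∈ pointIdeal M := by
  by_contra h
  have := D.ninth M
  rw [(interNum_eq_zero_iff _ _ _).mpr (Or.inr h), if_pos rfl] at this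
  exact absurd this.symm (by simp)

theorem mem_base_of_mem {P : Plane} (h1 : f ∈ pointIdeal P) (h2 : f' ∈ pointIdeal P) :
    P ∈ T ∨ P = M := by
  by_contra! h
  have := D.ninth P
  rw [if_neg h.1, if_neg h.2, add_zero, interNum_eq_zero_iff] at this
  exact this.elim (fun h => h h1) (fun h => h h2)

theorem finite_base : {P : Plane | OnCurve f P ∧ OnCurve f' P}.Finite := by
  refine (T.finite_toSet.insert M).subset fun P hP => ?_
  rcases D.mem_base_of_mem ((mem_pointIdeal_iff D.isHomogeneous_left P).mpr hP.1)
    ((mem_pointIdeal_iff D.isHomogeneous_right P).mpr hP.2) with h | h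
  · exact Set.mem_insert_of_mem _ h
  · rw [h]; exact Set.mem_insert _ _

theorem interNum_eq_one {P : Plane} (hP : P ∈ T) (hPM : P ≠ M) : interNum f f' P = 1 := by
  rw [D.ninth P, if_pos hP, if_neg hPM, add_zero]

theorem interNum_ninth_of_notMem (hM : M ∉ T) : interNum f f' M = 1 := by
  rw [D.ninth M, if_neg hM, if_pos rfl, zero_add]

theorem interNum_ninth_of_mem (hM : M ∈ T) : interNum f f' M = 2 := by
  rw [D.ninth M, if_pos hM, if_pos rfl, one_add_one_eq_two]

theorem transverse {P : Plane} (hP : P ∈ T) (hPM : P ≠ M) : Transverse f f' P :=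
  transverse_of_interNum_eq_one (D.mem_left hP) (D.mem_right hP) (D.interNum_eq_one hP hPM)

theorem transverse_ninth (hM : M ∉ T) : Transverse f f' M :=
  transverse_of_interNum_eq_one D.mem_left_ninth D.mem_right_ninth (D.interNum_ninth_of_notMem hM)

/-- By Noether's theorem, a sextic singular along `T` that also vanishes at the ninth point is a
combination of `f` and `f'` with cubic coefficients. -/
theorem exists_eq_add_of_mem_sextics {G : Poly} (hG : G ∈ formSpace 6 2 (T : Set Plane))
    (hGM : G ∈ pointIdeal M) :
    ∃ A B : Poly, A.IsHomogeneous 3 ∧ B.IsHomogeneous 3 ∧ G = A * f + B * f' := by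
  obtain ⟨hG6, hGT⟩ := mem_formSpace.mp hG
  have h1 : G ∈ Ideal.span {f, f'} := by
    refine mem_span_pair_of_local D.isHomogeneous_left D.isHomogeneous_right hG6 D.finite_base
      fun P hP hP' => ?_
    replace hP := (mem_pointIdeal_iff D.isHomogeneous_left P).mpr hP
    replace hP' := (mem_pointIdeal_iff D.isHomogeneous_right P).mpr hP'
    rw [← mem_locIdeal]
    rcases eq_or_ne P M with rfl | hPM
    · by_cases hMT : P ∈ T
      · exact sq_le_locIdeal_of_interNum_le_two hP hP' (D.interNum_ninth_of_mem hMT).le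
          (hGT P hMT)
      · exact le_locIdeal_of_interNum_eq_one hP hP' (D.interNum_ninth_of_notMem hMT) hGM
    · have hPT := (D.mem_base_of_mem hP hP').resolve_right hPM
      exact le_locIdeal_of_interNum_eq_one hP hP' (D.interNum_eq_one hPT hPM)
        (Ideal.pow_le_self two_ne_zero (hGT P hPT))
  exact exists_isHomogeneous_of_mem_span_pair (c := 3) (d := 3) D.isHomogeneous_left
    D.isHomogeneous_right hG6 rfl h1

/-- The sextics `A * f + B * f'` with `A, B` cubics through `T` are the quadratic forms in
`f, f'`. -/
theorem not_eq_combination {G A B : Poly} {a b c : ℂ}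
    (hGg : G = g - (C a * f ^ 2 + C b * (f * f') + C c * f' ^ 2))
    (hA : A ∈ formSpace 3 1 (T : Set Plane)) (hB : B ∈ formSpace 3 1 (T : Set Plane)) :
    G ≠ A * f + B * f' := by
  rintro rfl
  obtain ⟨p, q, rfl⟩ := D.exists_cubic hA
  obtain ⟨r, s, rfl⟩ := D.exists_cubic hB
  have := D.sextics_independent (a := -a - p) (b := -b - q - r) (c := -c - s) (e := 1) (by
    simp only [C_sub, C_neg, C_1]
    linear_combination -hGg)
  exact one_ne_zero this

theorem sextic_sub_mem (a b c : ℂ) :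
    g - (C a * f ^ 2 + C b * (f * f') + C c * f' ^ 2) ∈ formSpace 6 2 (T : Set Plane) :=
  sub_mem D.mem_sextics_right (D.quadratic_mem a b c)

/-- If `g` vanished at the ninth point `M ∉ T`, it would lie in the span of `f ^ 2`, `f * f'`,
`f' ^ 2` by Noether's theorem. -/
theorem sextic_notMem_ninth (hM : M ∉ T) : g ∉ pointIdeal M := by
  intro h
  obtain ⟨A, B, hA, hB, e⟩ := D.exists_eq_add_of_mem_sextics D.mem_sextics_right h
  have hAB : ∀ P ∈ (T : Set Plane), A ∈ pointIdeal P ∧ B ∈ pointIdeal P := fun P hP => by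
    have hPM : P ≠ M := fun h => hM (h ▸ hP)
    exact (D.transverse hP hPM).mem_and_mem D.isHomogeneous_left D.isHomogeneous_right hA hB
      (D.mem_left hP) (D.mem_right hP) (e ▸ D.mem_sextic hP)
  refine D.not_eq_combination (a := 0) (b := 0) (c := 0) rfl
    (mem_formSpace.mpr ⟨hA, fun P hP => ?_⟩) (mem_formSpace.mpr ⟨hB, fun P hP => ?_⟩) (by
      rw [← e]; simp)
  · rw [pow_one]; exact (hAB P hP).1
  · rw [pow_one]; exact (hAB P hP).2

theorem isHomogeneous_jacobianDet : (jacobianDet f f' g).IsHomogeneous 9 := by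
  have h1 := D.isHomogeneous_left
  have h2 := D.isHomogeneous_right
  have h3 := D.isHomogeneous_sextic
  have key : ∀ i j k, (pderiv i f * pderiv j f' * pderiv k g).IsHomogeneous 9 := fun i j k =>
    (h1.pderiv.mul h2.pderiv).mul h3.pderiv
  rw [jacobianDet, Matrix.det_fin_three]
  exact (((((key _ _ _).sub (key _ _ _)).sub (by
    simpa [mul_comm, mul_left_comm, mul_assoc] using key 1 0 2)).add (key _ _ _)).add
      (key _ _ _)).sub (key _ _ _)

theorem jacobianDet_mem_cube {P : Plane} (hP : P ∈ T) :
    jacobianDet f f' g ∈ pointIdeal P ^ 3 :=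
  CobleNonic.jacobianDet_mem_cube D.isHomogeneous_left D.isHomogeneous_right
    D.isHomogeneous_sextic (D.mem_left hP) (D.mem_right hP) (D.mem_sextic hP)

/-- At `M ∉ T` the cubics are transverse and `g` does not vanish, so the gradients are linearly
independent. -/
theorem jacobianDet_notMem_ninth (hM : M ∉ T) : jacobianDet f f' g ∉ pointIdeal M := by
  intro h
  rw [mem_pointIdeal_iff D.isHomogeneous_jacobianDet] at h
  obtain ⟨a, b, e, h0, h1, h2⟩ := exists_dependent_of_jacobianDet D.isHomogeneous_left
    D.isHomogeneous_right D.isHomogeneous_sextic h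
  have hf := D.mem_left_ninth
  have hf' := D.mem_right_ninth
  have hg := D.sextic_notMem_ninth hM
  rw [mem_pointIdeal_iff D.isHomogeneous_left] at hf
  rw [mem_pointIdeal_iff D.isHomogeneous_right] at hf'
  rw [mem_pointIdeal_iff D.isHomogeneous_sextic] at hg
  have he : e = 0 := by simpa [hf, hf', hg] using h2
  have hab := D.transverse_ninth hM a b (by
    rw [mem_sq_iff (n := 2) ((D.isHomogeneous_left.C_mul _).add (D.isHomogeneous_right.C_mul _))]
    intro k
    simpa [he] using h1 k)
  exact h0 ⟨hab.1, hab.2, he⟩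

/-- The key case of a tangent pencil, in a basis adapted to the base point. -/
theorem jacobianDet_notMem_of_tangent (hM : M ∈ T) (hf2 : f ∉ pointIdeal M ^ 2)
    (hf'2 : f' ∈ pointIdeal M ^ 2) : jacobianDet f f' g ∉ pointIdeal M ^ 4 := by
  intro hj
  have hloc := notMem_locIdeal_cube_of_interNum_le_two (D.mem_left hM) hf2
    (D.interNum_ninth_of_mem hM).le
  have hf'3 : f' ∉ pointIdeal M ^ 3 := fun h => hloc (le_locIdeal _ _ (Ideal.mem_sup_right h))
  obtain ⟨c, hc⟩ := mem_of_tangent_of_jacobianDet_mem D.isHomogeneous_left D.isHomogeneous_right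
    D.isHomogeneous_sextic (D.mem_left hM) hf2 hf'2 hf'3 (D.mem_sextic hM) hj
  have hG : g - C c * f ^ 2 = g - (C c * f ^ 2 + C 0 * (f * f') + C 0 * f' ^ 2) := by simp
  have hGm : g - C c * f ^ 2 ∈ formSpace 6 2 (T : Set Plane) := by
    rw [hG]; exact D.sextic_sub_mem _ _ _
  obtain ⟨A, B, hA, hB, e⟩ := D.exists_eq_add_of_mem_sextics hGm
    (Ideal.pow_le_self three_ne_zero hc)
  have hAB : ∀ P ∈ (T : Set Plane), A ∈ pointIdeal P ∧ B ∈ pointIdeal P := fun P hP => by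
    rcases eq_or_ne P M with rfl | hPM
    · have hA1 : A ∈ pointIdeal P := by
        have h1 : f * A ∈ pointIdeal P ^ (1 + 1) := by
          have h2 : f * A = g - C c * f ^ 2 - B * f' := by rw [e]; ring
          rw [h2]
          exact sub_mem (Ideal.pow_le_pow_right (by norm_num) hc) (Ideal.mul_mem_left _ _ hf'2)
        simpa using mem_pow_of_mul_mem hf2 h1
      refine ⟨hA1, ?_⟩
      by_contra hB1
      -- otherwise `f'` would agree with a multiple of `f` up to order three
      refine hloc (mem_locIdeal.mpr ⟨B, hB1, ?_⟩)
      have h2 : B * f' = (-A) * f + (g - C c * f ^ 2) := by rw [e]; ring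
      rw [h2]
      exact add_mem (Ideal.mem_sup_left (Ideal.mul_mem_left _ _ (Ideal.mem_span_singleton_self f)))
        (Ideal.mem_sup_right hc)
    · exact (D.transverse hP hPM).mem_and_mem D.isHomogeneous_left D.isHomogeneous_right hA hB
        (D.mem_left hP) (D.mem_right hP) (e ▸ (mem_formSpace.mp hGm).2 P hP)
  refine D.not_eq_combination hG (mem_formSpace.mpr ⟨hA, fun P hP => ?_⟩)
    (mem_formSpace.mpr ⟨hB, fun P hP => ?_⟩) e
  · rw [pow_one]; exact (hAB P hP).1
  · rw [pow_one]; exact (hAB P hP).2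

/-- If `M ∈ T`, the pencil is tangent at `M`, and `j` has multiplicity exactly three there. -/
theorem jacobianDet_notMem_ninth_pow_four (hM : M ∈ T) :
    jacobianDet f f' g ∉ pointIdeal M ^ 4 := by
  intro hj
  have hnt := not_transverse_of_interNum_eq_two D.isHomogeneous_left D.isHomogeneous_right
    (D.mem_left hM) (D.mem_right hM) (D.interNum_ninth_of_mem hM)
  simp only [Transverse, not_forall] at hnt
  obtain ⟨a, b, hab, hne⟩ := hnt
  -- `h'` is the member of the pencil singular at `M`
  set h' := C a * f + C b * f' with hh'
  have main : ∀ h : Poly, h ∉ pointIdeal M ^ 2 →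
      Submodule.span ℂ {h, h'} = Submodule.span ℂ {f, f'} → False := by
    intro h hh2 hspan
    have hs := hspan.trans D.cubics
    obtain ⟨c, hc⟩ := D.exists_jacobianDet_eq hs D.mem_sextics_right
    refine (D.changeBasis hs).jacobianDet_notMem_of_tangent hM hh2 hab ?_
    rw [hc]
    exact Ideal.mul_mem_left _ _ hj
  rcases notMem_sq_or_notMem_sq (D.interNum_ninth_of_mem hM).le with h | h
  · have hb : b ≠ 0 := by
      rintro rfl
      have ha : a ≠ 0 := fun ha => hne ⟨ha, rfl⟩
      rw [hh', C_0, zero_mul, add_zero, C_mul_mem_iff ha] at hab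
      exact h hab
    exact main f h (span_pair_combination_eq f f' a hb)
  · have ha : a ≠ 0 := by
      rintro rfl
      have hb : b ≠ 0 := fun hb => hne ⟨rfl, hb⟩
      rw [hh', C_0, zero_mul, zero_add, C_mul_mem_iff hb] at hab
      exact h hab
    refine main f' h ?_
    rw [hh', add_comm, span_pair_combination_eq f' f b ha, Set.pair_comm]

theorem jacobianDet_ne_zero : jacobianDet f f' g ≠ 0 := by
  intro h0
  by_cases hM : M ∈ T
  · exact D.jacobianDet_notMem_ninth_pow_four hM (h0 ▸ zero_mem _)
  · exact D.jacobianDet_notMem_ninth hM (h0 ▸ zero_mem _)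

end NonicData

/-! ### Sextics singular at a ninth point of a nonsingular cubic -/

theorem exists_isHomogeneous_eq_mul_of_dvd {f G : Poly} {a c : ℕ} (hf : f.IsHomogeneous a)
    (hG : G.IsHomogeneous (c + a)) (h : f ∣ G) : ∃ A : Poly, A.IsHomogeneous c ∧ G = A * f := by
  obtain ⟨A, rfl⟩ := h
  refine ⟨homogeneousComponent c A, homogeneousComponent_isHomogeneous _ _, ?_⟩
  rw [← homogeneousComponent_mul_of_isHomogeneous hf, mul_comm A, homogeneousComponent_of_mem hG,
    if_pos rfl]

theorem one_lt_finrank_of_notMem_span {V : Submodule ℂ Poly} [FiniteDimensional ℂ V] {x y : Poly}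
    (hx : x ∈ V) (hy : y ∈ V) (hx0 : x ≠ 0) (h : y ∉ Submodule.span ℂ {x}) :
    1 < Module.finrank ℂ V := by
  rw [← finrank_span_singleton (K := ℂ) hx0]
  refine Submodule.finrank_lt_finrank_of_lt (lt_of_le_of_ne ?_ fun e => h (e ▸ hy))
  rwa [Submodule.span_singleton_le_iff_mem]

/-- A form vanishing to order two along `V(f)` at `P` has gradient proportional to that of `f`. -/
theorem exists_eval_pderiv_eq_mul {f G : Poly} {m n : ℕ} (hf : f.IsHomogeneous (m + 1))
    (hG : G.IsHomogeneous (n + 1)) {P : Plane} (hP : OnCurve f P)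
    (h : G ∈ locIdeal P (Ideal.span {f} ⊔ pointIdeal P ^ 2)) :
    ∃ c : ℂ, ∀ k, eval P.rep (pderiv k G) = c * eval P.rep (pderiv k f) := by
  obtain ⟨s, hs, hsG⟩ := mem_locIdeal.mp h
  obtain ⟨x, hx, q, hq, e⟩ := Submodule.mem_sup.mp hsG
  obtain ⟨r, rfl⟩ := Ideal.mem_span_singleton.mp hx
  have hfm := (mem_pointIdeal_iff hf P).mpr hP
  have hGm : G ∈ pointIdeal P := by
    refine ((pointIdeal_isPrime P).mem_or_mem ?_).resolve_left hs
    rw [← e]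
    exact add_mem (Ideal.mul_mem_right _ _ hfm) (Ideal.pow_le_self two_ne_zero hq)
  have hzero : ∀ F ∈ pointIdeal P, ∀ t : ℂ, eval (t • P.rep) F = 0 := fun F hF t => by
    rw [← eval_aeval_mul_X, (RingHom.mem_ker.mp hF :), Polynomial.eval_zero]
  -- `s` does not vanish identically on the line over `P`
  obtain ⟨t, ht⟩ : ∃ t : ℂ, t * eval (t • P.rep) s ≠ 0 := by
    by_contra! hcon
    have h0 : Polynomial.X * aeval (R := ℂ) (fun i : Fin 3 =>
        Polynomial.C (P.rep i) * (Polynomial.X : Polynomial ℂ)) s = 0 :=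
      Polynomial.funext fun t => by
        rw [Polynomial.eval_mul, Polynomial.eval_X, eval_aeval_mul_X, hcon, Polynomial.eval_zero]
    exact hs ((mul_eq_zero.mp h0).resolve_left Polynomial.X_ne_zero)
  have ht0 : t ≠ 0 := left_ne_zero_of_mul ht
  have hs0 : eval (t • P.rep) s ≠ 0 := right_ne_zero_of_mul ht
  refine ⟨eval (t • P.rep) r * t ^ m / (eval (t • P.rep) s * t ^ n), fun k => ?_⟩
  have h1 := congrArg (fun F => eval (t • P.rep) (pderiv k F)) e
  simp only [map_add, mul_comm f r, eval_pderiv_mul_of_eval_eq_zero (hzero f hfm t),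
    eval_pderiv_mul_of_eval_eq_zero (hzero G hGm t)] at h1
  have hq' : pderiv k q ∈ pointIdeal P := by
    simpa using derivation_mem_pow (pderiv k) (pointIdeal P) 1 hq
  rw [hzero _ hq', add_zero, eval_smul_of_isHomogeneous hf.pderiv,
    eval_smul_of_isHomogeneous hG.pderiv] at h1
  simp only [Nat.add_sub_cancel] at h1
  field_simp
  linear_combination -h1

namespace NonicData

variable {T : Finset Plane} {f f' g : Poly} {M : Plane} (D : NonicData T f f' g M)

include D

theorem not_dvd : ¬ f ∣ f' := by
  intro h
  obtain ⟨A, hA, e⟩ := exists_isHomogeneous_eq_mul_of_dvd (c := 0) D.isHomogeneous_left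
    D.isHomogeneous_right h
  rw [← totalDegree_zero_iff_isHomogeneous, totalDegree_eq_zero_iff_eq_C] at hA
  have := D.cubics_independent (a := coeff 0 A) (b := -1) (by
    rw [← hA, C_neg, C_1, e]; ring)
  exact neg_ne_zero.mpr one_ne_zero this.2

/-- The sextics singular along `T` that contain the nonsingular cubic `V(f)` are `f` times the
cubics of the pencil. -/
theorem exists_of_dvd (hns : Nonsingular f) {G : Poly} (hG : G ∈ formSpace 6 2 (T : Set Plane))
    (h : f ∣ G) : ∃ a b : ℂ, G = f * (C a * f + C b * f') := by
  obtain ⟨hG6, hGT⟩ := mem_formSpace.mp hG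
  obtain ⟨A, hA, e⟩ := exists_isHomogeneous_eq_mul_of_dvd (c := 3) D.isHomogeneous_left hG6 h
  obtain ⟨a, b, rfl⟩ := D.exists_cubic (h := A) (mem_formSpace.mpr ⟨hA, fun P hP => by
    refine mem_pow_of_mul_mem (m := 1) (hns.notMem_sq D.isHomogeneous_left
      ((mem_pointIdeal_iff D.isHomogeneous_left P).mp (D.mem_left hP))) ?_
    rw [mul_comm, ← e]
    exact hGT P hP⟩)
  exact ⟨a, b, by rw [e, mul_comm]⟩

open scoped Classical in
theorem interNum_sq_right (hns : Nonsingular f) {R : Plane} (hR : OnCurve f R) :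
    interNum f (f' ^ 2) R =
      (((if R ∈ T then 2 else 0) + (if R = M then 2 else 0) : ℕ) : ℕ∞) := by
  rw [pow_two, interNum_mul D.isHomogeneous_left hns hR, D.ninth R]
  split_ifs <;> norm_num

theorem not_dvd_sq_right (hns : Nonsingular f) : ¬ f ∣ f' ^ 2 := fun h =>
  D.not_dvd ((hns.prime D.isHomogeneous_left).dvd_of_dvd_pow h)

open scoped Classical in
/-- By Bézout, a sextic that meets the nonsingular cubic `V(f)` at least in `2 T + 2 Q` meets it
in no further point; comparison with `f' ^ 2` shows `2 Q ∼ 2 M`. -/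
theorem linEquivOn_of_le_interNum (hns : Nonsingular f) {Q : Plane} (hQ : OnCurve f Q) {G : Poly}
    (hG : G.IsHomogeneous 6) (hfG : ¬ f ∣ G)
    (h : ∀ R, OnCurve f R →
      (((if R ∈ T then 2 else 0) + (if R = Q then 2 else 0) : ℕ) : ℕ∞) ≤ interNum f G R) :
    LinEquivOn f (Finsupp.single Q 2) (Finsupp.single M 2) := by
  set E : Plane →₀ ℕ := ∑ P ∈ T, Finsupp.single P 2 + Finsupp.single Q 2 with hE
  have hE' : ∀ R, E R = (if R ∈ T then 2 else 0) + (if R = Q then 2 else 0) := fun R => by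
    rw [hE, Finsupp.add_apply, Finsupp.finsetSum_apply]
    simp [Finsupp.single_apply, eq_comm]
  have h2 := interNum_eq_of_sum_eq D.isHomogeneous_left hns hG hfG E (fun R hR => ?_)
    (fun R hR => by rw [hE']; exact h R hR) ?_
  · refine ⟨6, G, f' ^ 2, hG, D.isHomogeneous_right.pow 2, hfG, D.not_dvd_sq_right hns,
      fun R hR => ?_⟩
    rw [h2 R hR, D.interNum_sq_right hns hR, ENat.toNat_natCast, ENat.toNat_natCast, hE']
    simp only [Finsupp.single_apply, eq_comm (b := R)]
    push_cast
    ring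
  · rw [Finsupp.mem_support_iff, hE'] at hR
    by_cases hRQ : R = Q
    · rwa [hRQ]
    · have hRT : R ∈ T := by
        by_contra hRT
        simp [hRQ, hRT] at hR
      exact (mem_pointIdeal_iff D.isHomogeneous_left R).mp (D.mem_left hRT)
  · have : E.sum (fun _ m => m) = E.degree := rfl
    rw [this, hE, map_add, map_sum]
    simp [D.card]

/-- If `j` has multiplicity four at `P`, some sextic `g - q(f, f')` has a quadruple point at `P`,
and it meets `V(f)` in `2 T + 2 P`. -/
theorem linEquivOn_of_jacobianDet_mem (hns : Nonsingular f) {P : Plane} (hP : P ∈ T)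
    (hPM : P ≠ M) (hj : jacobianDet f f' g ∈ pointIdeal P ^ 4) :
    LinEquivOn f (Finsupp.single P 2) (Finsupp.single M 2) := by
  classical
  obtain ⟨a, b, c, h3⟩ := (D.transverse hP hPM).exists_quadratic D.isHomogeneous_left
    D.isHomogeneous_right D.isHomogeneous_sextic (D.mem_left hP) (D.mem_right hP) (D.mem_sextic hP)
  have hG := D.sextic_sub_mem a b c
  set G := g - (C a * f ^ 2 + C b * (f * f') + C c * f' ^ 2) with hGdef
  have hGeq : G = C (-a) * f ^ 2 + C (-b) * (f * f') + C (-c) * f' ^ 2 + C 1 * g := by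
    rw [hGdef, C_neg, C_neg, C_neg, C_1]; ring
  obtain ⟨hG6, hGT⟩ := mem_formSpace.mp hG
  have h4 : G ∈ pointIdeal P ^ 4 := by
    refine (D.transverse hP hPM).mem_of_jacobianDet_mem D.isHomogeneous_left
      D.isHomogeneous_right hG6 (D.mem_left hP) (D.mem_right hP) h3 ?_
    rwa [hGeq, jacobianDet_add_quadratic, C_1, one_mul]
  have hfG : ¬ f ∣ G := fun h => by
    obtain ⟨p, q, e⟩ := D.exists_of_dvd hns hG h
    refine one_ne_zero (D.sextics_independent (a := -a - p) (b := -b - q) (c := -c) (e := 1) ?_)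
    simp only [C_sub, C_neg, C_1]
    linear_combination e - hGdef
  have hPf := (mem_pointIdeal_iff D.isHomogeneous_left P).mp (D.mem_left hP)
  refine D.linEquivOn_of_le_interNum hns hPf hG6 hfG fun R hR => ?_
  by_cases hRP : R = P
  · subst hRP
    rw [if_pos hP, if_pos rfl]
    exact natCast_le_interNum D.isHomogeneous_left hns hR h4
  · by_cases hRT : R ∈ T
    · rw [if_pos hRT, if_neg hRP]
      exact natCast_le_interNum D.isHomogeneous_left hns hR (hGT R hRT)
    · rw [if_neg hRT, if_neg hRP]
      exact bot_le

/-- If `j` has multiplicity four at `P ≠ M`, then `2 P ∼ 2 M` on every nonsingular cubic of the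
pencil: the Jacobian does not depend on the basis of the pencil. -/
theorem linEquivOn_of_mem_cubics {h : Poly} (hh : h ∈ formSpace 3 1 (T : Set Plane))
    (hns : Nonsingular h) {P : Plane} (hP : P ∈ T) (hPM : P ≠ M)
    (hj : jacobianDet f f' g ∈ pointIdeal P ^ 4) :
    LinEquivOn h (Finsupp.single P 2) (Finsupp.single M 2) := by
  obtain ⟨h', hs⟩ : ∃ h', Submodule.span ℂ {h, h'} = formSpace 3 1 (T : Set Plane) := by
    have h0 : h ≠ 0 := (hns.prime (n := 2) (mem_formSpace.mp hh).1).ne_zero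
    obtain ⟨a, b, rfl⟩ := D.exists_cubic hh
    by_cases hb : b = 0
    · have ha : a ≠ 0 := by
        rintro rfl
        exact h0 (by simp [hb])
      refine ⟨f', ?_⟩
      rw [Set.pair_comm, add_comm, span_pair_combination_eq f' f b ha, Set.pair_comm, D.cubics]
    · exact ⟨f, by rw [Set.pair_comm, span_pair_combination_eq f f' a hb, D.cubics]⟩
  obtain ⟨c, hc⟩ := D.exists_jacobianDet_eq hs D.mem_sextics_right
  refine (D.changeBasis hs).linEquivOn_of_jacobianDet_mem hns hP hPM ?_
  rw [hc]
  exact Ideal.mul_mem_left _ _ hj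

section Point

variable (hns : Nonsingular f) {Q : Plane} (hQ : OnCurve f Q) (hQT : Q ∉ T) (hQM : Q ≠ M)

include hQ hQT hQM

theorem right_notMem : f' ∉ pointIdeal Q := fun h =>
  (D.mem_base_of_mem ((mem_pointIdeal_iff D.isHomogeneous_left Q).mpr hQ) h).elim hQT hQM

theorem eval_right_ne_zero : eval Q.rep f' ≠ 0 := fun h =>
  D.right_notMem hQ hQT hQM ((mem_pointIdeal_iff D.isHomogeneous_right Q).mpr h)

omit hQT hQM in
theorem left_mem_of_mem_insert {P : Plane} (hP : P ∈ insert Q (T : Set Plane)) :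
    f ∈ pointIdeal P := by
  rcases hP with rfl | hP
  · exact (mem_pointIdeal_iff D.isHomogeneous_left P).mpr hQ
  · exact D.mem_left hP

include hns

/-- The only sextics through `2 T + 2 Q` containing `V(f)` are the multiples of `f ^ 2`. -/
theorem one_lt_finrank_iff :
    1 < Module.finrank ℂ (formSpace 6 2 (insert Q (T : Set Plane))) ↔
      ∃ G ∈ formSpace 6 2 (insert Q (T : Set Plane)), ¬ f ∣ G := by
  have hf2 : f ^ 2 ∈ formSpace 6 2 (insert Q (T : Set Plane)) :=
    mem_formSpace.mpr ⟨D.isHomogeneous_left.pow 2, fun P hP =>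
      Ideal.pow_mem_pow (D.left_mem_of_mem_insert hQ hP) 2⟩
  constructor
  · intro h
    obtain ⟨G, hG, hG'⟩ : ∃ G ∈ formSpace 6 2 (insert Q (T : Set Plane)),
        G ∉ Submodule.span ℂ {f ^ 2} := by
      by_contra! hcon
      exact absurd ((Submodule.finrank_mono hcon).trans (finrank_span_le_card _)) (by simpa using h)
    refine ⟨G, hG, fun hd => hG' ?_⟩
    obtain ⟨hG6, hGT⟩ := mem_formSpace.mp hG
    obtain ⟨a, b, rfl⟩ := D.exists_of_dvd hns
      (mem_formSpace.mpr ⟨hG6, fun P hP => hGT P (Set.mem_insert_of_mem _ hP)⟩) hd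
    have h1 : C a * f + C b * f' ∈ pointIdeal Q ^ 1 :=
      mem_pow_of_mul_mem (m := 1) (hns.notMem_sq D.isHomogeneous_left hQ)
        (hGT Q (Set.mem_insert _ _))
    rw [pow_one] at h1
    have h2 : C b * f' ∈ pointIdeal Q := (Ideal.add_mem_iff_right _
      (Ideal.mul_mem_left _ _ (D.left_mem_of_mem_insert hQ (Set.mem_insert _ _)))).mp h1
    have hb : b = 0 := by
      by_contra hb
      exact D.right_notMem hQ hQT hQM ((C_mul_mem_iff hb).mp h2)
    rw [hb, Submodule.mem_span_singleton]
    exact ⟨a, by rw [smul_eq_C_mul, C_0]; ring⟩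
  · rintro ⟨G, hG, hd⟩
    refine one_lt_finrank_of_notMem_span hf2 hG
      (pow_ne_zero 2 (hns.prime D.isHomogeneous_left).ne_zero) fun hs => hd ?_
    obtain ⟨a, rfl⟩ := Submodule.mem_span_singleton.mp hs
    rw [smul_eq_C_mul]
    exact Dvd.dvd.mul_left (dvd_pow_self f two_ne_zero) _

theorem linEquivOn_of_one_lt_finrank
    (h : 1 < Module.finrank ℂ (formSpace 6 2 (insert Q (T : Set Plane)))) :
    LinEquivOn f (Finsupp.single Q 2) (Finsupp.single M 2) := by
  classical
  obtain ⟨G, hG, hd⟩ := (D.one_lt_finrank_iff hns hQ hQT hQM).mp h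
  obtain ⟨hG6, hGT⟩ := mem_formSpace.mp hG
  refine D.linEquivOn_of_le_interNum hns hQ hG6 hd fun R hR => ?_
  by_cases hRT : R ∈ T
  · have hRQ : R ≠ Q := fun h => hQT (h ▸ hRT)
    rw [if_pos hRT, if_neg hRQ]
    exact natCast_le_interNum D.isHomogeneous_left hns hR (hGT R (Set.mem_insert_of_mem _ hRT))
  · rw [if_neg hRT]
    split_ifs with hRQ
    · exact natCast_le_interNum D.isHomogeneous_left hns hR (hGT R (hRQ ▸ Set.mem_insert _ _))
    · exact bot_le

/-- A sextic through `2 T + 2 Q` not divisible by `f` may replace `g` in the Jacobian, and its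
gradient vanishes at `Q`. -/
theorem onCurve_jacobianDet_of_one_lt_finrank
    (h : 1 < Module.finrank ℂ (formSpace 6 2 (insert Q (T : Set Plane)))) :
    OnCurve (jacobianDet f f' g) Q := by
  obtain ⟨G, hG, hd⟩ := (D.one_lt_finrank_iff hns hQ hQT hQM).mp h
  obtain ⟨hG6, hGT⟩ := mem_formSpace.mp hG
  have hGQ := hGT Q (Set.mem_insert _ _)
  have hrow := (mem_sq_iff (n := 5) hG6 Q).mp hGQ
  have hG0 := (mem_pointIdeal_iff hG6 Q).mp (Ideal.pow_le_self two_ne_zero hGQ)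
  have hj : eval Q.rep (jacobianDet f f' G) = 0 := by
    simp only [jacobianDet, Matrix.det_fin_three, Matrix.of_apply, Matrix.cons_val_zero,
      Matrix.cons_val_one, Matrix.cons_val, map_add, map_sub, map_mul, hrow, mul_zero, add_zero,
      sub_zero]
  obtain ⟨a, b, c, e, hGe⟩ := D.exists_sextic
    (mem_formSpace.mpr ⟨hG6, fun P hP => hGT P (Set.mem_insert_of_mem _ hP)⟩)
  have he : e ≠ 0 := by
    rintro rfl
    have hf0 : eval Q.rep f = 0 := hQ
    have hc : c = 0 := by
      rw [hGe] at hG0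
      simpa [hf0, D.eval_right_ne_zero hQ hQT hQM] using hG0
    exact hd ⟨C a * f + C b * f', by rw [hGe, hc, C_0]; ring⟩
  rw [hGe, jacobianDet_add_quadratic, map_mul, eval_C] at hj
  exact (mul_eq_zero.mp hj).resolve_left he

/-- If `j` vanishes at `Q`, the sextic `g` corrected by multiples of `f' ^ 2` and `f * f'` is
singular at `Q`. -/
theorem one_lt_finrank_of_onCurve_jacobianDet (h : OnCurve (jacobianDet f f' g) Q) :
    1 < Module.finrank ℂ (formSpace 6 2 (insert Q (T : Set Plane))) := by
  rw [D.one_lt_finrank_iff hns hQ hQT hQM]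
  have hf'0 := D.eval_right_ne_zero hQ hQT hQM
  have hf0 : eval Q.rep f = 0 := hQ
  -- subtracting a multiple of `f' ^ 2` makes the sextic vanish at `Q`
  set c := eval Q.rep g / eval Q.rep f' ^ 2 with hc
  set G₀ := g - (C 0 * f ^ 2 + C 0 * (f * f') + C c * f' ^ 2) with hG₀
  have hG₀m : G₀ ∈ formSpace 6 2 (T : Set Plane) := D.sextic_sub_mem _ _ _
  have hG₀eq : G₀ = C 0 * f ^ 2 + C 0 * (f * f') + C (-c) * f' ^ 2 + C 1 * g := by
    rw [hG₀, C_neg, C_0, C_1]; ring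
  have hG₀0 : eval Q.rep G₀ = 0 := by
    rw [hG₀]
    simp only [map_sub, map_add, map_mul, map_pow, eval_C, hc]
    field_simp
    ring
  obtain ⟨a, b, e, hne, hk, hv⟩ := exists_dependent_of_jacobianDet D.isHomogeneous_left
    D.isHomogeneous_right (mem_formSpace.mp hG₀m).1 (v := Q.rep) (by
      rw [hG₀eq, jacobianDet_add_quadratic, map_mul,
        show eval Q.rep (jacobianDet f f' g) = 0 from h, mul_zero])
  have hb : b = 0 := by simpa [hf0, hG₀0, hf'0] using hv
  subst hb
  have he : e ≠ 0 := by
    rintro rfl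
    obtain ⟨i, hi⟩ := hns Q hQ
    have ha : a = 0 := by simpa [hi] using hk i
    exact hne ⟨ha, rfl, rfl⟩
  -- subtracting a multiple of `f * f'` then kills the gradient at `Q`
  set μ := -a / (e * eval Q.rep f') with hμ
  have hG : G₀ - C μ * (f * f') = g - (C 0 * f ^ 2 + C μ * (f * f') + C c * f' ^ 2) := by
    rw [hG₀, C_0]; ring
  obtain ⟨hG6, hGT⟩ := mem_formSpace.mp (hG ▸ D.sextic_sub_mem 0 μ c)
  have hGm : G₀ - C μ * (f * f') ∈ formSpace 6 2 (T : Set Plane) := mem_formSpace.mpr ⟨hG6, hGT⟩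
  refine ⟨G₀ - C μ * (f * f'), mem_formSpace.mpr ⟨hG6, ?_⟩, fun hd => ?_⟩
  · rintro P (rfl | hP)
    · rw [mem_sq_iff (n := 5) hG6]
      intro k
      have h1 : C μ * (f * f') = (C μ * f') * f := by ring
      rw [map_sub, map_sub, h1, eval_pderiv_mul_of_eval_eq_zero hf0, map_mul, eval_C, hμ]
      field_simp
      linear_combination hk k
    · exact hGT P hP
  · obtain ⟨p, q, e'⟩ := D.exists_of_dvd hns hGm hd
    refine one_ne_zero (D.sextics_independent (a := -p) (b := -μ - q) (c := -c) (e := 1) ?_)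
    simp only [C_sub, C_neg, C_1]
    linear_combination e' - hG + (f ^ 2) * (C_0 : (C 0 : Poly) = 0)

omit hns in
/-- The nine points `T ∪ {Q}` impose independent conditions on cubics. -/
theorem exists_cubic_eval_eq (c : Plane → ℂ) :
    ∃ h : Poly, h.IsHomogeneous 3 ∧ ∀ P ∈ insert Q (T : Set Plane), eval P.rep h = c P := by
  classical
  have hker : Module.finrank ℂ (evalMap 3 (insert Q T)).ker ≤ 1 := by
    refine (finrank_ker_evalMap_le 3 (insert Q T)).trans ?_
    have hle : formSpace 3 1 ((insert Q T : Finset Plane) : Set Plane) ≤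
        Submodule.span ℂ {f} := by
      intro h hh
      obtain ⟨h3, hT⟩ := mem_formSpace.mp hh
      obtain ⟨a, b, rfl⟩ := D.exists_cubic (mem_formSpace.mpr
        ⟨h3, fun P hP => hT P (by simpa using Or.inr hP)⟩)
      have h1 := hT Q (by simp)
      rw [pow_one] at h1
      have h2 : C b * f' ∈ pointIdeal Q := (Ideal.add_mem_iff_right _
        (Ideal.mul_mem_left _ _ (D.left_mem_of_mem_insert hQ (Set.mem_insert _ _)))).mp h1
      have hb : b = 0 := by
        by_contra hb
        exact D.right_notMem hQ hQT hQM ((C_mul_mem_iff hb).mp h2)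
      rw [hb, Submodule.mem_span_singleton]
      exact ⟨a, by rw [smul_eq_C_mul, C_0]; ring⟩
    exact (Submodule.finrank_mono hle).trans ((finrank_span_le_card _).trans (by simp))
  have hsurj : (evalMap 3 (insert Q T)).range = ⊤ := by
    have h1 := (evalMap 3 (insert Q T)).finrank_range_add_finrank_ker
    have h2 := Submodule.finrank_le (evalMap 3 (insert Q T)).range
    have h3 : (3 + 2).choose 2 = 10 := rfl
    apply Submodule.eq_top_of_finrank_eq
    rw [finrank_homogeneousSubmodule, h3] at h1
    rw [Module.finrank_fintype_fun_eq_card, Fintype.card_coe, Finset.card_insert_of_notMem hQT,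
      D.card] at h2 ⊢
    omega
  obtain ⟨h, hh⟩ := LinearMap.range_eq_top.mp hsurj fun P => c P.1
  refine ⟨h.1, h.2, fun P hP => ?_⟩
  exact congrFun hh ⟨P, by simpa using hP⟩

open scoped Classical in
/-- A rational function with divisor `2 Q - 2 M`, multiplied by `f' ^ 2`, is cut out by a sextic
according to Noether's theorem. -/
theorem exists_sextic_of_linEquivOn (h : LinEquivOn f (Finsupp.single Q 2) (Finsupp.single M 2)) :
    ∃ G : Poly, G.IsHomogeneous 6 ∧ ¬ f ∣ G ∧ ∀ R ∈ insert Q (T : Set Plane),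
      OnCurve f R → ((2 : ℕ) : ℕ∞) ≤ interNum f G R := by
  have hf := D.isHomogeneous_left
  obtain ⟨d, a, b, ha, hb, hfa, hfb, hab⟩ := h
  have key : ∀ R, OnCurve f R → interNum f (f' ^ 2 * a) R =
      (((if R ∈ T then 2 else 0) + (if R = Q then 2 else 0) : ℕ) : ℕ∞) + interNum f b R := by
    intro R hR
    have h1 := hab R hR
    rw [interNum_mul hf hns hR, D.interNum_sq_right hns hR]
    obtain ⟨x, hx⟩ := ENat.ne_top_iff_exists.mp (interNum_ne_top hf hns hR hfa)
    obtain ⟨y, hy⟩ := ENat.ne_top_iff_exists.mp (interNum_ne_top hf hns hR hfb)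
    rw [← hx, ← hy] at h1 ⊢
    simp only [Finsupp.single_apply, eq_comm (b := R), ENat.toNat_natCast] at h1
    norm_cast
    split_ifs at h1 ⊢ <;> omega
  have hF : (f' ^ 2 * a).IsHomogeneous ((d + 3) + 3) := by
    have := (D.isHomogeneous_right.pow 2).mul ha
    rwa [show 3 * 2 + d = d + 3 + 3 by ring] at this
  have hfF : ¬ f ∣ f' ^ 2 * a := fun h =>
    ((hns.prime hf).dvd_or_dvd h).elim (D.not_dvd_sq_right hns) hfa
  have hmem : f' ^ 2 * a ∈ Ideal.span {f, b} := by
    refine mem_span_pair_of_local hf hb hF (finite_inter hf hns hb hfb) fun R hR _ => ?_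
    rw [← mem_locIdeal]
    refine mem_locIdeal_of_interNum_le hf hns hR ?_
    rw [key R hR]
    exact le_add_self
  obtain ⟨A, G, hA, hG, e⟩ := exists_isHomogeneous_of_mem_span_pair (d := 6) hf hb hF (by ring) hmem
  refine ⟨G, hG, fun hd => hfF ?_, fun R hRT hR => ?_⟩
  · rw [e]
    exact dvd_add (dvd_mul_left f A) (hd.mul_right b)
  · have h1 : interNum f (f' ^ 2 * a) R = interNum f (G * b) R :=
      interNum_eq_of_dvd_sub ⟨A, by rw [e]; ring⟩
    rw [key R hR, interNum_mul hf hns hR] at h1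
    rw [← ENat.add_left_injective_of_ne_top (interNum_ne_top hf hns hR hfb) h1, Nat.cast_le]
    rcases hRT with rfl | hRT
    · simp
    · rw [if_pos (Finset.mem_coe.mp hRT)]
      omega

/-- The sextic cut out by the rational function touches `V(f)` along `T ∪ {Q}`; a multiple of `f`
with a suitable cubic cofactor makes it singular there. -/
theorem one_lt_finrank_of_linEquivOn
    (h : LinEquivOn f (Finsupp.single Q 2) (Finsupp.single M 2)) :
    1 < Module.finrank ℂ (formSpace 6 2 (insert Q (T : Set Plane))) := by
  have hf := D.isHomogeneous_left
  rw [D.one_lt_finrank_iff hns hQ hQT hQM]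
  obtain ⟨G, hG, hfG, hG2⟩ := D.exists_sextic_of_linEquivOn hns hQ hQT hQM h
  have hon : ∀ P ∈ insert Q (T : Set Plane), OnCurve f P := fun P hP =>
    (mem_pointIdeal_iff hf P).mp (D.left_mem_of_mem_insert hQ hP)
  have h1 : ∀ P ∈ insert Q (T : Set Plane), ∃ c : ℂ, ∀ k,
      eval P.rep (pderiv k G) = c * eval P.rep (pderiv k f) := fun P hP =>
    exists_eval_pderiv_eq_mul (m := 2) (n := 5) hf hG (hon P hP)
      ((natCast_le_interNum_iff hf hns (hon P hP) 2 G).mp (hG2 P hP (hon P hP)))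
  choose! c hc using h1
  obtain ⟨u, hu, huc⟩ := D.exists_cubic_eval_eq hQ hQT hQM c
  have hG' : (G - u * f).IsHomogeneous 6 := hG.sub (hu.mul hf)
  refine ⟨G - u * f, mem_formSpace.mpr ⟨hG', fun P hP => ?_⟩, fun hd => hfG ?_⟩
  · rw [mem_sq_iff (n := 5) hG']
    intro k
    rw [map_sub, map_sub, eval_pderiv_mul_of_eval_eq_zero (hon P hP), hc P hP, huc P hP, sub_self]
  · exact (dvd_sub_left (dvd_mul_left f u)).mp hd

end Point

end NonicData

end CobleNonic

open CobleNonic in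
theorem mainTheorem7 (T : Finset Plane) (hcard : T.card = 8) (hT : GeneralEnough T)
    (f f' g : Poly)
    (hf : Submodule.span ℂ {f, f'} = formSpace 3 1 (T : Set Plane))
    (hg : Submodule.span ℂ {f ^ 2, f * f', f' ^ 2, g} = formSpace 6 2 (T : Set Plane))
    (M : Plane) (hM : IsNinthPoint T f f' M) :
    -- (a) `N_T = V(j)` has degree 9 and depends only on `T`
    ((jacobianDet f f' g).IsHomogeneous 9 ∧ jacobianDet f f' g ≠ 0 ∧
      ∀ f₁ f₁' g₁ : Poly,
        Submodule.span ℂ {f₁, f₁'} = formSpace 3 1 (T : Set Plane) →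
        Submodule.span ℂ {f₁ ^ 2, f₁ * f₁', f₁' ^ 2, g₁} = formSpace 6 2 (T : Set Plane) →
        ∃ c : ℂ, c ≠ 0 ∧ jacobianDet f₁ f₁' g₁ = MvPolynomial.C c * jacobianDet f f' g) ∧
    -- (b) multiplicity at least 3 at the points of `T`, and exactly 3 at `P` unless `P ≠ M`
    -- and `2P ∼ 2M` on every nonsingular cubic through `T`
    (∀ P ∈ T, MultGE (jacobianDet f f' g) 3 P ∧
      ((P = M ∨ ∃ h ∈ formSpace 3 1 (T : Set Plane), Nonsingular h ∧
          ¬ LinEquivOn h (Finsupp.single P 2) (Finsupp.single M 2)) →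
        ¬ MultGE (jacobianDet f f' g) 4 P)) ∧
    -- (c)
    (Nonsingular f →
      (∀ Q : Plane, OnCurve f Q → Q ∉ T → Q ≠ M →
        ((1 < Module.finrank ℂ (formSpace 6 2 (insert Q (T : Set Plane))) ↔
            LinEquivOn f (Finsupp.single Q 2) (Finsupp.single M 2)) ∧
          (LinEquivOn f (Finsupp.single Q 2) (Finsupp.single M 2) ↔
            OnCurve (jacobianDet f f' g) Q))) ∧
      (OnCurve (jacobianDet f f' g) M ↔ M ∈ T)) := by
  have D : NonicData T f f' g M := ⟨hcard, hf, hg, hM⟩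
  refine ⟨⟨D.isHomogeneous_jacobianDet, D.jacobianDet_ne_zero, fun f₁ f₁' g₁ h₁ h₂ => ?_⟩,
    fun P hP => ⟨D.jacobianDet_mem_cube hP, ?_⟩, fun hns => ⟨fun Q hQ hQT hQM => ?_, ?_, ?_⟩⟩
  · have hg₁ : g₁ ∈ formSpace 6 2 (T : Set Plane) := by
      rw [← h₂]; exact Submodule.subset_span (by simp)
    obtain ⟨c, hc⟩ := D.exists_jacobianDet_eq h₁ hg₁
    refine ⟨c, ?_, hc⟩
    rintro rfl
    have D₁ : NonicData T f₁ f₁' g₁ M := ⟨hcard, h₁, h₂, (D.changeBasis h₁).ninth⟩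
    exact D₁.jacobianDet_ne_zero (by rw [hc, MvPolynomial.C_0, zero_mul])
  · intro h hj
    by_cases hPM : P = M
    · exact D.jacobianDet_notMem_ninth_pow_four (hPM ▸ hP) (hPM ▸ hj)
    · obtain ⟨k, hk, hns, hle⟩ := h.resolve_left hPM
      exact hle (D.linEquivOn_of_mem_cubics hk hns hP hPM hj)
  · have h1 := D.linEquivOn_of_one_lt_finrank hns hQ hQT hQM
    have h2 := D.one_lt_finrank_of_linEquivOn hns hQ hQT hQM
    exact ⟨⟨h1, h2⟩, fun h => D.onCurve_jacobianDet_of_one_lt_finrank hns hQ hQT hQM (h2 h),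
      fun h => h1 (D.one_lt_finrank_of_onCurve_jacobianDet hns hQ hQT hQM h)⟩
  · intro h
    by_contra hMT
    exact D.jacobianDet_notMem_ninth hMT
      ((mem_pointIdeal_iff D.isHomogeneous_jacobianDet M).mpr h)
  · intro hMT
    exact (mem_pointIdeal_iff D.isHomogeneous_jacobianDet M).mp
      (Ideal.pow_le_self three_ne_zero (D.jacobianDet_mem_cube hMT))
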